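/- **Setting.** For $\mathbf A=(A_1,\dots,A_6)\in\mathbb R^6$ let $$\Psi_{\mathbf A}(t,s)=(t,\,s,\,A_1t^2+2A_2ts+A_3s^2,\,A_4t^2+2A_5ts+A_6s^2),$$ $$c_1=\det\begin{bmatrix}A_1&A_2\\A_4&A_5\end{bmatrix},\quad c_2=\det\begin{bmatrix}A_1&A_3\\A_4&A_6\end{bmatrix},\quad c_3=\det\begin{bmatrix}A_6&A_5\\A_3&A_2\end{bmatrix},$$ and for $L>0$ let $\mathcal L_L$ be the set of $\mathbf A$ with $|A_i|\le L$ for all $i$ and $\max\{|c_1|,|c_2|,|c_3|\}\ge L^{-1}$. For measurable $S\subset[0,1]^2$ and integrable $g:S\to\mathbb C$ put $E_Sg(x)=\int_S g(t,s)e^{2\pi i\,x\cdot\Psi_{\mathbf A}(t,s)}\,dt\,ds$, $x\in\mathbb R^4$. For a ball $B\subset\mathbb R^4$ with centre $c$ and radius $R$ put $w_B(x)=(1+|x-c|/R)^{-100}$ and $\|f\|_{L^p(w_B)}=(\int|f|^pw_B)^{1/p}$. Two sets $S_1,S_2\subset[0,1]^2$ are *$\nu$-transverse* if $$|c_1(t_1-t_2)^2+c_2(t_1-t_2)(s_1-s_2)+c_3(s_1-s_2)^2|\ge\nu\quad\text{for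 all }(t_i,s_i)\in S_i .$$ Squares have sides parallel to the axes and positive side length. For real $N\ge1$ and $2\le p<\infty$, sums over $\Delta$ run over the tiling of $[0,1]^2$ by dyadic squares at scale $N^{-1/2}$, that is, with side length $2^{-k}$ where $4^k\le N<4^{k+1}$ (so the side length is exactly $N^{-1/2}$ when $N$ is a power of $4$). * $D(N,p)=D_{\mathbf A}(N,p)$ is the smallest constant such that $$\|E_{[0,1]^2}g\|_{L^p(w_{B})}\le D(N,p)\Big(\sum_{\Delta}\|E_\Delta g\|_{L^p(w_{B})}^p\Big)^{1/p}$$ for all integrable $g:[0,1]^2\to\mathbb C$ and all balls $B\subset\mathbb R^4$ of radius $N$. * $D_{multi}(N,p,\nu)$ is the smallest constant such that $$\big\||E_{R_1}g_1E_{R_2}g_2|^{1/2}\big\|_{L^p(w_{B})}\le D_{multi}(N,p,\nu)\Big(\prod_{i=1}^2\sum_\Delta\|E_{\Delta}g_i\|_{L^p(w_{B})}^p\Big)^{\frac1{2p}}$$ for all $\nu$-transverse squares $R_1,R_2\subset[0,1]^2$ of arbitrary side lengths, all integrable $g_i:R_i\to\mathbb C$ (extended by $0$ outside $R_i$), and all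 balls $B\subset\mathbb R^4$ of radius $N$. **Theorem.** Let $L>0$. There are constants $C_\nu>0$ (depending only on $\nu$ and $L$) and $\epsilon(\nu,p)\in\mathbb R$ (depending only on $\nu$, $p$ and $L$), with $\lim_{\nu\to0^+}\epsilon(\nu,p)=0$ for each $p\ge2$, such that for all $0<\nu\le\frac1{10}$, all $2\le p<\infty$, all $\mathbf A\in\mathcal L_L$ for which at least one pair of $\nu$-transverse squares $R_1,R_2\subset[0,1]^2$ exists, and all real $N\ge1$, $$D(N,p)\le C_\nu N^{\epsilon(\nu,p)}\sup_{1\le M\le N}\Big(\frac MN\Big)^{\frac1p-\frac12}D_{multi}(M,p,\nu).$$ -/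

import Mathlib

open Set Filter Topology MeasureTheory
open scoped ENNReal

noncomputable section

namespace SurfaceDecoupling

/-- The coefficients `A₁, …, A₆` of a pair of binary quadratic forms; `A 0` is `A₁`, …,
`A 5` is `A₆`. -/
abbrev Coeffs := Fin 6 → ℝ

/-- The quadratic surface
`Ψ_A(t,s) = (t, s, A₁t² + 2A₂ts + A₃s², A₄t² + 2A₅ts + A₆s²)` in `ℝ⁴`. -/
def surface (A : Coeffs) (q : ℝ × ℝ) : EuclideanSpace ℝ (Fin 4) :=
  !₂[q.1, q.2,
    A 0 * q.1 ^ 2 + 2 * A 1 * q.1 * q.2 + A 2 * q.2 ^ 2,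
    A 3 * q.1 ^ 2 + 2 * A 4 * q.1 * q.2 + A 5 * q.2 ^ 2]

/-- The minor `det [A₁ A₂; A₄ A₅]`. -/
def minor₁ (A : Coeffs) : ℝ := Matrix.det !![A 0, A 1; A 3, A 4]

/-- The minor `det [A₁ A₃; A₄ A₆]`. -/
def minor₂ (A : Coeffs) : ℝ := Matrix.det !![A 0, A 2; A 3, A 5]

/-- The minor `det [A₆ A₅; A₃ A₂]`. -/
def minor₃ (A : Coeffs) : ℝ := Matrix.det !![A 5, A 4; A 2, A 1]

/-- The quantitatively nondegenerate coefficients: all entries are at most `L` in absolute value,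
and the largest `2 × 2` minor is at least `L⁻¹` in absolute value. -/
def admissible (L : ℝ) : Set Coeffs :=
  {A | (∀ i, |A i| ≤ L) ∧ L⁻¹ ≤ max |minor₁ A| (max |minor₂ A| |minor₃ A|)}

/-- The extension operator `E_S g(x) = ∫_S g(t,s) e(x·Ψ_A(t,s)) dt ds`, `e(z) = exp(2πiz)`. -/
def extension (A : Coeffs) (S : Set (ℝ × ℝ)) (g : ℝ × ℝ → ℂ)
    (x : EuclideanSpace ℝ (Fin 4)) : ℂ :=
  ∫ q in S, g q * Complex.exp (2 * Real.pi * Complex.I * ((inner ℝ x (surface A q) : ℝ) : ℂ))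

/-- The weight `w_B(x) = (1 + |x - c| / R)^(-100)` of the ball `B` with centre `c` and
radius `R`. -/
def ballWeight (c : EuclideanSpace ℝ (Fin 4)) (R : ℝ) (x : EuclideanSpace ℝ (Fin 4)) : ℝ :=
  1 / (1 + dist x c / R) ^ 100

/-- The weighted norm `‖f‖_{L^p(w_B)} = (∫ |f(x)|^p w_B(x) dx)^{1/p}`, with values in `[0, ∞]`,
where `B` has centre `c` and radius `R`. -/
def weightedNorm {F : Type*} [NormedAddCommGroup F] (p : ℝ) (c : EuclideanSpace ℝ (Fin 4))
    (R : ℝ) (f : EuclideanSpace ℝ (Fin 4) → F) : ℝ≥0∞ :=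
  (∫⁻ x, ‖f x‖ₑ ^ p * ENNReal.ofReal (ballWeight c R x)) ^ (1 / p)

/-- The square `[a, a + l] × [b, b + l]`, where `q = (a, b)`. -/
def square (q : ℝ × ℝ) (l : ℝ) : Set (ℝ × ℝ) :=
  Icc q.1 (q.1 + l) ×ˢ Icc q.2 (q.2 + l)

/-- The unit square `[0,1]²`. -/
def unitSquare : Set (ℝ × ℝ) := Icc 0 1 ×ˢ Icc 0 1

/-- `R` is a (nondegenerate, axis-parallel) square contained in `[0,1]²`. -/
def IsSubsquare (R : Set (ℝ × ℝ)) : Prop :=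
  R ⊆ unitSquare ∧ ∃ (q : ℝ × ℝ) (l : ℝ), 0 < l ∧ R = square q l

/-- For real `N ≥ 1`, the integer `k` with `4^k ≤ N < 4^(k+1)`: the dyadic squares at scale
`N^{-1/2}` have side length `2^{-k}`. This side length is exactly `N^{-1/2}` if `N` is a power
of `4`, and lies in `[N^{-1/2}, 2 N^{-1/2})` in general. -/
def level (N : ℝ) : ℕ := Nat.log 4 ⌊N⌋₊

/-- The indices of the dyadic squares that tile `[0,1]²` at scale `N^{-1/2}`. -/
abbrev CapIndex (N : ℝ) := Fin (2 ^ level N) × Fin (2 ^ level N)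

/-- The dyadic squares `Δ` that tile `[0,1]²` at scale `N^{-1/2}` (closed, hence overlapping in
null sets only). -/
def cap (N : ℝ) (i : CapIndex N) : Set (ℝ × ℝ) :=
  square ((i.1 : ℝ) / 2 ^ level N, (i.2 : ℝ) / 2 ^ level N) (1 / 2 ^ level N)

/-- Two sets are `ν`-transverse if
`|c₁(t₁-t₂)² + c₂(t₁-t₂)(s₁-s₂) + c₃(s₁-s₂)²| ≥ ν` for all their points `(t₁,s₁)`, `(t₂,s₂)`. -/
def Transverse (A : Coeffs) (ν : ℝ) (S₁ S₂ : Set (ℝ × ℝ)) : Prop :=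
  ∀ q₁ ∈ S₁, ∀ q₂ ∈ S₂,
    ν ≤ |minor₁ A * (q₁.1 - q₂.1) ^ 2 + minor₂ A * ((q₁.1 - q₂.1) * (q₁.2 - q₂.2))
          + minor₃ A * (q₁.2 - q₂.2) ^ 2|

/-- The linear decoupling constant `D(N,p)`: the smallest `D` such that
`‖E_{[0,1]²} g‖_{L^p(w_B)} ≤ D (∑_Δ ‖E_Δ g‖_{L^p(w_B)}^p)^{1/p}`
for all integrable `g` and all balls `B` of radius `N`. -/
def linearConst (A : Coeffs) (N p : ℝ) : ℝ≥0∞ :=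
  sInf {D : ℝ≥0∞ | ∀ (g : ℝ × ℝ → ℂ), IntegrableOn g unitSquare →
    ∀ c : EuclideanSpace ℝ (Fin 4),
      weightedNorm p c N (extension A unitSquare g) ≤
        D * (∑ i : CapIndex N, weightedNorm p c N (extension A (cap N i) g) ^ p) ^ (1 / p)}

/-- The bilinear decoupling constant `D_multi(N,p,ν)`: the smallest `D` such that
`‖|E_{R₁} g₁ E_{R₂} g₂|^{1/2}‖_{L^p(w_B)} ≤ D (∏_{i=1,2} ∑_Δ ‖E_Δ g_i‖_{L^p(w_B)}^p)^{1/(2p)}`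
for all `ν`-transverse squares `R₁, R₂ ⊆ [0,1]²`, all integrable `g_i : R_i → ℂ` and all balls
`B` of radius `N`. As `g_i` lives on `R_i`, `E_Δ g_i` is the integral over `Δ ∩ R_i`. -/
def bilinearConst (A : Coeffs) (N p ν : ℝ) : ℝ≥0∞ :=
  sInf {D : ℝ≥0∞ | ∀ R : Fin 2 → Set (ℝ × ℝ), (∀ j, IsSubsquare (R j)) →
    Transverse A ν (R 0) (R 1) →
    ∀ g : Fin 2 → ℝ × ℝ → ℂ, (∀ j, IntegrableOn (g j) (R j)) →
    ∀ c : EuclideanSpace ℝ (Fin 4),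
      weightedNorm p c N
          (fun x => ‖extension A (R 0) (g 0) x * extension A (R 1) (g 1) x‖ ^ (1 / 2 : ℝ)) ≤
        D * (∏ j : Fin 2, ∑ i : CapIndex N,
          weightedNorm p c N (extension A (cap N i ∩ R j) (g j)) ^ p) ^ (1 / (2 * p))}

end SurfaceDecoupling

end

open SurfaceDecoupling

/-! The proof is a Bourgain–Guth broad–narrow induction on scales. Choose m with 4^m ≤ 1/ν < 4^(m+1)
and tile the unit square by caps of side 2^(-m). At a given point either two significant caps are
ν-transverse, and the bilinear constant controls the whole sum up to a power of 4^m, or all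
significant caps are pairwise non-transverse. The form that measures transversality dominates a
product of two nondegenerate linear functionals, even when it is definite (`exists_factorization`).
Two non-transverse caps are therefore O(2^(-m))-close for one of the functionals, and a pairwise
non-transverse family lies in one strip of one functional (`exists_uniformly_close`). A strip holds
O(2^m) caps, which orthogonality separates at the cost O(2^m)^(1-2/p) (`exists_flat_decoupling`).
Each cap is an affine copy of the whole surface, so parabolic rescaling decouples it further
(`exists_rescaled_decoupling`). The outcome, `exists_linearConst_le_add`, is D(N) ≤ C (2^m)^(1-2/p)
D(N/4^m) + 4^(4m) D_multi(N), with C depending on L alone.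

Under iteration the powers of 2^m become exactly the weights (M/N)^(1/p-1/2) with M = N/4^(mi),
while a power a^j of a constant with 4^(mj) ≤ N is at most N^ε, where ε = log a / log 4^m tends to 0
with ν. Scales below 4^m are compared with D_multi(1), which is bounded below by a test on
indicators (`exists_le_bilinearConst_one`); this is where the existence of a transverse pair enters.

The delicate point is rescaling with weights of fixed decay and sharp caps. A ball of radius N
becomes a tube, much longer than r = N/4^m horizontally (in the first two coordinates), with weight
W. Averaging weights of r-balls against W does not return a multiple of W uniformly in m, since both
decay with the same power. The function is therefore localized first. Averaging g over modulated
translations of size δ/r (`spread`) changes E g little on the r-ball about a centre c. As a function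
of the horizontal part of c the result is a Fourier transform, so Bessel's inequality supplies the
missing horizontal integrability (`lintegral_spreadExt_rpow_le`, `RescaledWeight.packet_energy_le`).
Averaging over c and absorbing the small error then yields decoupling for W
(`RescaledWeight.average_le`). Since translations must not leave a cap, each cap is first cut
smoothly into four pieces, each with room to move in one quadrant of directions. -/

noncomputable section

namespace SurfaceDecoupling

/-! ### Coordinates on ℝ⁴, the extension operator and averages of translates -/

/-- The character `e(t) = exp(2πit)`. -/
def ee (t : ℝ) : ℂ := Complex.exp (2 * Real.pi * Complex.I * (t : ℂ))

lemma norm_ee (t : ℝ) : ‖ee t‖ = 1 := by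
  have : (2 * Real.pi * Complex.I * (t : ℂ)) = ((2 * Real.pi * t : ℝ) : ℂ) * Complex.I := by
    push_cast; ring
  rw [ee, this, Complex.norm_exp_ofReal_mul_I]

lemma ee_add (s t : ℝ) : ee (s + t) = ee s * ee t := by
  simp only [ee, ← Complex.exp_add]; congr 1; push_cast; ring

lemma continuous_ee : Continuous ee := by unfold ee; fun_prop

lemma conj_ee (t : ℝ) : (starRingEnd ℂ) (ee t) = ee (-t) := by
  simp only [ee, ← Complex.exp_conj]; congr 1; simp [Complex.conj_ofNat]

/-- The point of `ℝ⁴` with coordinates `(u, v)`. -/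
def pt (u v : ℝ × ℝ) : EuclideanSpace ℝ (Fin 4) := !₂[u.1, u.2, v.1, v.2]

/-- Translation vector in the first two coordinates. -/
abbrev tr (u : ℝ × ℝ) : EuclideanSpace ℝ (Fin 4) := pt u 0

lemma pt_add (u v u' v' : ℝ × ℝ) : pt u v + pt u' v' = pt (u + u') (v + v') := by
  ext i; fin_cases i <;> simp [pt]

lemma pt_sub (u v u' v' : ℝ × ℝ) : pt u v - pt u' v' = pt (u - u') (v - v') := by
  ext i; fin_cases i <;> simp [pt]

lemma continuous_pt : Continuous fun z : (ℝ × ℝ) × (ℝ × ℝ) => pt z.1 z.2 := by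
  unfold pt
  refine (PiLp.continuous_toLp 2 _).comp ?_
  refine continuous_pi fun i => ?_
  fin_cases i <;> simp <;> fun_prop

@[fun_prop]
lemma Continuous.pt' {X : Type*} [TopologicalSpace X] {f g : X → ℝ × ℝ} (hf : Continuous f)
    (hg : Continuous g) : Continuous fun x => pt (f x) (g x) :=
  continuous_pt.comp (hf.prodMk hg)

/-- Every point of `ℝ⁴` is of the form `pt u v`. -/
def hpart (x : EuclideanSpace ℝ (Fin 4)) : ℝ × ℝ := (x 0, x 1)

/-- The last two coordinates. -/
def vpart (x : EuclideanSpace ℝ (Fin 4)) : ℝ × ℝ := (x 2, x 3)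

lemma pt_parts (x : EuclideanSpace ℝ (Fin 4)) : pt (hpart x) (vpart x) = x := by
  ext i; fin_cases i <;> simp [pt, hpart, vpart]

@[simp] lemma hpart_pt (u v : ℝ × ℝ) : hpart (pt u v) = u := by simp [pt, hpart]
@[simp] lemma vpart_pt (u v : ℝ × ℝ) : vpart (pt u v) = v := by simp [pt, vpart]

@[fun_prop] lemma continuous_hpart : Continuous hpart := by unfold hpart; fun_prop
@[fun_prop] lemma continuous_vpart : Continuous vpart := by unfold vpart; fun_prop

lemma measurePreserving_ptEquiv :
    MeasurePreserving (fun z : (ℝ × ℝ) × (ℝ × ℝ) => pt z.1 z.2) := by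
  have h1 : MeasurePreserving (MeasurableEquiv.finTwoArrow (α := ℝ)).symm :=
    (volume_preserving_finTwoArrow ℝ).symm _
  have h2 := h1.prod h1
  have h3 := (volume_measurePreserving_sumPiEquivProdPi_symm (fun _ : Fin 2 ⊕ Fin 2 => ℝ)).comp h2
  have h4 := (volume_measurePreserving_piCongrLeft (fun _ : Fin 4 => ℝ)
    (finSumFinEquiv (m := 2) (n := 2))).comp h3
  have h5 := (PiLp.volume_preserving_toLp (Fin 4)).comp h4
  refine (?_ : (fun z : (ℝ × ℝ) × (ℝ × ℝ) => pt z.1 z.2) = _) ▸ h5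
  funext z
  ext i
  have : ∀ j : Fin 2 ⊕ Fin 2, (MeasurableEquiv.piCongrLeft (fun _ : Fin 4 => ℝ)
      (finSumFinEquiv (m := 2) (n := 2)))
      ((MeasurableEquiv.sumPiEquivProdPi fun _ : Fin 2 ⊕ Fin 2 => ℝ).symm
        (Prod.map (MeasurableEquiv.finTwoArrow (α := ℝ)).symm
          (MeasurableEquiv.finTwoArrow (α := ℝ)).symm z)) (finSumFinEquiv j) =
      ((MeasurableEquiv.sumPiEquivProdPi fun _ : Fin 2 ⊕ Fin 2 => ℝ).symm
        (Prod.map (MeasurableEquiv.finTwoArrow (α := ℝ)).symm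
          (MeasurableEquiv.finTwoArrow (α := ℝ)).symm z)) j := fun j =>
    Equiv.piCongrLeft_apply_apply _ _ _ _
  fin_cases i
  · exact (this (Sum.inl 0)).symm
  · exact (this (Sum.inl 1)).symm
  · exact (this (Sum.inr 0)).symm
  · exact (this (Sum.inr 1)).symm

/-- The vertical variable is outermost because the horizontal shifts met later depend on v only, so
that the inner integral is translation invariant. -/
lemma lintegral_pt (f : EuclideanSpace ℝ (Fin 4) → ℝ≥0∞) (hf : Measurable f) :
    ∫⁻ x, f x = ∫⁻ v : ℝ × ℝ, ∫⁻ u : ℝ × ℝ, f (pt u v) := by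
  rw [← measurePreserving_ptEquiv.lintegral_comp hf]
  exact lintegral_prod_symm _ (hf.comp continuous_pt.measurable).aemeasurable

/-- The first quadratic form. -/
def quad₁ (A : Coeffs) (q : ℝ × ℝ) : ℝ := A 0 * q.1 ^ 2 + 2 * A 1 * q.1 * q.2 + A 2 * q.2 ^ 2

/-- The second quadratic form. -/
def quad₂ (A : Coeffs) (q : ℝ × ℝ) : ℝ := A 3 * q.1 ^ 2 + 2 * A 4 * q.1 * q.2 + A 5 * q.2 ^ 2

lemma inner_pt (A : Coeffs) (u v q : ℝ × ℝ) :
    inner ℝ (pt u v) (surface A q) =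
      u.1 * q.1 + u.2 * q.2 + v.1 * quad₁ A q + v.2 * quad₂ A q := by
  simp [pt, surface, quad₁, quad₂, PiLp.inner_apply, Fin.sum_univ_four]
  ring

lemma inner_tr (A : Coeffs) (u q : ℝ × ℝ) :
    inner ℝ (tr u) (surface A q) = u.1 * q.1 + u.2 * q.2 := by
  simp [inner_pt]

/-- `grad A w v · q` is the polarization `2 (v₁ B₁(w,q) + v₂ B₂(w,q))`. -/
def grad (A : Coeffs) (w v : ℝ × ℝ) : ℝ × ℝ :=
  (2 * (v.1 * (A 0 * w.1 + A 1 * w.2) + v.2 * (A 3 * w.1 + A 4 * w.2)),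
    2 * (v.1 * (A 1 * w.1 + A 2 * w.2) + v.2 * (A 4 * w.1 + A 5 * w.2)))

/-- The surface is quadratic, so the cross term between q and w is linear in q and acts as a
horizontal translation of x. Both the spreading of functions and parabolic rescaling rest on this
identity. -/
lemma inner_surface_add (A : Coeffs) (x : EuclideanSpace ℝ (Fin 4)) (q w : ℝ × ℝ) :
    inner ℝ x (surface A (q + w)) = inner ℝ x (surface A q) +
      inner ℝ (tr (grad A w (vpart x))) (surface A q) + inner ℝ x (surface A w) := by
  obtain ⟨u, v, rfl⟩ : ∃ u v, x = pt u v := ⟨_, _, (pt_parts x).symm⟩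
  rw [vpart_pt, inner_tr, inner_pt, inner_pt, inner_pt]
  simp only [quad₁, quad₂, grad, Prod.fst_add, Prod.snd_add]
  ring

lemma continuous_surface (A : Coeffs) : Continuous (surface A) := by
  unfold surface
  refine (PiLp.continuous_toLp 2 _).comp ?_
  refine continuous_pi fun i => ?_
  fin_cases i <;> simp <;> fun_prop

lemma extension_eq (A : Coeffs) (S : Set (ℝ × ℝ)) (g : ℝ × ℝ → ℂ)
    (x : EuclideanSpace ℝ (Fin 4)) :
    extension A S g x = ∫ q in S, g q * ee (inner ℝ x (surface A q)) := rfl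

lemma continuous_phase_right (A : Coeffs) (x : EuclideanSpace ℝ (Fin 4)) :
    Continuous fun q => ee (inner ℝ x (surface A q)) :=
  continuous_ee.comp (continuous_const.inner (continuous_surface A))

lemma integrable_mul_bdd {X : Type*} [MeasurableSpace X] {μ : Measure X} {g h : X → ℂ}
    (hg : Integrable g μ) (hh : AEStronglyMeasurable h μ) {C : ℝ} (hC : ∀ x, ‖h x‖ ≤ C) :
    Integrable (fun q => g q * h q) μ :=
  hg.mul_bdd hh (Filter.Eventually.of_forall hC)

lemma integrable_phase (A : Coeffs) {μ : Measure (ℝ × ℝ)} {g : ℝ × ℝ → ℂ}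
    (hg : Integrable g μ) (x : EuclideanSpace ℝ (Fin 4)) :
    Integrable (fun q => g q * ee (inner ℝ x (surface A q))) μ :=
  integrable_mul_bdd hg (continuous_phase_right A x).aestronglyMeasurable
    fun _ => (norm_ee _).le

lemma norm_extension_le (A : Coeffs) (S : Set (ℝ × ℝ)) (g : ℝ × ℝ → ℂ)
    (x : EuclideanSpace ℝ (Fin 4)) : ‖extension A S g x‖ ≤ ∫ q in S, ‖g q‖ := by
  rw [extension_eq]
  refine (norm_integral_le_integral_norm _).trans (le_of_eq ?_)
  simp [norm_ee]

@[fun_prop]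
lemma continuous_extension (A : Coeffs) {S : Set (ℝ × ℝ)} {g : ℝ × ℝ → ℂ}
    (hg : IntegrableOn g S) : Continuous (extension A S g) := by
  refine continuous_of_dominated (F := fun x q => g q * ee (inner ℝ x (surface A q)))
    (bound := fun q => ‖g q‖) (fun x => (integrable_phase A hg x).aestronglyMeasurable)
    (fun x => ae_of_all _ fun _ => by simp [norm_ee]) hg.norm (ae_of_all _ fun q => ?_)
  exact continuous_const.mul (continuous_ee.comp (continuous_id.inner continuous_const))

lemma extension_congr (A : Coeffs) {S : Set (ℝ × ℝ)} (hS : MeasurableSet S) {g h : ℝ × ℝ → ℂ}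
    (hgh : ∀ q ∈ S, g q = h q) : extension A S g = extension A S h := by
  funext x
  exact setIntegral_congr_fun hS fun q hq => by simp [hgh q hq]

lemma extension_univ_indicator (A : Coeffs) {S : Set (ℝ × ℝ)} (hS : MeasurableSet S)
    (g : ℝ × ℝ → ℂ) : extension A univ (S.indicator g) = extension A S g := by
  funext x
  simp only [extension_eq, Measure.restrict_univ]
  rw [← integral_indicator hS]
  congr 1; funext q; by_cases h : q ∈ S <;> simp [h]

lemma extension_translate (A : Coeffs) (S : Set (ℝ × ℝ)) (g : ℝ × ℝ → ℂ)
    (x z : EuclideanSpace ℝ (Fin 4)) :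
    extension A S (fun q => g q * ee (inner ℝ z (surface A q))) x = extension A S g (x + z) := by
  simp only [extension_eq]
  congr 1; funext q
  rw [inner_add_left, ee_add]; ring

/-- Multiplying `g` by a superposition of characters superposes translates of `E g`. -/
lemma extension_mul_superposition (A : Coeffs) {Z : Type*} [MeasurableSpace Z]
    {μ : Measure Z} [SFinite μ] {S : Set (ℝ × ℝ)} (hS : MeasurableSet S) {g : ℝ × ℝ → ℂ}
    (hg : IntegrableOn g S) {k : Z → ℂ} (hk : Integrable k μ)
    {ι : Z → EuclideanSpace ℝ (Fin 4)} (hι : Measurable ι) {m : ℝ × ℝ → ℂ}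
    (hm : ∀ q ∈ S, m q = ∫ z, k z * ee (inner ℝ (ι z) (surface A q)) ∂μ)
    (x : EuclideanSpace ℝ (Fin 4)) :
    extension A S (fun q => g q * m q) x = ∫ z, k z * extension A S g (x + ι z) ∂μ := by
  have hint : Integrable (fun w : (ℝ × ℝ) × Z => (g w.1 * k w.2) *
      ee (inner ℝ (x + ι w.2) (surface A w.1))) ((volume.restrict S).prod μ) := by
    refine integrable_mul_bdd (Integrable.mul_prod hg hk) ?_ (fun _ => (norm_ee _).le)
    refine Measurable.aestronglyMeasurable ?_
    exact continuous_ee.measurable.comp (Measurable.inner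
      (measurable_const.add (hι.comp measurable_snd))
      ((continuous_surface A).measurable.comp measurable_fst))
  rw [extension_eq]
  calc ∫ q in S, g q * m q * ee (inner ℝ x (surface A q))
      = ∫ q in S, ∫ z, (g q * k z) * ee (inner ℝ (x + ι z) (surface A q)) ∂μ := by
        refine setIntegral_congr_fun hS fun q hq => ?_
        simp only [hm q hq]
        rw [← integral_const_mul, ← integral_mul_const]
        congr 1; funext z
        rw [inner_add_left, ee_add]; ring
    _ = ∫ z, (∫ q in S, (g q * k z) * ee (inner ℝ (x + ι z) (surface A q))) ∂μ :=
        integral_integral_swap hint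
    _ = _ := by
        congr 1; funext z
        rw [extension_eq, ← integral_const_mul]
        congr 1; funext q; ring

/-- Jensen's inequality for a kernel. -/
lemma lintegral_kernel_rpow_le {Z : Type*} [MeasurableSpace Z] {μ : Measure Z} {p : ℝ}
    (hp : 1 ≤ p) {κ h : Z → ℝ≥0∞} (hκ : Measurable κ) (hh : Measurable h) :
    (∫⁻ z, κ z * h z ∂μ) ^ p ≤ (∫⁻ z, κ z ∂μ) ^ (p - 1) * ∫⁻ z, κ z * h z ^ p ∂μ := by
  have hp0 : 0 < p := by linarith
  rcases eq_or_lt_of_le hp with rfl | hp1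
  · simp
  have hq : (p.conjExponent).HolderConjugate p := (Real.HolderConjugate.conjExponent hp1).symm
  -- Splitting κ between the two Hölder factors leaves the total mass of κ in one of them and κ h^p
  -- in the other.
  have hmul : ∀ z, κ z * h z = κ z ^ (1 / p.conjExponent) * (κ z ^ (1 / p) * h z) := by
    intro z
    rw [← mul_assoc, ← ENNReal.rpow_add_of_nonneg _ _ (by have := hq.pos; positivity)
      (by positivity)]
    have := hq.inv_add_inv_eq_one
    simp only [one_div]
    rw [this, ENNReal.rpow_one]
  have key := ENNReal.lintegral_mul_le_Lp_mul_Lq μ hq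
    (f := fun z => κ z ^ (1 / p.conjExponent)) (g := fun z => κ z ^ (1 / p) * h z)
    (hκ.pow_const _).aemeasurable ((hκ.pow_const _).mul hh).aemeasurable
  have e1 : ∀ z, (κ z ^ (1 / p.conjExponent)) ^ p.conjExponent = κ z := fun z => by
    rw [← ENNReal.rpow_mul, one_div, inv_mul_cancel₀ hq.pos.ne', ENNReal.rpow_one]
  have e2 : ∀ z, (κ z ^ (1 / p) * h z) ^ p = κ z * h z ^ p := fun z => by
    rw [ENNReal.mul_rpow_of_nonneg _ _ hp0.le, ← ENNReal.rpow_mul, one_div,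
      inv_mul_cancel₀ hp0.ne', ENNReal.rpow_one]
  simp only [Pi.mul_apply, ← hmul, e1, e2] at key
  calc (∫⁻ z, κ z * h z ∂μ) ^ p
      ≤ ((∫⁻ z, κ z ∂μ) ^ (1 / p.conjExponent) * (∫⁻ z, κ z * h z ^ p ∂μ) ^ (1 / p)) ^ p := by
        gcongr
    _ = _ := by
        rw [ENNReal.mul_rpow_of_nonneg _ _ hp0.le, ← ENNReal.rpow_mul, ← ENNReal.rpow_mul]
        congr 2
        · have := hq.inv_add_inv_eq_one
          have h3 : (p.conjExponent)⁻¹ = 1 - p⁻¹ := by linarith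
          rw [one_div, h3]; field_simp
        · rw [one_div, inv_mul_cancel₀ hp0.ne', ENNReal.rpow_one]

/-- The weighted `L^p` integral. -/
def wint {F : Type*} [NormedAddCommGroup F] (p : ℝ) (W : EuclideanSpace ℝ (Fin 4) → ℝ≥0∞)
    (f : EuclideanSpace ℝ (Fin 4) → F) : ℝ≥0∞ := ∫⁻ x, ‖f x‖ₑ ^ p * W x

/-- A function dominated by an average of translates of `f` has weighted norm bounded by that of
`f`, if the weight is controlled by its translates. -/
lemma lintegral_rpow_le_of_kernel {E : Type*} [NormedAddCommGroup E] [MeasurableSpace E]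
    [BorelSpace E] [SecondCountableTopology E] {vol : Measure E} [SFinite vol]
    [vol.IsAddRightInvariant] {Z : Type*} [MeasurableSpace Z] {μ : Measure Z} [SFinite μ] {p : ℝ}
    (hp : 1 ≤ p) {κ : Z → ℝ≥0∞} (hκ : Measurable κ) {ι : Z → E}
    (hι : Measurable ι) {W : E → ℝ≥0∞} (hW : Measurable W)
    {f : E → ℂ} (hf : Measurable f)
    {F : E → ℝ≥0∞}
    (hF : ∀ x, F x ≤ ∫⁻ z, κ z * ‖f (x + ι z)‖ₑ ∂μ) {a b : ℝ≥0∞}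
    (ha : ∫⁻ z, κ z ∂μ ≤ a) (hb : ∀ x, ∫⁻ z, κ z * W (x - ι z) ∂μ ≤ b * W x) :
    ∫⁻ x, F x ^ p * W x ∂vol ≤ a ^ (p - 1) * b * ∫⁻ x, ‖f x‖ₑ ^ p * W x ∂vol := by
  have hp0 : 0 ≤ p := by linarith
  have hfe : Measurable fun w : E × Z => ‖f (w.1 + ι w.2)‖ₑ ^ p :=
    ((hf.comp (measurable_fst.add (hι.comp measurable_snd))).enorm).pow_const _
  calc ∫⁻ x, F x ^ p * W x ∂vol
      ≤ ∫⁻ x, (a ^ (p - 1) * ∫⁻ z, κ z * ‖f (x + ι z)‖ₑ ^ p ∂μ) * W x ∂vol := by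
        refine lintegral_mono fun x => ?_
        dsimp only
        gcongr
        refine (ENNReal.rpow_le_rpow (hF x) hp0).trans
          ((lintegral_kernel_rpow_le hp hκ ?_).trans ?_)
        · exact (hf.comp (measurable_const.add hι)).enorm
        · gcongr
    _ = a ^ (p - 1) * ∫⁻ x, ∫⁻ z, κ z * ‖f (x + ι z)‖ₑ ^ p * W x ∂μ ∂vol := by
        rw [← lintegral_const_mul]
        · refine lintegral_congr fun x => ?_
          rw [mul_assoc, lintegral_mul_const]
          exact hκ.mul (hfe.comp (measurable_const.prodMk measurable_id))
        · exact Measurable.lintegral_prod_right' (f := fun w : E × Z =>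
            κ w.2 * ‖f (w.1 + ι w.2)‖ₑ ^ p * W w.1)
            (((hκ.comp measurable_snd).mul hfe).mul (hW.comp measurable_fst))
    _ = a ^ (p - 1) * ∫⁻ z, ∫⁻ x, κ z * ‖f (x + ι z)‖ₑ ^ p * W x ∂vol ∂μ := by
        rw [lintegral_lintegral_swap]
        exact (((hκ.comp measurable_snd).mul hfe).mul (hW.comp measurable_fst)).aemeasurable
    -- After Fubini the substitution x ↦ x - ι z moves the translation from f to W, where the
    -- hypothesis `hb` applies.
    _ = a ^ (p - 1) * ∫⁻ z, (∫⁻ x, κ z * ‖f x‖ₑ ^ p * W (x - ι z) ∂vol) ∂μ := by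
        congr 1
        refine lintegral_congr fun z => ?_
        rw [← lintegral_add_right_eq_self
          (fun x => κ z * ‖f x‖ₑ ^ p * W (x - ι z)) (ι z)]
        simp
    _ = a ^ (p - 1) * ∫⁻ x, ∫⁻ z, κ z * ‖f x‖ₑ ^ p * W (x - ι z) ∂μ ∂vol := by
        rw [lintegral_lintegral_swap]
        refine Measurable.aemeasurable ?_
        exact ((hκ.comp measurable_fst).mul ((hf.comp measurable_snd).enorm.pow_const _)).mul
          (hW.comp (measurable_snd.sub (hι.comp measurable_fst)))
    _ ≤ a ^ (p - 1) * ∫⁻ x, b * (‖f x‖ₑ ^ p * W x) ∂vol := by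
        refine mul_le_mul_right (lintegral_mono fun x => ?_) _
        dsimp only
        calc ∫⁻ z, κ z * ‖f x‖ₑ ^ p * W (x - ι z) ∂μ
            = ∫⁻ z, ‖f x‖ₑ ^ p * (κ z * W (x - ι z)) ∂μ := by
              refine lintegral_congr fun z => ?_
              ring
          _ = ‖f x‖ₑ ^ p * ∫⁻ z, κ z * W (x - ι z) ∂μ := by
              rw [lintegral_const_mul]
              exact hκ.mul (hW.comp (measurable_const.sub hι))
          _ ≤ ‖f x‖ₑ ^ p * (b * W x) := by gcongr; exact hb x
          _ = _ := by ring
    _ = _ := by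
        rw [lintegral_const_mul, mul_assoc]
        exact (hf.enorm.pow_const _).mul hW

end SurfaceDecoupling
end

/-! ### Schwartz multipliers and local constancy -/

noncomputable section

namespace SurfaceDecoupling

open scoped SchwartzMap FourierTransform ContDiff

/-- A smooth function on `[0,1]` is a superposition of characters with a Schwartz density. -/
lemma exists_schwartz_density (f : ℝ → ℂ) (hf : ContDiff ℝ ∞ f) :
    ∃ k : 𝓢(ℝ, ℂ), ∀ t ∈ Icc (0 : ℝ) 1, f t = ∫ z, k z * ee (z * t) := by
  -- The inner ball of radius 1 about 1/2 contains [0,1], so cutting off does not change f there.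
  let χ : ContDiffBump (1 / 2 : ℝ) := ⟨1, 2, by norm_num, by norm_num⟩
  have hs : HasCompactSupport fun t => ((χ t : ℝ) : ℂ) * f t :=
    (χ.hasCompactSupport.comp_left (g := fun t : ℝ => (t : ℂ)) (by simp)).mul_right
  have hd : ContDiff ℝ ∞ fun t => ((χ t : ℝ) : ℂ) * f t :=
    (Complex.ofRealCLM.contDiff.comp χ.contDiff).mul hf
  refine ⟨𝓕 (hs.toSchwartzMap hd), fun t ht => ?_⟩
  have h1 : (hs.toSchwartzMap hd) t = f t := by
    have : χ t = 1 := by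
      refine χ.one_of_mem_closedBall ?_
      rw [Metric.mem_closedBall, Real.dist_eq, abs_le]
      constructor <;> simp only [χ] <;> linarith [ht.1, ht.2]
    simp [this]
  rw [← h1]
  have h2 : 𝓕⁻ (𝓕 (hs.toSchwartzMap hd)) = hs.toSchwartzMap hd :=
    FourierTransform.fourierInv_fourier_eq _
  conv_lhs => rw [← h2]
  rw [SchwartzMap.fourierInv_coe, Real.fourierInv_eq']
  congr 1; funext z
  simp only [smul_eq_mul, ee, RCLike.inner_apply, conj_trivial]
  rw [mul_comm]
  congr 2; push_cast; ring

/-- The bound on the derivative serves only to estimate differences of translated kernels. -/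
lemma schwartz_decay (k : 𝓢(ℝ, ℂ)) (E : ℕ) :
    ∃ C : ℝ, 0 < C ∧ ∀ z, (1 + |z|) ^ E * ‖k z‖ ≤ C ∧ (1 + |z|) ^ E * ‖deriv k z‖ ≤ C := by
  have h := fun n (hn : n ≤ 1) z => SchwartzMap.one_add_le_sup_seminorm_apply (𝕜 := ℝ)
    (m := (E, 1)) (k := E) (n := n) le_rfl hn k z
  set D := 2 ^ (E, 1).1 * ((Finset.Iic (E, 1)).sup fun m => SchwartzMap.seminorm ℝ m.1 m.2) k
  refine ⟨|D| + 1, by positivity, fun z => ⟨?_, ?_⟩⟩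
  · have := h 0 (by norm_num) z
    rw [norm_iteratedFDeriv_zero, Real.norm_eq_abs] at this
    linarith [le_abs_self D]
  · have := h 1 le_rfl z
    rw [norm_iteratedFDeriv_one, Real.norm_eq_abs, ← norm_deriv_eq_norm_fderiv] at this
    linarith [le_abs_self D]

/-- The product bracket `(1 + |z₁|)(1 + |z₂|)`. -/
def brk (z : ℝ × ℝ) : ℝ := (1 + |z.1|) * (1 + |z.2|)

lemma one_le_brk (z : ℝ × ℝ) : 1 ≤ brk z := by
  unfold brk
  nlinarith [abs_nonneg z.1, abs_nonneg z.2, mul_nonneg (abs_nonneg z.1) (abs_nonneg z.2)]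

lemma brk_pos (z : ℝ × ℝ) : 0 < brk z := lt_of_lt_of_le one_pos (one_le_brk z)

@[fun_prop] lemma continuous_brk : Continuous brk := by unfold brk; fun_prop

@[simp] lemma brk_neg (z : ℝ × ℝ) : brk (-z) = brk z := by simp [brk]

lemma brk_smul_le {t : ℝ} (ht : 0 ≤ t) (ht1 : t ≤ 1) (z : ℝ × ℝ) : brk (t • z) ≤ brk z := by
  unfold brk
  simp only [Prod.smul_fst, Prod.smul_snd, smul_eq_mul, abs_mul, abs_of_nonneg ht]
  gcongr <;> exact mul_le_of_le_one_left (abs_nonneg _) ht1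

lemma brk_add_le (z w : ℝ × ℝ) : brk (z + w) ≤ brk z * brk w := by
  have aux : ∀ a b : ℝ, 1 + |a + b| ≤ (1 + |a|) * (1 + |b|) := fun a b => by
    nlinarith [abs_add_le a b, mul_nonneg (abs_nonneg a) (abs_nonneg b)]
  unfold brk
  calc _ ≤ ((1 + |z.1|) * (1 + |w.1|)) * ((1 + |z.2|) * (1 + |w.2|)) := by
        gcongr <;> exact aux _ _
    _ = _ := by ring

lemma integrable_inv_one_add_abs_sq : Integrable fun z : ℝ => ((1 + |z|) ^ 2)⁻¹ := by
  have := integrable_one_add_norm (E := ℝ) (μ := volume) (r := 2) (by simp)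
  refine this.congr (ae_of_all _ fun z => ?_)
  simp only [Real.norm_eq_abs]
  rw [Real.rpow_neg (by positivity)]; norm_num

/-- The total mass of `brk⁻²`. -/
def brkMass : ℝ≥0∞ := ∫⁻ z : ℝ × ℝ, ENNReal.ofReal ((brk z ^ 2)⁻¹)

lemma integrable_brk : Integrable fun z : ℝ × ℝ => (brk z ^ 2)⁻¹ := by
  refine (integrable_inv_one_add_abs_sq.mul_prod integrable_inv_one_add_abs_sq).congr
    (ae_of_all _ fun z => ?_)
  simp [brk, mul_pow, mul_comm]

lemma brkMass_ne_top : brkMass ≠ ⊤ := by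
  have := integrable_brk.lintegral_lt_top
  exact this.ne

lemma integrable_of_brk_decay {k : ℝ × ℝ → ℂ} (hk : Continuous k) {C : ℝ} {E : ℕ} (hE : 2 ≤ E)
    (h : ∀ z, ‖k z‖ ≤ C * (brk z ^ E)⁻¹) : Integrable k := by
  have hC : 0 ≤ C := by
    have := (norm_nonneg _).trans (h 0)
    simpa [brk] using this
  refine (integrable_brk.const_mul C).mono' hk.aestronglyMeasurable (ae_of_all _ fun z => ?_)
  refine (h z).trans ?_
  have := one_le_brk z
  gcongr

lemma lintegral_brk_le {E : ℕ} (hE : 2 ≤ E) :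
    ∫⁻ z : ℝ × ℝ, ENNReal.ofReal ((brk z ^ E)⁻¹) ≤ brkMass := by
  refine lintegral_mono fun z => ?_
  have := one_le_brk z
  dsimp only
  gcongr

/-- Multipliers given by a kernel in the first two frequency variables. -/
lemma enorm_extension_mul_le (A : Coeffs) {S : Set (ℝ × ℝ)} (hS : MeasurableSet S)
    {g : ℝ × ℝ → ℂ} (hg : IntegrableOn g S) {k : ℝ × ℝ → ℂ} (hk : Integrable k) (t : ℝ)
    {m : ℝ × ℝ → ℂ}
    (hm : ∀ q ∈ S, m q = ∫ z, k z * ee (t * z.1 * q.1 + t * z.2 * q.2))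
    (x : EuclideanSpace ℝ (Fin 4)) :
    ‖extension A S (fun q => g q * m q) x‖ₑ ≤
      ∫⁻ z, ‖k z‖ₑ * ‖extension A S g (x + tr (t • z))‖ₑ := by
  rw [extension_mul_superposition A hS hg hk (ι := fun z => tr (t • z))
    (Continuous.measurable (by fun_prop)) (m := m) (fun q hq => by
      rw [hm q hq]; simp only [inner_tr, Prod.smul_fst, Prod.smul_snd, smul_eq_mul])]
  refine (enorm_integral_le_lintegral_enorm _).trans (le_of_eq ?_)
  simp only [enorm_mul]

lemma prod_kernel_bound {k₁ k₂ : ℝ → ℂ} {C₁ C₂ : ℝ} {E : ℕ}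
    (h₁ : ∀ z, (1 + |z|) ^ E * ‖k₁ z‖ ≤ C₁) (h₂ : ∀ z, (1 + |z|) ^ E * ‖k₂ z‖ ≤ C₂)
    (z : ℝ × ℝ) : ‖k₁ z.1 * k₂ z.2‖ ≤ C₁ * C₂ * (brk z ^ E)⁻¹ := by
  have hb : 0 < brk z ^ E := pow_pos (brk_pos z) E
  have hC : 0 ≤ C₁ := le_trans (by positivity) (h₁ 0)
  rw [← div_eq_mul_inv, le_div_iff₀ hb, norm_mul]
  calc ‖k₁ z.1‖ * ‖k₂ z.2‖ * brk z ^ E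
      = ((1 + |z.1|) ^ E * ‖k₁ z.1‖) * ((1 + |z.2|) ^ E * ‖k₂ z.2‖) := by
        rw [brk, mul_pow]; ring
    _ ≤ C₁ * C₂ := mul_le_mul (h₁ _) (h₂ _) (by positivity) hC

/-- Smooth multipliers adapted to a square. -/
lemma exists_multiplier_bound (f₁ f₂ : ℝ → ℂ) (hf₁ : ContDiff ℝ ∞ f₁) (hf₂ : ContDiff ℝ ∞ f₂)
    (E : ℕ) (hE : 2 ≤ E) : ∃ C : ℝ, 0 < C ∧ ∀ (A : Coeffs) (a : ℝ × ℝ) (l : ℝ), 0 < l →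
      ∀ (S : Set (ℝ × ℝ)), MeasurableSet S → S ⊆ square a l →
      ∀ g : ℝ × ℝ → ℂ, IntegrableOn g S → ∀ x,
      ‖extension A S (fun q => g q * (f₁ ((q.1 - a.1) / l) * f₂ ((q.2 - a.2) / l))) x‖ₑ ≤
        ∫⁻ z, ENNReal.ofReal (C * (brk z ^ E)⁻¹) * ‖extension A S g (x + tr (l⁻¹ • z))‖ₑ := by
  obtain ⟨k₁, hk₁⟩ := exists_schwartz_density f₁ hf₁
  obtain ⟨k₂, hk₂⟩ := exists_schwartz_density f₂ hf₂
  obtain ⟨C₁, hC₁, hd₁⟩ := schwartz_decay k₁ E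
  obtain ⟨C₂, hC₂, hd₂⟩ := schwartz_decay k₂ E
  refine ⟨C₁ * C₂, by positivity, fun A a l hl S hS hSl g hg x => ?_⟩
  -- The phase moves the multiplier from the unit square to the corner a. It has modulus one, so the
  -- bounds do not depend on a, and l enters only through the scale of the translations.
  set k : ℝ × ℝ → ℂ := fun z => (k₁ z.1 * k₂ z.2) * ee (-(l⁻¹ * (a.1 * z.1 + a.2 * z.2))) with hk
  have hkb : ∀ z, ‖k z‖ ≤ C₁ * C₂ * (brk z ^ E)⁻¹ := fun z => by
    rw [hk, norm_mul, norm_ee, mul_one]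
    exact prod_kernel_bound (fun z => (hd₁ z).1) (fun z => (hd₂ z).1) z
  have hkc : Continuous k := by
    have h1 := k₁.continuous
    have h2 := k₂.continuous
    have h3 := continuous_ee
    fun_prop
  have hki : Integrable k := integrable_of_brk_decay hkc hE hkb
  refine (enorm_extension_mul_le A hS hg hki l⁻¹ (fun q hq => ?_) x).trans
    (lintegral_mono fun z => ?_)
  · have hq' := hSl hq
    simp only [square, mem_prod, mem_Icc] at hq'
    have m1 : (q.1 - a.1) / l ∈ Icc (0 : ℝ) 1 :=
      ⟨div_nonneg (by linarith) hl.le, (div_le_one hl).2 (by linarith)⟩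
    have m2 : (q.2 - a.2) / l ∈ Icc (0 : ℝ) 1 :=
      ⟨div_nonneg (by linarith) hl.le, (div_le_one hl).2 (by linarith)⟩
    rw [hk₁ _ m1, hk₂ _ m2, ← integral_prod_mul]
    congr 1; funext z
    simp only [hk]
    rw [mul_assoc (k₁ z.1 * k₂ z.2), ← ee_add, mul_mul_mul_comm, ← ee_add]
    congr 2
    field_simp
    ring
  · dsimp only
    gcongr
    rw [← ofReal_norm]
    exact ENNReal.ofReal_le_ofReal (hkb z)

lemma kernel_shift_decay {k : ℝ → ℂ} {C : ℝ} {E : ℕ}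
    (h : ∀ z, (1 + |z|) ^ E * ‖k z‖ ≤ C) {s : ℝ} (hs : |s| ≤ 1) (z : ℝ) :
    (1 + |z|) ^ E * ‖k (z - s)‖ ≤ 2 ^ E * C := by
  have h1 : (1 + |z|) ≤ 2 * (1 + |z - s|) := by
    have := abs_add_le (z - s) s
    rw [sub_add_cancel] at this
    linarith [abs_nonneg (z - s)]
  calc (1 + |z|) ^ E * ‖k (z - s)‖ ≤ (2 * (1 + |z - s|)) ^ E * ‖k (z - s)‖ := by gcongr
    _ = 2 ^ E * ((1 + |z - s|) ^ E * ‖k (z - s)‖) := by rw [mul_pow]; ring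
    _ ≤ _ := by gcongr; exact h _

/-- Mean value inequality on the segment from z to z - s, where 1 + |·| changes by at most a factor
of two; this produces the gain |s|. -/
lemma kernel_diff_decay (k : 𝓢(ℝ, ℂ)) {C : ℝ} {E : ℕ}
    (h : ∀ z, (1 + |z|) ^ E * ‖deriv k z‖ ≤ C) {s : ℝ} (hs : |s| ≤ 1) (z : ℝ) :
    (1 + |z|) ^ E * ‖k (z - s) - k z‖ ≤ 2 ^ E * C * |s| := by
  have hz : (0 : ℝ) < (1 + |z|) ^ E := by positivity
  have hb : ∀ y ∈ segment ℝ z (z - s), ‖deriv k y‖ ≤ 2 ^ E * C / (1 + |z|) ^ E := by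
    intro y hy
    rw [le_div_iff₀ hz, mul_comm]
    have hyz : |z - y| ≤ 1 := by
      rw [segment_eq_image'] at hy
      obtain ⟨θ, hθ, rfl⟩ := hy
      simp only [sub_sub_cancel_left, smul_eq_mul]
      rw [show z - (z + θ * -s) = θ * s by ring, abs_mul, abs_of_nonneg hθ.1]
      nlinarith [hθ.1, hθ.2, abs_nonneg s]
    simpa using kernel_shift_decay h hyz z
  have := (convex_segment z (z - s)).norm_image_sub_le_of_norm_deriv_le
    (fun y _ => k.differentiableAt) hb (left_mem_segment ℝ _ _) (right_mem_segment ℝ _ _)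
  rw [sub_sub_cancel_left, norm_neg, Real.norm_eq_abs] at this
  calc (1 + |z|) ^ E * ‖k (z - s) - k z‖
      ≤ (1 + |z|) ^ E * (2 ^ E * C / (1 + |z|) ^ E * |s|) := by gcongr
    _ = _ := by field_simp

/-- Functions with frequencies in the unit square are locally constant at unit scale. -/
lemma exists_local_constancy (E : ℕ) (hE : 2 ≤ E) : ∃ C : ℝ, 0 < C ∧ ∀ (A : Coeffs)
      (S : Set (ℝ × ℝ)), MeasurableSet S → S ⊆ unitSquare →
      ∀ g : ℝ × ℝ → ℂ, IntegrableOn g S → ∀ s : ℝ × ℝ, |s.1| ≤ 1 → |s.2| ≤ 1 → ∀ x,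
      ‖extension A S g (x + tr s) - extension A S g x‖ₑ ≤
        ∫⁻ z, ENNReal.ofReal (C * (|s.1| + |s.2|) * (brk z ^ E)⁻¹) *
          ‖extension A S g (x + tr z)‖ₑ := by
  -- A density for the constant 1: averaging translates against its tensor square reproduces every
  -- extension from the unit square.
  obtain ⟨k, hk⟩ := exists_schwartz_density (fun _ => 1) contDiff_const
  obtain ⟨C, hC, hd⟩ := schwartz_decay k E
  refine ⟨2 ^ E * 2 ^ E * C * C, by positivity, fun A S hS hSl g hg s hs1 hs2 x => ?_⟩
  -- The translated reproducing kernel minus the kernel itself. Changing one variable at a time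
  -- exhibits the factor |s.1| + |s.2|.
  set K : ℝ × ℝ → ℂ := fun z => k (z.1 - s.1) * k (z.2 - s.2) - k z.1 * k z.2 with hK
  have hKb : ∀ z, ‖K z‖ ≤ 2 ^ E * 2 ^ E * C * C * (|s.1| + |s.2|) * (brk z ^ E)⁻¹ := fun z => by
    have e : K z = (k (z.1 - s.1) - k z.1) * k (z.2 - s.2) +
      k z.1 * (k (z.2 - s.2) - k z.2) := by rw [hK]; ring
    have b1 := prod_kernel_bound
      (k₁ := fun z => k (z - s.1) - k z) (k₂ := fun z => k (z - s.2))
      (kernel_diff_decay k (fun z => (hd z).2) hs1)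
      (kernel_shift_decay (fun z => (hd z).1) hs2) z
    have b2 := prod_kernel_bound
      (k₁ := fun z => k z) (k₂ := fun z => k (z - s.2) - k z)
      (fun z => (hd z).1) (kernel_diff_decay k (fun z => (hd z).2) hs2) z
    have hb : 0 ≤ (brk z ^ E)⁻¹ := by have := brk_pos z; positivity
    have h2 : (1 : ℝ) ≤ 2 ^ E := one_le_pow₀ (by norm_num)
    rw [e]
    refine (norm_add_le _ _).trans ((add_le_add b1 b2).trans ?_)
    rw [← add_mul]
    refine mul_le_mul_of_nonneg_right ?_ hb
    have h3 : C * (2 ^ E * C * |s.2|) ≤ 2 ^ E * (C * (2 ^ E * C * |s.2|)) :=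
      le_mul_of_one_le_left (by positivity) h2
    linarith
  have hkc := k.continuous
  have hKi : Integrable K := integrable_of_brk_decay (by fun_prop) hE hKb
  have hprod : Integrable fun z : ℝ × ℝ => k z.1 * k z.2 :=
    integrable_of_brk_decay (by fun_prop) hE
      (prod_kernel_bound (fun z => (hd z).1) (fun z => (hd z).1))
  have hmain := enorm_extension_mul_le A hS hg hKi 1
    (m := fun q => ee (s.1 * q.1 + s.2 * q.2) - 1) (fun q hq => ?_) x
  · have e : extension A S (fun q => g q * (ee (s.1 * q.1 + s.2 * q.2) - 1)) x =
        extension A S g (x + tr s) - extension A S g x := by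
      rw [← extension_translate, extension_eq, extension_eq, extension_eq,
        ← integral_sub]
      · congr 1; funext q; rw [inner_tr]; ring
      · refine integrable_phase A ?_ x
        exact integrable_phase A hg (tr s)
      · exact integrable_phase A hg x
    rw [← e]
    refine hmain.trans (lintegral_mono fun z => ?_)
    dsimp only
    rw [one_smul]
    gcongr
    rw [← ofReal_norm]
    exact ENNReal.ofReal_le_ofReal (hKb z)
  · have hq' := hSl hq
    simp only [unitSquare, mem_prod] at hq'
    have h1 : ∫ z : ℝ × ℝ, (k z.1 * k z.2) * ee (z.1 * q.1 + z.2 * q.2) = 1 := by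
      have := integral_prod_mul (μ := (volume : Measure ℝ)) (ν := (volume : Measure ℝ))
        (fun z => k z * ee (z * q.1)) (fun z => k z * ee (z * q.2))
      rw [← hk _ hq'.1, ← hk _ hq'.2, one_mul] at this
      rw [← this]
      congr 1; funext z; rw [ee_add]; ring
    have h2 : ∫ z : ℝ × ℝ, (k (z.1 - s.1) * k (z.2 - s.2)) * ee (z.1 * q.1 + z.2 * q.2) =
        ee (s.1 * q.1 + s.2 * q.2) := by
      have := integral_sub_right_eq_self (μ := (volume : Measure (ℝ × ℝ)))
        (fun z : ℝ × ℝ => (k z.1 * k z.2) * ee ((z.1 + s.1) * q.1 + (z.2 + s.2) * q.2)) s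
      simp only [Prod.fst_sub, Prod.snd_sub, sub_add_cancel] at this
      rw [this, ← mul_one (ee (s.1 * q.1 + s.2 * q.2)), ← h1, ← integral_const_mul]
      congr 1; funext z
      rw [show (z.1 + s.1) * q.1 + (z.2 + s.2) * q.2 =
        (s.1 * q.1 + s.2 * q.2) + (z.1 * q.1 + z.2 * q.2) by ring, ee_add]
      ring
    simp only [one_mul]
    rw [← h1, ← h2, ← integral_sub]
    · congr 1; funext z; simp only [hK]; ring
    · refine integrable_mul_bdd ?_ (by have := continuous_ee; fun_prop) (fun _ => (norm_ee _).le)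
      exact hprod.comp_sub_right s
    · exact integrable_mul_bdd hprod (by have := continuous_ee; fun_prop) (fun _ => (norm_ee _).le)

/-- A weight that varies slowly at scale `r` under translations in the first two variables. -/
structure TrSlow (C r : ℝ) (E : ℕ) (W : EuclideanSpace ℝ (Fin 4) → ℝ≥0∞) : Prop where
  measurable : Measurable W
  le : ∀ x z, W (x + tr z) ≤ ENNReal.ofReal (C * brk (r⁻¹ • z) ^ E) * W x

/-- The decay exponent exceeds the growth exponent of W by two, which leaves the integrable factor
brk⁻². Since t ≤ r, a shift at scale t is no larger when measured at scale r. -/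
lemma TrSlow.kernel_le {C r : ℝ} {E : ℕ} {W : EuclideanSpace ℝ (Fin 4) → ℝ≥0∞}
    (hW : TrSlow C r E W) (hC : 0 ≤ C) (hr : 0 < r) {D : ℝ} (hD : 0 ≤ D) {t : ℝ} (ht : 0 ≤ t)
    (htr : t ≤ r) (x : EuclideanSpace ℝ (Fin 4)) :
    ∫⁻ z, ENNReal.ofReal (D * (brk z ^ (E + 2))⁻¹) * W (x - tr (t • z)) ≤
      (ENNReal.ofReal (D * C) * brkMass) * W x := by
  calc ∫⁻ z, ENNReal.ofReal (D * (brk z ^ (E + 2))⁻¹) * W (x - tr (t • z))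
      ≤ ∫⁻ z, ENNReal.ofReal (D * C) * W x * ENNReal.ofReal ((brk z ^ 2)⁻¹) := by
        refine lintegral_mono fun z => ?_
        dsimp only
        have h1 := hW.le x (-(t • z))
        have h2 : x + tr (-(t • z)) = x - tr (t • z) := by
          rw [sub_eq_add_neg]; congr 1; ext i; fin_cases i <;> simp [pt]
        have h3 : brk (r⁻¹ • -(t • z)) ≤ brk z := by
          rw [smul_neg, brk_neg, smul_smul]
          exact brk_smul_le (by positivity) (by rw [inv_mul_le_iff₀ hr]; linarith) z
        have hb := brk_pos z
        have hb' := brk_pos (r⁻¹ • -(t • z))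
        rw [h2] at h1
        calc ENNReal.ofReal (D * (brk z ^ (E + 2))⁻¹) * W (x - tr (t • z))
            ≤ ENNReal.ofReal (D * (brk z ^ (E + 2))⁻¹) *
              (ENNReal.ofReal (C * brk z ^ E) * W x) := by
              gcongr
              exact h1.trans (by gcongr)
          _ = ENNReal.ofReal (D * (brk z ^ (E + 2))⁻¹ * (C * brk z ^ E)) * W x := by
              rw [← mul_assoc, ← ENNReal.ofReal_mul (by positivity)]
          _ = ENNReal.ofReal (D * C * (brk z ^ 2)⁻¹) * W x := by
              congr 2; rw [pow_add]; field_simp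
          _ = _ := by rw [ENNReal.ofReal_mul (by positivity)]; ring
    _ = _ := by
        rw [lintegral_const_mul _ (by fun_prop)]
        rw [brkMass]; ring

lemma lintegral_brk_const_le {D : ℝ} (hD : 0 ≤ D) {E : ℕ} (hE : 2 ≤ E) :
    ∫⁻ z : ℝ × ℝ, ENNReal.ofReal (D * (brk z ^ E)⁻¹) ≤ ENNReal.ofReal D * brkMass := by
  simp only [ENNReal.ofReal_mul hD]
  rw [lintegral_const_mul _ (by
    refine ENNReal.measurable_ofReal.comp ?_
    exact (by fun_prop : Measurable fun z : ℝ × ℝ => brk z ^ E).inv)]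
  gcongr
  exact lintegral_brk_le hE

/-- Weighted bounds for functions dominated by an average of translates. -/
lemma TrSlow.wint_le {C r : ℝ} {E : ℕ} {W : EuclideanSpace ℝ (Fin 4) → ℝ≥0∞}
    (hW : TrSlow C r E W) (hC : 1 ≤ C) (hr : 0 < r) {D : ℝ} (hD : 0 ≤ D) {t : ℝ} (ht : 0 ≤ t)
    (htr : t ≤ r) {p : ℝ} (hp : 1 ≤ p) {f : EuclideanSpace ℝ (Fin 4) → ℂ} (hf : Measurable f)
    {F : EuclideanSpace ℝ (Fin 4) → ℝ≥0∞}
    (hF : ∀ x, F x ≤ ∫⁻ z, ENNReal.ofReal (D * (brk z ^ (E + 2))⁻¹) * ‖f (x + tr (t • z))‖ₑ) :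
    ∫⁻ x, F x ^ p * W x ≤ (ENNReal.ofReal (D * C) * brkMass) ^ p * wint p W f := by
  have hm : Measurable fun z : ℝ × ℝ => ENNReal.ofReal (D * (brk z ^ (E + 2))⁻¹) :=
    ENNReal.measurable_ofReal.comp
      ((by fun_prop : Measurable fun z : ℝ × ℝ => brk z ^ (E + 2)).inv.const_mul D)
  refine (lintegral_rpow_le_of_kernel hp hm (ι := fun z => tr (t • z))
    (Continuous.measurable (by fun_prop)) hW.measurable hf hF
    ((lintegral_brk_const_le hD (by omega)).trans (mul_le_mul_left
      (ENNReal.ofReal_le_ofReal (le_mul_of_one_le_right hD hC)) _))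
    (hW.kernel_le (by linarith) hr hD ht htr)).trans (le_of_eq ?_)
  rw [wint]
  congr 1
  conv_lhs => rw [← ENNReal.rpow_one (ENNReal.ofReal (D * C) * brkMass)]
  rw [← ENNReal.rpow_mul, ← ENNReal.rpow_add_of_nonneg _ _ (by linarith) (by norm_num)]
  congr 1; ring

end SurfaceDecoupling
end

/-! ### Band-limited weights and local L² orthogonality -/

noncomputable section

namespace SurfaceDecoupling

open scoped SchwartzMap FourierTransform ContDiff

/-- A nonnegative rapidly decaying function whose Fourier transform is supported in `[-1,1]`. -/
structure BandLimited (E : ℕ) where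
  toFun : ℝ → ℝ
  continuous : Continuous toFun
  nonneg : ∀ z, 0 ≤ toFun z
  bound : ℝ
  bound_pos : 0 < bound
  decay : ∀ z, (1 + |z|) ^ E * ‖(toFun z : ℂ)‖ ≤ bound
  lower : ℝ
  lower_pos : 0 < lower
  radius : ℝ
  radius_pos : 0 < radius
  radius_le : radius ≤ 1
  lower_le : ∀ z, |z| ≤ radius → lower ≤ toFun z
  fourier_eq_zero : ∀ ξ : ℝ, 1 ≤ |ξ| → ∫ z, (toFun z : ℂ) * ee (z * ξ) = 0

/-- Take |h|², where h is the Fourier transform of a bump supported in |t| ≤ 1/2. It is nonnegative,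
and its transform is an autocorrelation of the bump, which vanishes once the shift reaches 1. -/
lemma exists_bandLimited (E : ℕ) : Nonempty (BandLimited E) := by
  let χ : ContDiffBump (0 : ℝ) := ⟨1 / 4, 1 / 2, by norm_num, by norm_num⟩
  have hs : ∀ ξ : ℝ, HasCompactSupport fun t => ((χ (t + ξ) : ℝ) : ℂ) := fun ξ =>
    (χ.hasCompactSupport.comp_left (g := fun t : ℝ => (t : ℂ)) (by simp)).comp_homeomorph
      (Homeomorph.addRight ξ)
  have hd : ∀ ξ : ℝ, ContDiff ℝ ∞ fun t => ((χ (t + ξ) : ℝ) : ℂ) := fun ξ =>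
    Complex.ofRealCLM.contDiff.comp (χ.contDiff.comp (contDiff_id.add contDiff_const))
  let φ : ℝ → 𝓢(ℝ, ℂ) := fun ξ => (hs ξ).toSchwartzMap (hd ξ)
  have hφ : ∀ ξ t, φ ξ t = ((χ (t + ξ) : ℝ) : ℂ) := fun ξ t => rfl
  let h : 𝓢(ℝ, ℂ) := 𝓕 (φ 0)
  -- Translating the bump modulates its transform, so the transform of |h|² at ξ is an inner product
  -- of transforms.
  have hshift : ∀ ξ z, (𝓕 (φ ξ)) z = h z * ee (z * ξ) := by
    intro ξ z
    simp only [h]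
    rw [SchwartzMap.fourier_coe, SchwartzMap.fourier_coe, Real.fourier_eq', Real.fourier_eq',
      ← integral_mul_const]
    rw [← integral_sub_right_eq_self _ ξ]
    congr 1; funext v
    simp only [hφ, smul_eq_mul, RCLike.inner_apply, conj_trivial, sub_add_cancel, add_zero, ee]
    rw [mul_right_comm (Complex.exp _) _ (Complex.exp _), ← Complex.exp_add]
    congr 2; push_cast; ring
  obtain ⟨C, hC, hdec⟩ := schwartz_decay h E
  have h0 : h 0 ≠ 0 := by
    have : h 0 = ((∫ t, χ t : ℝ) : ℂ) := by
      simp only [h]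
      rw [SchwartzMap.fourier_coe, Real.fourier_eq', ← integral_complex_ofReal]
      congr 1; funext v
      simp [hφ]
    rw [this]
    exact_mod_cast (χ.integral_pos (μ := volume)).ne'
  have hcont : Continuous fun z => ‖h z‖ ^ 2 := by have := h.continuous; fun_prop
  have hpos : 0 < ‖h 0‖ ^ 2 := by positivity
  have hev : ∀ᶠ z in 𝓝 (0 : ℝ), ‖h 0‖ ^ 2 / 2 < ‖h z‖ ^ 2 :=
    hcont.continuousAt.eventually_const_lt (by linarith)
  obtain ⟨ρ, hρ, hball⟩ := Metric.eventually_nhds_iff.1 hev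
  refine ⟨⟨fun z => ‖h z‖ ^ 2, hcont, fun z => by positivity, C * C, by positivity, fun z => ?_,
    ‖h 0‖ ^ 2 / 2, by positivity, min (ρ / 2) 1, by positivity, min_le_right _ _,
    fun z hz => (hball ?_).le, fun ξ hξ => ?_⟩⟩
  · have h1 : ‖h z‖ ≤ C := by
      refine le_trans ?_ (hdec z).1
      exact le_mul_of_one_le_left (norm_nonneg _) (one_le_pow₀ (by linarith [abs_nonneg z]))
    rw [Complex.norm_real, Real.norm_of_nonneg (by positivity), pow_two, ← mul_assoc]
    exact mul_le_mul (hdec z).1 h1 (norm_nonneg _) hC.le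
  · rw [dist_zero_right, Real.norm_eq_abs]
    linarith [hz.trans (min_le_left _ _)]
  -- Parseval turns the inner product of transforms into that of two bumps with disjoint supports.
  · have key := SchwartzMap.integral_inner_fourier_fourier (φ 0) (φ ξ)
    have e1 : ∀ z, inner ℂ ((𝓕 (φ 0)) z) ((𝓕 (φ ξ)) z) =
        (((‖h z‖ ^ 2 : ℝ)) : ℂ) * ee (z * ξ) := by
      intro z
      rw [hshift ξ z, RCLike.inner_apply, mul_right_comm]
      congr 1
      change h z * (starRingEnd ℂ) (h z) = _
      rw [Complex.mul_conj, Complex.normSq_eq_norm_sq]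
    have e2 : ∀ t, inner ℂ (φ 0 t) (φ ξ t) = 0 := by
      intro t
      rw [hφ, hφ, RCLike.inner_apply, add_zero]
      have hz : χ t = 0 ∨ χ (t + ξ) = 0 := by
        by_contra hcon
        push Not at hcon
        have m1 : t ∈ Function.support χ := hcon.1
        have m2 : t + ξ ∈ Function.support χ := hcon.2
        rw [χ.support_eq, Metric.mem_ball, Real.dist_eq, sub_zero, abs_lt] at m1 m2
        simp only [χ] at m1 m2
        rcases le_abs.1 hξ with h | h <;> linarith [m1.1, m1.2, m2.1, m2.2]
      rcases hz with hz | hz <;> simp [hz]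
    simp only [e1, e2, integral_zero] at key
    exact key

/-- The two-dimensional tensor square of a band limited function. -/
def BandLimited.tensor {E : ℕ} (η : BandLimited E) (z : ℝ × ℝ) : ℝ := η.toFun z.1 * η.toFun z.2

section tensor
variable {E : ℕ} (η : BandLimited E)

lemma BandLimited.continuous_tensor : Continuous η.tensor := by
  have := η.continuous
  unfold BandLimited.tensor; fun_prop

lemma BandLimited.tensor_nonneg (z : ℝ × ℝ) : 0 ≤ η.tensor z :=
  mul_nonneg (η.nonneg _) (η.nonneg _)

lemma BandLimited.tensor_le (z : ℝ × ℝ) :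
    ‖(η.tensor z : ℂ)‖ ≤ η.bound * η.bound * (brk z ^ E)⁻¹ := by
  rw [BandLimited.tensor, Complex.ofReal_mul]
  exact prod_kernel_bound (k₁ := fun z => (η.toFun z : ℂ)) (k₂ := fun z => (η.toFun z : ℂ))
    η.decay η.decay z

lemma BandLimited.integrable_tensor (hE : 2 ≤ E) : Integrable fun z => (η.tensor z : ℂ) :=
  integrable_of_brk_decay (by have := η.continuous_tensor; fun_prop) hE η.tensor_le

lemma BandLimited.tensor_fourier_eq_zero (ξ : ℝ × ℝ) (hξ : 1 ≤ |ξ.1| ∨ 1 ≤ |ξ.2|) :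
    ∫ z : ℝ × ℝ, (η.tensor z : ℂ) * ee (z.1 * ξ.1 + z.2 * ξ.2) = 0 := by
  have := integral_prod_mul (μ := (volume : Measure ℝ)) (ν := (volume : Measure ℝ))
    (fun z => (η.toFun z : ℂ) * ee (z * ξ.1)) (fun z => (η.toFun z : ℂ) * ee (z * ξ.2))
  have e : ∀ z : ℝ × ℝ, (η.tensor z : ℂ) * ee (z.1 * ξ.1 + z.2 * ξ.2) =
      ((η.toFun z.1 : ℂ) * ee (z.1 * ξ.1)) * ((η.toFun z.2 : ℂ) * ee (z.2 * ξ.2)) := fun z => by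
    rw [BandLimited.tensor, ee_add]; push_cast; ring
  simp only [e]
  rw [Measure.volume_eq_prod, this]
  rcases hξ with h | h
  · rw [η.fourier_eq_zero _ h, zero_mul]
  · rw [η.fourier_eq_zero _ h, mul_zero]

/-- Extensions from separated sets are orthogonal with respect to a band limited weight. -/
lemma BandLimited.orthogonal (hE : 2 ≤ E) (A : Coeffs) {K : ℝ} {S S' : Set (ℝ × ℝ)}
    (hS : MeasurableSet S) (hS' : MeasurableSet S') {g : ℝ × ℝ → ℂ} (hg : IntegrableOn g S)
    (hg' : IntegrableOn g S')
    (hsep : ∀ q ∈ S, ∀ q' ∈ S', 1 ≤ |K * (q'.1 - q.1)| ∨ 1 ≤ |K * (q'.2 - q.2)|)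
    (x : EuclideanSpace ℝ (Fin 4)) :
    ∫ z : ℝ × ℝ, (η.tensor z : ℂ) * (starRingEnd ℂ (extension A S' g (x + tr (K • z))) *
      extension A S g (x + tr (K • z))) = 0 := by
  have hc := η.continuous_tensor
  have hι : Measurable fun z : ℝ × ℝ => tr (K • z) := Continuous.measurable (by fun_prop)
  have hE' := continuous_extension A hg'
  have hk : Integrable fun z : ℝ × ℝ =>
      (η.tensor z : ℂ) * starRingEnd ℂ (extension A S' g (x + tr (K • z))) := by
    refine integrable_mul_bdd (η.integrable_tensor hE) ?_ (C := ∫ q in S', ‖g q‖) fun z => ?_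
    · refine Continuous.aestronglyMeasurable ?_
      have : Continuous fun z : ℝ × ℝ => extension A S' g (x + tr (K • z)) :=
        hE'.comp (by fun_prop)
      exact Complex.continuous_conj.comp this
    · rw [RCLike.norm_conj]; exact norm_extension_le _ _ _ _
  -- The superposition identity is used twice, both times for the zero multiplier: first to expand
  -- the extension from S, then, with q fixed, the one from S'. What remains is the transform of the
  -- weight at K(q' - q), which vanishes by separation.
  have h1 := extension_mul_superposition A hS hg hk hι (m := fun _ => 0) (fun q hq => ?_) x
  · simp only [mul_zero] at h1
    rw [← (by simp [extension_eq] : extension A S (fun _ => 0) x = 0), h1]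
    congr 1; funext z; ring
  · have hk2 : Integrable fun z : ℝ × ℝ =>
        (η.tensor z : ℂ) * ee (-(inner ℝ (tr (K • z)) (surface A q))) := by
      refine integrable_mul_bdd (η.integrable_tensor hE) ?_ fun _ => (norm_ee _).le
      refine Continuous.aestronglyMeasurable ?_
      have h3 := continuous_ee
      have h4 : Continuous fun z : ℝ × ℝ => tr (K • z) := by fun_prop
      exact h3.comp (h4.inner continuous_const).neg
    have h2 := extension_mul_superposition A hS' hg' hk2 hι (m := fun _ => 0)
      (fun q' hq' => ?_) x
    · simp only [mul_zero] at h2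
      have h3 : extension A S' (fun _ => 0) x = 0 := by simp [extension_eq]
      rw [h3] at h2
      have h4 := congrArg (starRingEnd ℂ) h2
      rw [map_zero, ← integral_conj] at h4
      rw [h4]
      congr 1; funext z
      simp only [map_mul, Complex.conj_ofReal, conj_ee, neg_neg]
      ring
    · rw [← η.tensor_fourier_eq_zero (K * (q'.1 - q.1), K * (q'.2 - q.2)) (hsep q hq q' hq')]
      congr 1; funext z
      rw [mul_assoc, ← ee_add, inner_tr, inner_tr]
      congr 2
      simp only [Prod.smul_fst, Prod.smul_snd, smul_eq_mul]
      ring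

end tensor

/-- Pythagoras in a weighted space of bounded continuous functions. -/
lemma lintegral_enorm_sum_sq {ι : Type*} [DecidableEq ι] (T : Finset ι) {Z : Type*}
    [MeasurableSpace Z]
    {μ : Measure Z} {κ : Z → ℝ} (hκ : Integrable (fun z => (κ z : ℂ)) μ) (hκ0 : ∀ z, 0 ≤ κ z)
    {a : ι → Z → ℂ} (ha : ∀ i ∈ T, AEStronglyMeasurable (a i) μ) {B : ℝ}
    (hB : ∀ i ∈ T, ∀ z, ‖a i z‖ ≤ B)
    (horth : ∀ i ∈ T, ∀ j ∈ T, i ≠ j → ∫ z, (κ z : ℂ) * (starRingEnd ℂ (a j z) * a i z) ∂μ = 0) :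
    ∫⁻ z, ENNReal.ofReal (κ z) * ‖∑ i ∈ T, a i z‖ₑ ^ 2 ∂μ =
      ∑ i ∈ T, ∫⁻ z, ENNReal.ofReal (κ z) * ‖a i z‖ₑ ^ 2 ∂μ := by
  have hint : ∀ i ∈ T, ∀ j ∈ T, Integrable
      (fun z => (κ z : ℂ) * (starRingEnd ℂ (a j z) * a i z)) μ := fun i hi j hj => by
    refine integrable_mul_bdd hκ ?_ (C := B * B) fun z => ?_
    · exact (Complex.continuous_conj.comp_aestronglyMeasurable (ha j hj)).mul (ha i hi)
    · rw [norm_mul, RCLike.norm_conj]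
      exact mul_le_mul (hB j hj z) (hB i hi z) (norm_nonneg _) ((norm_nonneg _).trans (hB j hj z))
  have hsq : ∀ b : Z → ℂ, ∀ z, ((κ z * ‖b z‖ ^ 2 : ℝ) : ℂ) =
      (κ z : ℂ) * (starRingEnd ℂ (b z) * b z) := fun b z => by
    rw [mul_comm (starRingEnd ℂ (b z)), Complex.mul_conj, Complex.normSq_eq_norm_sq]; push_cast
    ring
  have hconv : ∀ b : Z → ℂ, Integrable (fun z => (κ z : ℂ) * (starRingEnd ℂ (b z) * b z)) μ →
      ∫⁻ z, ENNReal.ofReal (κ z) * ‖b z‖ₑ ^ 2 ∂μ =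
        ENNReal.ofReal (∫ z, κ z * ‖b z‖ ^ 2 ∂μ) := fun b hb => by
    rw [ofReal_integral_eq_lintegral_ofReal]
    · refine lintegral_congr fun z => ?_
      rw [ENNReal.ofReal_mul (hκ0 z), ENNReal.ofReal_pow (norm_nonneg _), ofReal_norm]
    · have := hb.re
      refine this.congr (ae_of_all _ fun z => ?_)
      dsimp only
      rw [← hsq]
      exact Complex.ofReal_re _
    · exact ae_of_all _ fun z => mul_nonneg (hκ0 z) (by positivity)
  have hexp : ∀ z, (κ z : ℂ) * (starRingEnd ℂ (∑ i ∈ T, a i z) * ∑ i ∈ T, a i z) =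
      ∑ j ∈ T, ∑ i ∈ T, (κ z : ℂ) * (starRingEnd ℂ (a j z) * a i z) := fun z => by
    rw [map_sum, Finset.sum_mul_sum, Finset.mul_sum]
    refine Finset.sum_congr rfl fun j _ => ?_
    rw [Finset.mul_sum]
  have hsumint : Integrable (fun z => (κ z : ℂ) * (starRingEnd ℂ (∑ i ∈ T, a i z) *
      ∑ i ∈ T, a i z)) μ := by
    simp only [hexp]
    exact integrable_finsetSum _ fun j hj => integrable_finsetSum _ fun i hi => hint i hi j hj
  rw [hconv (fun z => ∑ i ∈ T, a i z) hsumint,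
    Finset.sum_congr rfl fun i hi => hconv (a i) (hint i hi i hi),
    ← ENNReal.ofReal_sum_of_nonneg fun i _ => integral_nonneg fun z =>
      mul_nonneg (hκ0 z) (by positivity)]
  congr 1
  apply Complex.ofReal_injective
  rw [← integral_complex_ofReal]
  simp only [hsq (fun z => ∑ i ∈ T, a i z), hexp]
  rw [integral_finsetSum _ fun j hj => integrable_finsetSum _ fun i hi => hint i hi j hj,
    Complex.ofReal_sum]
  refine Finset.sum_congr rfl fun j hj => ?_
  rw [integral_finsetSum _ fun i hi => hint i hi j hj, Finset.sum_eq_single j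
    (fun i hi hij => horth i hi j hj hij) (fun h => absurd hj h), ← integral_complex_ofReal]
  simp only [hsq]

/-- The closed dyadic square of side `2^{-k}` with index `I`. -/
def dsq (k : ℕ) (I : ℕ × ℕ) : Set (ℝ × ℝ) :=
  square ((I.1 : ℝ) / 2 ^ k, (I.2 : ℝ) / 2 ^ k) (1 / 2 ^ k)

lemma measurableSet_square (q : ℝ × ℝ) (l : ℝ) : MeasurableSet (square q l) :=
  measurableSet_Icc.prod measurableSet_Icc

lemma measurableSet_dsq (k : ℕ) (I : ℕ × ℕ) : MeasurableSet (dsq k I) := measurableSet_square _ _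

lemma mem_dsq {k : ℕ} {I : ℕ × ℕ} {q : ℝ × ℝ} : q ∈ dsq k I ↔
    ((I.1 : ℝ) ≤ 2 ^ k * q.1 ∧ 2 ^ k * q.1 ≤ I.1 + 1) ∧
      ((I.2 : ℝ) ≤ 2 ^ k * q.2 ∧ 2 ^ k * q.2 ≤ I.2 + 1) := by
  have h : (0 : ℝ) < 2 ^ k := by positivity
  simp only [dsq, square, mem_prod, mem_Icc, ← add_div, div_le_iff₀ h, le_div_iff₀ h,
    mul_comm (2 ^ k : ℝ)]

/-- Distinct indices of equal parity differ by at least two, which leaves a gap of length one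
between the closed unit intervals. -/
lemma abs_sub_of_index {x y : ℝ} {i j : ℕ} (hx : (i : ℝ) ≤ x) (hx' : x ≤ i + 1)
    (hy : (j : ℝ) ≤ y) (hy' : y ≤ j + 1) (hij : i ≠ j) (hpar : i % 2 = j % 2) :
    1 ≤ |y - x| := by
  rcases lt_or_gt_of_ne hij with h | h
  · have : i + 2 ≤ j := by omega
    have : (i : ℝ) + 2 ≤ j := by exact_mod_cast this
    exact le_abs.2 (Or.inl (by linarith))
  · have : j + 2 ≤ i := by omega
    have : (j : ℝ) + 2 ≤ i := by exact_mod_cast this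
    exact le_abs.2 (Or.inr (by linarith))

/-- Local `L²` orthogonality. -/
lemma BandLimited.lintegral_sum_sq_le {E : ℕ} (η : BandLimited E) (hE : 2 ≤ E) (A : Coeffs)
    (k : ℕ) (T : Finset (ℕ × ℕ)) {g : ℝ × ℝ → ℂ} (hg : ∀ I ∈ T, IntegrableOn g (dsq k I))
    (x : EuclideanSpace ℝ (Fin 4)) :
    ∫⁻ z, ENNReal.ofReal (η.tensor z) *
      ‖∑ I ∈ T, extension A (dsq k I) g (x + tr ((2 ^ k : ℝ) • z))‖ₑ ^ 2 ≤
      4 * ∑ I ∈ T, ∫⁻ z, ENNReal.ofReal (η.tensor z) *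
        ‖extension A (dsq k I) g (x + tr ((2 ^ k : ℝ) • z))‖ₑ ^ 2 := by
  classical
  set a : ℕ × ℕ → ℝ × ℝ → ℂ := fun I z => extension A (dsq k I) g (x + tr ((2 ^ k : ℝ) • z))
  -- Squares with the same pair of parities are separated and hence orthogonal. The convexity
  -- inequality over the four classes gives the constant 4.
  set par : ℕ × ℕ → Fin 2 × Fin 2 := fun I => (Fin.ofNat 2 I.1, Fin.ofNat 2 I.2)
  have hac : ∀ I ∈ T, Continuous (a I) := fun I hI =>
    (continuous_extension A (hg I hI)).comp (by fun_prop)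
  have hmeas : ∀ T' ⊆ T, Measurable fun z => ENNReal.ofReal (η.tensor z) *
      ‖∑ I ∈ T', a I z‖ₑ ^ 2 := fun T' hT' => by
    have h1 := η.continuous_tensor
    have h2 : Continuous fun z => ∑ I ∈ T', a I z :=
      continuous_finsetSum _ fun I hI => hac I (hT' hI)
    exact (ENNReal.measurable_ofReal.comp h1.measurable).mul (h2.measurable.enorm.pow_const 2)
  have hcl : ∀ c, ∫⁻ z, ENNReal.ofReal (η.tensor z) * ‖∑ I ∈ T with par I = c, a I z‖ₑ ^ 2 =
      ∑ I ∈ T with par I = c, ∫⁻ z, ENNReal.ofReal (η.tensor z) * ‖a I z‖ₑ ^ 2 := fun c => by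
    refine lintegral_enorm_sum_sq _ (η.integrable_tensor hE) η.tensor_nonneg
      (fun I hI => (hac I (Finset.mem_filter.1 hI).1).aestronglyMeasurable)
      (B := ∑ I ∈ T, ∫ q in dsq k I, ‖g q‖) (fun I hI z => ?_) (fun I hI J hJ hIJ => ?_)
    · refine (norm_extension_le _ _ _ _).trans ?_
      exact Finset.single_le_sum (f := fun I => ∫ q in dsq k I, ‖g q‖)
        (fun I _ => integral_nonneg fun _ => norm_nonneg _) (Finset.mem_filter.1 hI).1
    · obtain ⟨hI, hIc⟩ := Finset.mem_filter.1 hI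
      obtain ⟨hJ, hJc⟩ := Finset.mem_filter.1 hJ
      refine η.orthogonal hE A (measurableSet_dsq _ _) (measurableSet_dsq _ _) (hg I hI) (hg J hJ)
        (fun q hq q' hq' => ?_) x
      rw [mem_dsq] at hq hq'
      have hpar : par I = par J := hIc.trans hJc.symm
      simp only [par, Prod.mk.injEq, Fin.ext_iff, Fin.ofNat] at hpar
      rw [mul_sub, mul_sub]
      by_cases h1 : I.1 = J.1
      · have h2 : I.2 ≠ J.2 := fun h2 => hIJ (Prod.ext h1 h2)
        exact Or.inr (abs_sub_of_index hq.2.1 hq.2.2 hq'.2.1 hq'.2.2 h2 hpar.2)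
      · exact Or.inl (abs_sub_of_index hq.1.1 hq.1.2 hq'.1.1 hq'.1.2 h1 hpar.1)
  calc ∫⁻ z, ENNReal.ofReal (η.tensor z) * ‖∑ I ∈ T, a I z‖ₑ ^ 2
      ≤ ∫⁻ z, 4 * ∑ c, ENNReal.ofReal (η.tensor z) *
          ‖∑ I ∈ T with par I = c, a I z‖ₑ ^ 2 := by
        refine lintegral_mono fun z => ?_
        dsimp only
        rw [← Finset.mul_sum, mul_left_comm]
        gcongr
        rw [← Finset.sum_fiberwise T par]
        have h1 := ENNReal.rpow_sum_le_const_mul_sum_rpow (p := 2) Finset.univ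
          (fun c => ‖∑ I ∈ T with par I = c, a I z‖ₑ) (by norm_num)
        have h2 : ((Finset.univ : Finset (Fin 2 × Fin 2)).card : ℝ≥0∞) ^ ((2 : ℝ) - 1) = 4 := by
          norm_num
        rw [h2] at h1
        simp only [ENNReal.rpow_two] at h1
        refine le_trans ?_ h1
        gcongr
        exact enorm_sum_le _ _
    _ = 4 * ∑ c, ∫⁻ z, ENNReal.ofReal (η.tensor z) *
          ‖∑ I ∈ T with par I = c, a I z‖ₑ ^ 2 := by
        rw [lintegral_const_mul, lintegral_finsetSum]
        · exact fun c _ => hmeas _ (Finset.filter_subset _ _)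
        · exact Finset.measurable_sum _ fun c _ => hmeas _ (Finset.filter_subset _ _)
    _ = _ := by
        simp only [hcl]
        rw [Finset.sum_fiberwise]

/-- Moving an averaging kernel from the weight to the function. -/
lemma lintegral_kernel_swap {E : Type*} [NormedAddCommGroup E] [MeasurableSpace E]
    [BorelSpace E] [SecondCountableTopology E] {vol : Measure E} [SFinite vol]
    [vol.IsAddRightInvariant] {Z : Type*} [MeasurableSpace Z] {μ : Measure Z} [SFinite μ]
    {κ : Z → ℝ≥0∞} (hκ : Measurable κ) {ι : Z → E} (hι : Measurable ι) {W f : E → ℝ≥0∞}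
    (hW : Measurable W) (hf : Measurable f) :
    ∫⁻ x, f x * ∫⁻ z, κ z * W (x - ι z) ∂μ ∂vol = ∫⁻ x, (∫⁻ z, κ z * f (x + ι z) ∂μ) * W x ∂vol := by
  have m1 : Measurable fun w : E × Z => W (w.1 - ι w.2) :=
    hW.comp (measurable_fst.sub (hι.comp measurable_snd))
  have m2 : Measurable fun w : E × Z => f (w.1 + ι w.2) :=
    hf.comp (measurable_fst.add (hι.comp measurable_snd))
  calc ∫⁻ x, f x * ∫⁻ z, κ z * W (x - ι z) ∂μ ∂vol
      = ∫⁻ x, ∫⁻ z, f x * (κ z * W (x - ι z)) ∂μ ∂vol := by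
        refine lintegral_congr fun x => ?_
        rw [lintegral_const_mul]
        exact hκ.mul (m1.comp (measurable_const.prodMk measurable_id))
    _ = ∫⁻ z, ∫⁻ x, f x * (κ z * W (x - ι z)) ∂vol ∂μ := by
        rw [lintegral_lintegral_swap]
        exact ((hf.comp measurable_fst).mul ((hκ.comp measurable_snd).mul m1)).aemeasurable
    _ = ∫⁻ z, ∫⁻ x, f (x + ι z) * (κ z * W x) ∂vol ∂μ := by
        refine lintegral_congr fun z => ?_
        rw [← lintegral_add_right_eq_self (fun x => f x * (κ z * W (x - ι z))) (ι z)]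
        simp
    _ = ∫⁻ x, ∫⁻ z, f (x + ι z) * (κ z * W x) ∂μ ∂vol := by
        rw [lintegral_lintegral_swap]
        have : Measurable fun w : Z × E => f (w.2 + ι w.1) * (κ w.1 * W w.2) :=
          (m2.comp measurable_swap).mul ((hκ.comp measurable_fst).mul (hW.comp measurable_snd))
        exact this.aemeasurable
    _ = _ := by
        refine lintegral_congr fun x => ?_
        rw [← lintegral_mul_const]
        · refine lintegral_congr fun z => ?_
          ring
        · exact hκ.mul (m2.comp (measurable_const.prodMk measurable_id))

end SurfaceDecoupling
end

/-! ### Flat decoupling for slowly varying weights -/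

noncomputable section

namespace SurfaceDecoupling

lemma measurable_brk_inv (D : ℝ) (E : ℕ) :
    Measurable fun z : ℝ × ℝ => ENNReal.ofReal (D * (brk z ^ E)⁻¹) :=
  ENNReal.measurable_ofReal.comp
    ((by fun_prop : Measurable fun z : ℝ × ℝ => brk z ^ E).inv.const_mul D)

lemma TrSlow.mono_scale {C r s : ℝ} {E : ℕ} {W : EuclideanSpace ℝ (Fin 4) → ℝ≥0∞}
    (hW : TrSlow C r E W) (hC : 0 ≤ C) (hs : 0 < s) (hsr : s ≤ r) : TrSlow C s E W := by
  refine ⟨hW.measurable, fun x z => (hW.le x z).trans ?_⟩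
  have hr : 0 < r := hs.trans_le hsr
  have e : r⁻¹ • z = (s / r) • (s⁻¹ • z) := by
    rw [smul_smul]; congr 1; field_simp
  have hb := brk_pos (r⁻¹ • z)
  gcongr
  rw [e]
  exact brk_smul_le (by positivity) ((div_le_one hr).2 hsr) _

/-- Weighted `L²` orthogonality for slowly varying weights. -/
lemma exists_l2_orthogonality (Cv : ℝ) (hCv : 1 ≤ Cv) : ∃ C : ℝ≥0∞, C ≠ ⊤ ∧ ∀ (A : Coeffs) (k : ℕ)
    (T : Finset (ℕ × ℕ)) (g : ℝ × ℝ → ℂ), (∀ I ∈ T, IntegrableOn g (dsq k I)) →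
    ∀ V, TrSlow Cv (2 ^ k) 202 V →
    ∫⁻ x, ‖∑ I ∈ T, extension A (dsq k I) g x‖ₑ ^ 2 * V x ≤
      C * ∑ I ∈ T, ∫⁻ x, ‖extension A (dsq k I) g x‖ₑ ^ 2 * V x := by
  -- The decay exponent is the growth exponent 202 of V plus the two needed for integrability.
  obtain ⟨η⟩ := exists_bandLimited (202 + 2)
  set box : Set (ℝ × ℝ) := Icc (-η.radius) η.radius ×ˢ Icc (-η.radius) η.radius with hbox
  set β : ℝ≥0∞ := ENNReal.ofReal (η.lower * η.lower) * volume box with hβ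
  have hbm : MeasurableSet box := measurableSet_Icc.prod measurableSet_Icc
  have hvol : volume box = ENNReal.ofReal (2 * η.radius) * ENNReal.ofReal (2 * η.radius) := by
    rw [hbox, Measure.volume_eq_prod, Measure.prod_prod, Real.volume_Icc]
    congr 2 <;> ring
  have hr := η.radius_pos
  have hl := η.lower_pos
  have hβ0 : β ≠ 0 := by
    rw [hβ, hvol]
    simp [hr, hl]
  have hβt : β ≠ ⊤ := by
    rw [hβ, hvol]
    exact ENNReal.mul_ne_top ENNReal.ofReal_ne_top
      (ENNReal.mul_ne_top ENNReal.ofReal_ne_top ENNReal.ofReal_ne_top)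
  set c₁ : ℝ≥0∞ := β⁻¹ * ENNReal.ofReal (Cv * 4 ^ 202)
  set c₂ : ℝ≥0∞ := ENNReal.ofReal (η.bound * η.bound * Cv) * brkMass
  have hc₁ : c₁ ≠ ⊤ := ENNReal.mul_ne_top (ENNReal.inv_ne_top.2 hβ0) ENNReal.ofReal_ne_top
  have hc₂ : c₂ ≠ ⊤ := ENNReal.mul_ne_top ENNReal.ofReal_ne_top brkMass_ne_top
  refine ⟨c₁ * (4 * c₂), ENNReal.mul_ne_top hc₁ (ENNReal.mul_ne_top (by simp) hc₂),
    fun A k T g hg V hV => ?_⟩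
  have hK : (0 : ℝ) < 2 ^ k := by positivity
  set κ : ℝ × ℝ → ℝ≥0∞ := fun z => ENNReal.ofReal (η.tensor z) with hκ
  have hκm : Measurable κ := ENNReal.measurable_ofReal.comp η.continuous_tensor.measurable
  set ι : ℝ × ℝ → EuclideanSpace ℝ (Fin 4) := fun z => tr ((2 ^ k : ℝ) • z) with hι
  have hιm : Measurable ι := Continuous.measurable (by rw [hι]; fun_prop)
  -- On the box the shift is at most one unit of scale 2^k in each coordinate, so the bracket is at
  -- most 4 and V changes by a bounded factor. Averaging over the box, where the band-limited kernel
  -- is bounded below, dominates V by its average.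
  have hlow : ∀ x, V x ≤ c₁ * ∫⁻ z, κ z * V (x - ι z) := fun x => by
    have h1 : ∀ z ∈ box, V x ≤ ENNReal.ofReal (Cv * 4 ^ 202) * V (x - ι z) := fun z hz => by
      have h2 := hV.le (x - ι z) ((2 ^ k : ℝ) • z)
      have e : x - ι z + tr ((2 ^ k : ℝ) • z) = x := by simp [hι]
      have h3 : brk (((2 : ℝ) ^ k)⁻¹ • (2 ^ k : ℝ) • z) ≤ 4 := by
        rw [smul_smul, inv_mul_cancel₀ hK.ne', one_smul]
        have a1 : |z.1| ≤ 1 := (abs_le.2 hz.1).trans η.radius_le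
        have a2 : |z.2| ≤ 1 := (abs_le.2 hz.2).trans η.radius_le
        unfold brk
        nlinarith [abs_nonneg z.1, abs_nonneg z.2]
      have h4 := brk_pos (((2 : ℝ) ^ k)⁻¹ • (2 ^ k : ℝ) • z)
      rw [e] at h2
      refine h2.trans ?_
      gcongr
    have h5 : V x * β ≤ ENNReal.ofReal (Cv * 4 ^ 202) * ∫⁻ z, κ z * V (x - ι z) := by
      calc V x * β = ∫⁻ _ in box, ENNReal.ofReal (η.lower * η.lower) * V x := by
            rw [setLIntegral_const, hβ]; ring
        _ ≤ ∫⁻ z in box, ENNReal.ofReal (Cv * 4 ^ 202) * (κ z * V (x - ι z)) := by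
            refine setLIntegral_mono' hbm fun z hz => ?_
            rw [mul_left_comm]
            refine mul_le_mul' (ENNReal.ofReal_le_ofReal ?_) (h1 z hz)
            exact mul_le_mul (η.lower_le _ (abs_le.2 hz.1)) (η.lower_le _ (abs_le.2 hz.2)) hl.le
              (η.nonneg _)
        _ ≤ ∫⁻ z, ENNReal.ofReal (Cv * 4 ^ 202) * (κ z * V (x - ι z)) :=
            setLIntegral_le_lintegral _ _
        _ = _ := by
            rw [lintegral_const_mul]
            exact hκm.mul (hV.measurable.comp (measurable_const.sub hιm))
    calc V x = β⁻¹ * (V x * β) := by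
          rw [mul_comm (V x), ← mul_assoc, ENNReal.inv_mul_cancel hβ0 hβt, one_mul]
      _ ≤ β⁻¹ * (ENNReal.ofReal (Cv * 4 ^ 202) * ∫⁻ z, κ z * V (x - ι z)) := by gcongr
      _ = _ := by rw [← mul_assoc]
  -- The converse comparison, by which the averaged weight is removed again after the orthogonality
  -- step.
  have hup : ∀ x, ∫⁻ z, κ z * V (x - ι z) ≤ c₂ * V x := fun x => by
    refine le_trans (lintegral_mono fun z => ?_) (hV.kernel_le (by linarith) hK
      (D := η.bound * η.bound) (by have := η.bound_pos; positivity) hK.le le_rfl x)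
    dsimp only
    gcongr
    rw [hκ]
    refine ENNReal.ofReal_le_ofReal (le_trans ?_ (η.tensor_le z))
    rw [Complex.norm_real]
    exact le_abs_self _
  have hcont : ∀ I ∈ T, Continuous fun x => extension A (dsq k I) g x := fun I hI =>
    continuous_extension A (hg I hI)
  have hm : ∀ I ∈ T, Measurable fun x => ‖extension A (dsq k I) g x‖ₑ ^ 2 := fun I hI =>
    (hcont I hI).measurable.enorm.pow_const 2
  have hms : Measurable fun x => ‖∑ I ∈ T, extension A (dsq k I) g x‖ₑ ^ 2 :=
    (continuous_finsetSum _ hcont).measurable.enorm.pow_const 2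
  calc ∫⁻ x, ‖∑ I ∈ T, extension A (dsq k I) g x‖ₑ ^ 2 * V x
      ≤ ∫⁻ x, c₁ * (‖∑ I ∈ T, extension A (dsq k I) g x‖ₑ ^ 2 * ∫⁻ z, κ z * V (x - ι z)) := by
        refine lintegral_mono fun x => ?_
        dsimp only
        rw [mul_left_comm]
        gcongr
        exact hlow x
    _ = c₁ * ∫⁻ x, ‖∑ I ∈ T, extension A (dsq k I) g x‖ₑ ^ 2 * ∫⁻ z, κ z * V (x - ι z) :=
        lintegral_const_mul' _ _ hc₁
    _ = c₁ * ∫⁻ x, (∫⁻ z, κ z * ‖∑ I ∈ T, extension A (dsq k I) g (x + ι z)‖ₑ ^ 2) * V x := by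
        rw [lintegral_kernel_swap hκm hιm hV.measurable hms]
    _ ≤ c₁ * ∫⁻ x, 4 * ∑ I ∈ T,
          (∫⁻ z, κ z * ‖extension A (dsq k I) g (x + ι z)‖ₑ ^ 2) * V x := by
        refine mul_le_mul_right (lintegral_mono fun x => ?_) _
        dsimp only
        rw [← Finset.sum_mul, ← mul_assoc]
        refine mul_le_mul_left ?_ _
        exact η.lintegral_sum_sq_le (by norm_num) A k T hg x
    _ = c₁ * (4 * ∑ I ∈ T, ∫⁻ x,
          (∫⁻ z, κ z * ‖extension A (dsq k I) g (x + ι z)‖ₑ ^ 2) * V x) := by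
        rw [lintegral_const_mul' _ _ (by simp), lintegral_finsetSum']
        intro I hI
        refine AEMeasurable.mul ?_ hV.measurable.aemeasurable
        refine Measurable.aemeasurable ?_
        exact Measurable.lintegral_prod_right' (f := fun w : EuclideanSpace ℝ (Fin 4) × (ℝ × ℝ) =>
          κ w.2 * ‖extension A (dsq k I) g (w.1 + ι w.2)‖ₑ ^ 2)
          ((hκm.comp measurable_snd).mul
            ((hm I hI).comp (measurable_fst.add (hιm.comp measurable_snd))))
    _ = c₁ * (4 * ∑ I ∈ T, ∫⁻ x,
          ‖extension A (dsq k I) g x‖ₑ ^ 2 * ∫⁻ z, κ z * V (x - ι z)) := by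
        congr 2
        refine Finset.sum_congr rfl fun I hI => ?_
        rw [lintegral_kernel_swap hκm hιm hV.measurable (hm I hI)]
    _ ≤ c₁ * (4 * ∑ I ∈ T, c₂ * ∫⁻ x, ‖extension A (dsq k I) g x‖ₑ ^ 2 * V x) := by
        gcongr with I hI
        rw [← lintegral_const_mul' _ _ hc₂]
        refine lintegral_mono fun x => ?_
        dsimp only
        rw [mul_left_comm]
        gcongr
        exact hup x
    _ = _ := by rw [← Finset.mul_sum]; ring

/-- Each factor is bounded by a power of ∑ m^p through the power mean inequality. The exponents
(p-2)/p and 2/p of ∑ m^p add to 1, and those of the cardinality add to p - 2. -/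
lemma sum_rpow_mul_sum_sq_le {ι : Type*} (T : Finset ι) (m : ι → ℝ≥0∞) {p : ℝ} (hp : 2 ≤ p) :
    (∑ i ∈ T, m i) ^ (p - 2) * ∑ i ∈ T, m i ^ 2 ≤
      (T.card : ℝ≥0∞) ^ (p - 2) * ∑ i ∈ T, m i ^ p := by
  have hp0 : 0 < p := by linarith
  rcases T.eq_empty_or_nonempty with rfl | hne
  · simp
  have hc0 : (T.card : ℝ≥0∞) ≠ 0 := by simpa using hne.ne_empty
  have hct : (T.card : ℝ≥0∞) ≠ ⊤ := by simp
  have h1 := ENNReal.rpow_sum_le_const_mul_sum_rpow (p := p) T m (by linarith)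
  have h2 := ENNReal.rpow_sum_le_const_mul_sum_rpow (p := p / 2) T (fun i => m i ^ (2 : ℝ))
    (by linarith)
  simp only [← ENNReal.rpow_mul, mul_div_cancel₀ p (two_ne_zero)] at h2
  set X := ∑ i ∈ T, m i ^ p
  have e1 : (∑ i ∈ T, m i) ^ (p - 2) = ((∑ i ∈ T, m i) ^ p) ^ ((p - 2) / p) := by
    rw [← ENNReal.rpow_mul]; congr 1; field_simp
  have e2 : ∑ i ∈ T, m i ^ 2 = ((∑ i ∈ T, m i ^ (2 : ℝ)) ^ (p / 2)) ^ (2 / p) := by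
    rw [← ENNReal.rpow_mul, show p / 2 * (2 / p) = 1 by field_simp, ENNReal.rpow_one]
    simp
  rw [e1, e2]
  have hpp : 0 ≤ (p - 2) / p := div_nonneg (by linarith) hp0.le
  calc _ ≤ ((T.card : ℝ≥0∞) ^ (p - 1) * X) ^ ((p - 2) / p) *
        ((T.card : ℝ≥0∞) ^ (p / 2 - 1) * X) ^ (2 / p) := by gcongr
    _ = ((T.card : ℝ≥0∞) ^ ((p - 1) * ((p - 2) / p)) *
          (T.card : ℝ≥0∞) ^ ((p / 2 - 1) * (2 / p))) * (X ^ ((p - 2) / p) * X ^ (2 / p)) := by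
        rw [ENNReal.mul_rpow_of_nonneg _ _ hpp, ENNReal.mul_rpow_of_nonneg _ _ (by positivity),
          ← ENNReal.rpow_mul, ← ENNReal.rpow_mul]
        ring
    _ = _ := by
        rw [← ENNReal.rpow_add _ _ hc0 hct, ← ENNReal.rpow_add_of_nonneg _ _ hpp (by positivity)]
        congr 1
        · congr 1; field_simp; ring
        · rw [show (p - 2) / p + 2 / p = 1 by field_simp; ring, ENNReal.rpow_one]

/-- The local `L^p` average of `F` at scale `2^k` in the first two variables. -/
def localMean (p : ℝ) (k : ℕ) (F : EuclideanSpace ℝ (Fin 4) → ℂ)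
    (x : EuclideanSpace ℝ (Fin 4)) : ℝ≥0∞ :=
  ∫⁻ z, ENNReal.ofReal ((brk z ^ 102)⁻¹) * ‖F (x + tr ((2 ^ k : ℝ) • z))‖ₑ ^ p

lemma measurable_localMean (p : ℝ) (k : ℕ) {F : EuclideanSpace ℝ (Fin 4) → ℂ}
    (hF : Continuous F) : Measurable (localMean p k F) := by
  have h1 := measurable_brk_inv 1 102
  simp only [one_mul] at h1
  refine Measurable.lintegral_prod_right' (f := fun w : EuclideanSpace ℝ (Fin 4) × (ℝ × ℝ) =>
    ENNReal.ofReal ((brk w.2 ^ 102)⁻¹) * ‖F (w.1 + tr ((2 ^ k : ℝ) • w.2))‖ₑ ^ p) ?_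
  have h2 : Continuous fun w : EuclideanSpace ℝ (Fin 4) × (ℝ × ℝ) =>
    F (w.1 + tr ((2 ^ k : ℝ) • w.2)) := hF.comp (by fun_prop)
  exact (h1.comp measurable_snd).mul (h2.measurable.enorm.pow_const p)

/-- The translation is absorbed into the kernel, whose bracket is submultiplicative. Thus the local
mean varies slowly although F need not. -/
lemma localMean_translate_le (p : ℝ) (k : ℕ) (F : EuclideanSpace ℝ (Fin 4) → ℂ)
    (x : EuclideanSpace ℝ (Fin 4)) (y : ℝ × ℝ) :
    localMean p k F (x + tr y) ≤
      ENNReal.ofReal (brk (((2 : ℝ) ^ k)⁻¹ • y) ^ 102) * localMean p k F x := by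
  have hK : (0 : ℝ) < 2 ^ k := by positivity
  set y' := ((2 : ℝ) ^ k)⁻¹ • y with hy'
  have hb' := brk_pos y'
  unfold localMean
  rw [← lintegral_sub_right_eq_self _ y', ← lintegral_const_mul' _ _ ENNReal.ofReal_ne_top]
  refine lintegral_mono fun z => ?_
  have e : x + tr y + tr ((2 ^ k : ℝ) • (z - y')) = x + tr ((2 ^ k : ℝ) • z) := by
    rw [add_assoc, pt_add, hy', smul_sub, smul_smul, mul_inv_cancel₀ hK.ne', one_smul]
    simp
  dsimp only
  rw [e, ← mul_assoc, ← ENNReal.ofReal_mul (by positivity)]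
  gcongr
  have h1 := brk_add_le (z - y') y'
  rw [sub_add_cancel] at h1
  have h2 := brk_pos z
  have h3 := brk_pos (z - y')
  rw [← div_eq_mul_inv, inv_eq_one_div, div_le_div_iff₀ (by positivity) (by positivity), one_mul,
    mul_comm, ← mul_pow]
  gcongr

/-- Flat decoupling: the trivial interpolation between `L²` orthogonality and the triangle
inequality. -/
theorem exists_flat_decoupling (Cw : ℝ) (hCw : 1 ≤ Cw) : ∃ C : ℝ≥0∞, C ≠ ⊤ ∧ 1 ≤ C ∧
    ∀ (A : Coeffs) (k : ℕ) (r p : ℝ), 2 ≤ p → 2 ^ k ≤ r →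
    ∀ (T : Finset (ℕ × ℕ)) (g : ℝ × ℝ → ℂ), (∀ I ∈ T, IntegrableOn g (dsq k I)) →
    ∀ W, TrSlow Cw r 100 W →
    wint p W (fun x => ∑ I ∈ T, extension A (dsq k I) g x) ≤
      C ^ p * ((T.card : ℝ≥0∞) ^ (p - 2) * ∑ I ∈ T, wint p W (extension A (dsq k I) g)) := by
  -- With the multiplier 1 this is a reproducing formula: each piece is dominated by averages of its
  -- own translates at the scale dual to its square.
  obtain ⟨C₁, hC₁, hmult⟩ := exists_multiplier_bound (fun _ => 1) (fun _ => 1) contDiff_const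
    contDiff_const 102 (by norm_num)
  obtain ⟨C₂, hC₂, hl2⟩ := exists_l2_orthogonality Cw hCw
  set b : ℝ≥0∞ := max 1 (ENNReal.ofReal C₁ * max 1 brkMass) with hb
  have hbt : b ≠ ⊤ := by
    simp [hb, ENNReal.mul_eq_top, brkMass_ne_top]
  have hb1 : 1 ≤ b := le_max_left _ _
  set d : ℝ≥0∞ := max 1 (C₂ * (ENNReal.ofReal (1 * Cw) * brkMass)) with hd
  have hdt : d ≠ ⊤ := by
    simp [hd, ENNReal.mul_eq_top, brkMass_ne_top, hC₂]
  have hd1 : 1 ≤ d := le_max_left _ _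
  refine ⟨b * d, ENNReal.mul_ne_top hbt hdt, one_le_mul hb1 hd1,
    fun A k r p hp hkr T g hg W hW => ?_⟩
  have hK : (0 : ℝ) < 2 ^ k := by positivity
  have hp0 : 0 < p := by linarith
  have hW' := hW.mono_scale (by linarith) hK hkr
  set F : ℕ × ℕ → EuclideanSpace ℝ (Fin 4) → ℂ := fun I => extension A (dsq k I) g
  have hFc : ∀ I ∈ T, Continuous (F I) := fun I hI => continuous_extension A (hg I hI)
  set m : ℕ × ℕ → EuclideanSpace ℝ (Fin 4) → ℝ≥0∞ := fun I x => localMean p k (F I) x ^ (1 / p)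
    with hm
  have hmm : ∀ I ∈ T, Measurable (m I) := fun I hI =>
    (measurable_localMean p k (hFc I hI)).pow_const _
  have hFm : ∀ I ∈ T, ∀ x, ‖F I x‖ₑ ≤ b * m I x := fun I hI x => by
    have h1 := hmult A ((I.1 : ℝ) / 2 ^ k, (I.2 : ℝ) / 2 ^ k) (1 / 2 ^ k) (by positivity)
      (dsq k I) (measurableSet_dsq k I) subset_rfl g (hg I hI) x
    simp only [mul_one, one_div, inv_inv] at h1
    have h2 := ENNReal.rpow_le_rpow h1 hp0.le
    have h3 := lintegral_kernel_rpow_le (μ := (volume : Measure (ℝ × ℝ))) (p := p) (by linarith)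
      (measurable_brk_inv C₁ 102) (h := fun z => ‖F I (x + tr ((2 ^ k : ℝ) • z))‖ₑ)
      ((hFc I hI).comp (by fun_prop : Continuous fun z : ℝ × ℝ =>
        x + tr ((2 ^ k : ℝ) • z))).measurable.enorm
    have h4 : ∫⁻ z : ℝ × ℝ, ENNReal.ofReal (C₁ * (brk z ^ 102)⁻¹) ≤ b :=
      (lintegral_brk_const_le hC₁.le (by norm_num)).trans (le_trans (by gcongr; exact le_max_right _ _)
        (le_max_right _ _))
    have h5 : ∫⁻ z : ℝ × ℝ, ENNReal.ofReal (C₁ * (brk z ^ 102)⁻¹) *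
        ‖F I (x + tr ((2 ^ k : ℝ) • z))‖ₑ ^ p ≤ b * localMean p k (F I) x := by
      simp only [ENNReal.ofReal_mul hC₁.le, mul_assoc]
      rw [lintegral_const_mul' _ _ ENNReal.ofReal_ne_top, localMean]
      gcongr
      refine le_trans ?_ (le_max_right _ _)
      exact le_mul_of_one_le_right' (le_max_left _ _)
    have h6 : ‖F I x‖ₑ ^ p ≤ (b * m I x) ^ p := by
      refine h2.trans (h3.trans ?_)
      rw [ENNReal.mul_rpow_of_nonneg _ _ hp0.le, hm, ← ENNReal.rpow_mul, one_div,
        inv_mul_cancel₀ hp0.ne', ENNReal.rpow_one]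
      calc _ ≤ b ^ (p - 1) * (b * localMean p k (F I) x) := by
            refine mul_le_mul' (ENNReal.rpow_le_rpow h4 (by linarith)) h5
        _ = _ := by
            rw [← mul_assoc]; congr 1
            conv_lhs => rw [← ENNReal.rpow_one b, ← ENNReal.rpow_mul, one_mul]
            rw [← ENNReal.rpow_add_of_nonneg _ _ (by linarith) (by norm_num)]
            congr 1; ring
    exact (ENNReal.rpow_le_rpow_iff hp0).1 h6
  -- All but two of the p factors are replaced by local means and frozen into the weight, so that L²
  -- orthogonality applies to the remaining square.
  set V : EuclideanSpace ℝ (Fin 4) → ℝ≥0∞ := fun x => (∑ I ∈ T, m I x) ^ (p - 2) * W x with hV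
  have hVs : TrSlow Cw (2 ^ k) 202 V := by
    refine ⟨((Finset.measurable_sum _ hmm).pow_const _).mul hW.measurable, fun x z => ?_⟩
    set B := brk (((2 : ℝ) ^ k)⁻¹ • z) with hB
    have hB1 : 1 ≤ B := one_le_brk _
    have hB0 : (1 : ℝ≥0∞) ≤ ENNReal.ofReal (B ^ 102) := by
      rw [ENNReal.one_le_ofReal]; exact one_le_pow₀ hB1
    have h1 : ∑ I ∈ T, m I (x + tr z) ≤ ENNReal.ofReal (B ^ 102) ^ (1 / p) * ∑ I ∈ T, m I x := by
      rw [Finset.mul_sum]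
      refine Finset.sum_le_sum fun I _ => ?_
      rw [hm, ← ENNReal.mul_rpow_of_nonneg _ _ (by positivity)]
      exact ENNReal.rpow_le_rpow (localMean_translate_le p k (F I) x z) (by positivity)
    -- The exponent (p-2)/p is at most 1, so the frozen factor grows at most like B^102 whatever p
    -- is. Together with the 100 of W this makes 202.
    have h2 : (ENNReal.ofReal (B ^ 102) ^ (1 / p)) ^ (p - 2) ≤ ENNReal.ofReal (B ^ 102) := by
      rw [← ENNReal.rpow_mul]
      conv_rhs => rw [← ENNReal.rpow_one (ENNReal.ofReal (B ^ 102))]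
      refine ENNReal.rpow_le_rpow_of_exponent_le hB0 ?_
      rw [one_div, inv_mul_le_iff₀ hp0]; linarith
    calc V (x + tr z) ≤ (ENNReal.ofReal (B ^ 102) ^ (1 / p) * ∑ I ∈ T, m I x) ^ (p - 2) *
          (ENNReal.ofReal (Cw * B ^ 100) * W x) := by
          exact mul_le_mul' (ENNReal.rpow_le_rpow h1 (by linarith)) (hW'.le x z)
      _ = (ENNReal.ofReal (B ^ 102) ^ (1 / p)) ^ (p - 2) * ENNReal.ofReal (Cw * B ^ 100) * V x := by
          rw [ENNReal.mul_rpow_of_nonneg _ _ (by linarith), hV]; ring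
      _ ≤ ENNReal.ofReal (B ^ 102) * ENNReal.ofReal (Cw * B ^ 100) * V x := by gcongr
      _ = _ := by
          rw [← ENNReal.ofReal_mul (by positivity)]
          congr 2; ring
  -- The kernel of the local mean is moved onto W, which absorbs it because W varies slowly at scale
  -- 2^k.
  have hswap : ∀ I ∈ T, ∫⁻ x, m I x ^ p * W x ≤
      ENNReal.ofReal (1 * Cw) * brkMass * wint p W (F I) := fun I hI => by
    have hι : Measurable fun z : ℝ × ℝ => tr ((2 ^ k : ℝ) • z) :=
      Continuous.measurable (by fun_prop)
    have e : ∀ x, m I x ^ p = localMean p k (F I) x := fun x => by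
      rw [hm, ← ENNReal.rpow_mul, one_div, inv_mul_cancel₀ hp0.ne', ENNReal.rpow_one]
    simp only [e, localMean]
    have hmb := measurable_brk_inv 1 102
    simp only [one_mul] at hmb
    rw [← lintegral_kernel_swap (vol := (volume : Measure (EuclideanSpace ℝ (Fin 4))))
      (f := fun x => ‖F I x‖ₑ ^ p) hmb hι hW.measurable
      ((hFc I hI).measurable.enorm.pow_const p), wint, ← lintegral_const_mul']
    · refine lintegral_mono fun x => ?_
      dsimp only
      rw [mul_left_comm]
      gcongr
      have := hW'.kernel_le (by linarith) hK zero_le_one hK.le le_rfl x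
      simpa only [one_mul] using this
    · exact ENNReal.mul_ne_top ENNReal.ofReal_ne_top brkMass_ne_top
  calc wint p W (fun x => ∑ I ∈ T, F I x)
      ≤ ∫⁻ x, b ^ (p - 2) * (‖∑ I ∈ T, F I x‖ₑ ^ 2 * V x) := by
        refine lintegral_mono fun x => ?_
        have h1 : ‖∑ I ∈ T, F I x‖ₑ ≤ b * ∑ I ∈ T, m I x := by
          rw [Finset.mul_sum]
          exact (enorm_sum_le _ _).trans (Finset.sum_le_sum fun I hI => hFm I hI x)
        have h2 : ‖∑ I ∈ T, F I x‖ₑ ^ p =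
            ‖∑ I ∈ T, F I x‖ₑ ^ (p - 2) * ‖∑ I ∈ T, F I x‖ₑ ^ 2 := by
          rw [← ENNReal.rpow_two, ← ENNReal.rpow_add_of_nonneg _ _ (by linarith) (by norm_num)]
          congr 1; ring
        dsimp only
        rw [h2]
        calc _ ≤ (b * ∑ I ∈ T, m I x) ^ (p - 2) * ‖∑ I ∈ T, F I x‖ₑ ^ 2 * W x := by
              gcongr
          _ = _ := by
              rw [ENNReal.mul_rpow_of_nonneg _ _ (by linarith), hV]; ring
    _ = b ^ (p - 2) * ∫⁻ x, ‖∑ I ∈ T, F I x‖ₑ ^ 2 * V x :=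
        lintegral_const_mul' _ _ (ENNReal.rpow_ne_top_of_nonneg (by linarith) hbt)
    _ ≤ b ^ (p - 2) * (C₂ * ∑ I ∈ T, ∫⁻ x, ‖F I x‖ₑ ^ 2 * V x) := by
        gcongr
        exact hl2 A k T g hg V hVs
    _ = b ^ (p - 2) * C₂ * ∫⁻ x, ∑ I ∈ T, ‖F I x‖ₑ ^ 2 * V x := by
        rw [lintegral_finsetSum, mul_assoc]
        exact fun I hI => ((hFc I hI).measurable.enorm.pow_const 2).mul hVs.measurable
    _ ≤ b ^ (p - 2) * C₂ * ∫⁻ x, b ^ 2 * ((T.card : ℝ≥0∞) ^ (p - 2) *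
          ∑ I ∈ T, m I x ^ p * W x) := by
        gcongr with x
        calc ∑ I ∈ T, ‖F I x‖ₑ ^ 2 * V x ≤ ∑ I ∈ T, (b * m I x) ^ 2 * V x := by
              gcongr with I hI
              exact hFm I hI x
          _ = b ^ 2 * (((∑ I ∈ T, m I x) ^ (p - 2) * ∑ I ∈ T, m I x ^ 2) * W x) := by
              simp only [mul_pow, ← Finset.sum_mul, ← Finset.mul_sum, hV]
              ring
          _ ≤ b ^ 2 * (((T.card : ℝ≥0∞) ^ (p - 2) * ∑ I ∈ T, m I x ^ p) * W x) := by
              refine mul_le_mul_right (mul_le_mul_left ?_ _) _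
              exact sum_rpow_mul_sum_sq_le T (fun I => m I x) hp
          _ = _ := by rw [← Finset.sum_mul]; ring
    _ = b ^ (p - 2) * C₂ * (b ^ 2 * ((T.card : ℝ≥0∞) ^ (p - 2) *
          ∑ I ∈ T, ∫⁻ x, m I x ^ p * W x)) := by
        rw [lintegral_const_mul' _ _ (by finiteness), lintegral_const_mul' _ _
          (ENNReal.rpow_ne_top_of_nonneg (by linarith) (by simp)), lintegral_finsetSum]
        exact fun I hI => ((hmm I hI).pow_const p).mul hW.measurable
    _ ≤ b ^ (p - 2) * C₂ * (b ^ 2 * ((T.card : ℝ≥0∞) ^ (p - 2) *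
          ∑ I ∈ T, ENNReal.ofReal (1 * Cw) * brkMass * wint p W (F I))) := by
        gcongr with I hI
        exact hswap I hI
    _ = b ^ p * (C₂ * (ENNReal.ofReal (1 * Cw) * brkMass)) * ((T.card : ℝ≥0∞) ^ (p - 2) *
          ∑ I ∈ T, wint p W (F I)) := by
        rw [← Finset.mul_sum]
        have : b ^ p = b ^ (p - 2) * b ^ 2 := by
          rw [← ENNReal.rpow_two, ← ENNReal.rpow_add_of_nonneg _ _ (by linarith) (by norm_num)]
          congr 1; ring
        rw [this]; ring
    _ ≤ _ := by
        gcongr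
        rw [ENNReal.mul_rpow_of_nonneg _ _ hp0.le]
        gcongr
        refine (le_max_right 1 _).trans ?_
        conv_lhs => rw [← hd, ← ENNReal.rpow_one d]
        exact ENNReal.rpow_le_rpow_of_exponent_le hd1 (by linarith)

end SurfaceDecoupling
end

/-! ### Bessel's inequality on the plane -/

noncomputable section

namespace SurfaceDecoupling

open scoped FourierTransform

/-- Schur's test: 2ab ≤ a² + b² splits the form into two integrals, and in each of them Γ integrates
to at most 1 by translation invariance. -/
lemma lintegral_enorm_mul_translate_le {F : ℝ × ℝ → ℂ} (hF : AEStronglyMeasurable F)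
    {Γ : ℝ × ℝ → ℝ≥0∞} (hΓ : Measurable Γ) (hΓ1 : ∫⁻ u, Γ u ≤ 1) :
    ∫⁻ q, ‖F q‖ₑ * ∫⁻ q', ‖F q'‖ₑ * Γ (q' - q) ≤ ∫⁻ q, ‖F q‖ₑ ^ 2 := by
  have hFm : AEMeasurable fun q => ‖F q‖ₑ := hF.enorm
  have hF2 : AEMeasurable fun q => ‖F q‖ₑ ^ 2 := hFm.pow_const 2
  have hswap : Measurable fun w : (ℝ × ℝ) × (ℝ × ℝ) => Γ (w.2 - w.1) :=
    hΓ.comp (measurable_snd.sub measurable_fst)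
  have h1 : ∫⁻ q, ∫⁻ q', ‖F q‖ₑ ^ 2 * Γ (q' - q) ≤ ∫⁻ q, ‖F q‖ₑ ^ 2 := by
    refine lintegral_mono fun q => ?_
    dsimp only
    rw [lintegral_const_mul]
    swap; · exact hΓ.comp (measurable_id.sub measurable_const)
    rw [lintegral_sub_right_eq_self (fun u => Γ u) q]
    exact mul_le_of_le_one_right' hΓ1
  have h2 : ∫⁻ q, ∫⁻ q', ‖F q'‖ₑ ^ 2 * Γ (q' - q) ≤ ∫⁻ q, ‖F q‖ₑ ^ 2 := by
    rw [lintegral_lintegral_swap]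
    · refine lintegral_mono fun q' => ?_
      dsimp only
      rw [lintegral_const_mul]
      swap; · exact hΓ.comp (measurable_const.sub measurable_id)
      rw [lintegral_sub_left_eq_self (fun u => Γ u) q']
      exact mul_le_of_le_one_right' hΓ1
    · exact (hF2.comp_snd).mul hswap.aemeasurable
  have key : ∀ a b : ℝ≥0∞, 2 * (a * b) ≤ a ^ 2 + b ^ 2 := fun a b => by
    rw [← mul_assoc]
    induction a with
    | top => simp
    | coe a =>
      induction b with
      | top => simp
      | coe b => exact_mod_cast two_mul_le_add_sq a b
  have h3 : 2 * ∫⁻ q, ‖F q‖ₑ * ∫⁻ q', ‖F q'‖ₑ * Γ (q' - q) ≤ 2 * ∫⁻ q, ‖F q‖ₑ ^ 2 := by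
    calc 2 * ∫⁻ q, ‖F q‖ₑ * ∫⁻ q', ‖F q'‖ₑ * Γ (q' - q)
        = ∫⁻ q, ∫⁻ q', 2 * (‖F q‖ₑ * ‖F q'‖ₑ) * Γ (q' - q) := by
          rw [← lintegral_const_mul' _ _ (by simp)]
          refine lintegral_congr fun q => ?_
          rw [← lintegral_const_mul' _ _ (by simp), ← lintegral_const_mul' _ _ (by simp)]
          refine lintegral_congr fun q' => ?_
          ring
      _ ≤ ∫⁻ q, ∫⁻ q', (‖F q‖ₑ ^ 2 * Γ (q' - q) + ‖F q'‖ₑ ^ 2 * Γ (q' - q)) := by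
          refine lintegral_mono fun q => lintegral_mono fun q' => ?_
          dsimp only
          rw [← add_mul]
          gcongr
          exact key _ _
      _ = (∫⁻ q, ∫⁻ q', ‖F q‖ₑ ^ 2 * Γ (q' - q)) + ∫⁻ q, ∫⁻ q', ‖F q'‖ₑ ^ 2 * Γ (q' - q) := by
          rw [← lintegral_add_left']
          · refine lintegral_congr fun q => ?_
            rw [lintegral_add_left]
            exact (hΓ.comp (measurable_id.sub measurable_const)).const_mul _
          · refine AEMeasurable.lintegral_prod_right' (f := fun w : (ℝ × ℝ) × (ℝ × ℝ) =>
              ‖F w.1‖ₑ ^ 2 * Γ (w.2 - w.1)) ?_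
            exact (hF2.comp_fst).mul hswap.aemeasurable
      _ ≤ _ := by rw [two_mul]; exact add_le_add h1 h2
  exact (ENNReal.mul_le_mul_iff_right (by simp) (by simp)).1 h3

/-- Bessel's inequality against an approximate identity. -/
lemma lintegral_fourier_sq_mul_le (A : Coeffs) {F : ℝ × ℝ → ℂ} (hF : Integrable F)
    {κ : ℝ × ℝ → ℝ} (hκ : Integrable fun c => (κ c : ℂ)) (hκ0 : ∀ c, 0 ≤ κ c)
    {Γ : ℝ × ℝ → ℝ} (hΓ0 : ∀ u, 0 ≤ Γ u) (hΓm : Measurable Γ)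
    (hΓ1 : ∫⁻ u, ENNReal.ofReal (Γ u) ≤ 1)
    (hΓ : ∀ u : ℝ × ℝ, ∫ c : ℝ × ℝ, (κ c : ℂ) * ee (c.1 * u.1 + c.2 * u.2) = Γ u) :
    ∫⁻ c, ENNReal.ofReal (κ c) * ‖extension A univ F (tr c)‖ₑ ^ 2 ≤ ∫⁻ q, ‖F q‖ₑ ^ 2 := by
  have hF' : IntegrableOn F univ := hF.integrableOn
  have htr : Continuous fun c : ℝ × ℝ => tr c := by fun_prop
  have hE : Continuous fun c : ℝ × ℝ => extension A univ F (tr c) :=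
    (continuous_extension A hF').comp htr
  have hb : ∀ c : ℝ × ℝ, ‖extension A univ F (tr c)‖ ≤ ∫ q in univ, ‖F q‖ := fun c =>
    norm_extension_le _ _ _ _
  set k : ℝ × ℝ → ℂ := fun c => (κ c : ℂ) * starRingEnd ℂ (extension A univ F (tr c)) with hk
  have hki : Integrable k := integrable_mul_bdd hκ
    (Complex.continuous_conj.comp hE).aestronglyMeasurable
    (fun c => by rw [RCLike.norm_conj]; exact hb c)
  set m : ℝ × ℝ → ℂ := fun q => ∫ c, k c * ee (inner ℝ (tr c) (surface A q)) with hm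
  have h1 := extension_mul_superposition A MeasurableSet.univ hF' hki htr.measurable
    (m := m) (fun q _ => rfl) 0
  have hmb : ∀ q, ‖m q‖ₑ ≤ ∫⁻ q', ‖F q'‖ₑ * ENNReal.ofReal (Γ (q' - q)) := fun q => by
    have hk2 : Integrable fun c : ℝ × ℝ => (κ c : ℂ) * ee (-(inner ℝ (tr c) (surface A q))) := by
      refine integrable_mul_bdd hκ ?_ fun _ => (norm_ee _).le
      exact (continuous_ee.comp (htr.inner continuous_const).neg).aestronglyMeasurable
    have h2 := extension_mul_superposition A MeasurableSet.univ hF' hk2 htr.measurable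
      (m := fun q' => (Γ (q' - q) : ℂ)) (fun q' _ => by
        rw [← hΓ]
        congr 1; funext c
        rw [mul_assoc, ← ee_add, inner_tr, inner_tr]
        congr 2
        simp only [Prod.fst_sub, Prod.snd_sub]; ring) 0
    have h3 : m q = starRingEnd ℂ (extension A univ (fun q' => F q' * (Γ (q' - q) : ℂ)) 0) := by
      rw [h2, hm, ← integral_conj]
      refine integral_congr_ae (ae_of_all _ fun c => ?_)
      simp only [hk, map_mul, Complex.conj_ofReal, conj_ee, neg_neg, zero_add]
      ring
    rw [h3, RCLike.enorm_conj, extension_eq, Measure.restrict_univ]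
    refine (enorm_integral_le_lintegral_enorm _).trans (le_of_eq (lintegral_congr fun q' => ?_))
    rw [enorm_mul, enorm_mul, ← ofReal_norm (ee _), norm_ee, ENNReal.ofReal_one, mul_one]
    congr 1
    rw [← ofReal_norm, Complex.norm_real, Real.norm_of_nonneg (hΓ0 _)]
  have h4 : ∫⁻ c, ENNReal.ofReal (κ c) * ‖extension A univ F (tr c)‖ₑ ^ 2 =
      ‖∫ c, k c * extension A univ F (0 + tr c)‖ₑ := by
    have e : ∀ c, k c * extension A univ F (0 + tr c) =
        ((κ c * ‖extension A univ F (tr c)‖ ^ 2 : ℝ) : ℂ) := fun c => by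
      rw [zero_add, hk]
      dsimp only
      rw [mul_assoc, mul_comm (starRingEnd ℂ _), Complex.mul_conj, Complex.normSq_eq_norm_sq]
      push_cast; ring
    have hnn : ∀ c, 0 ≤ κ c * ‖extension A univ F (tr c)‖ ^ 2 := fun c =>
      mul_nonneg (hκ0 c) (by positivity)
    simp only [e]
    rw [integral_complex_ofReal, ← ofReal_norm, Complex.norm_real,
      Real.norm_of_nonneg (integral_nonneg hnn), ofReal_integral_eq_lintegral_ofReal]
    · refine lintegral_congr fun c => ?_
      rw [ENNReal.ofReal_mul (hκ0 c), ENNReal.ofReal_pow (norm_nonneg _), ofReal_norm]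
    · have := (integrable_mul_bdd hki hE.aestronglyMeasurable hb).re
      refine this.congr (ae_of_all _ fun c => ?_)
      dsimp only
      have e' := e c
      rw [zero_add] at e'
      rw [e']
      exact Complex.ofReal_re _
    · exact ae_of_all _ hnn
  rw [h4, ← h1, extension_eq, Measure.restrict_univ]
  refine (enorm_integral_le_lintegral_enorm _).trans ?_
  refine le_trans (lintegral_mono fun q => ?_) (lintegral_enorm_mul_translate_le
    hF.aestronglyMeasurable (ENNReal.measurable_ofReal.comp hΓm) hΓ1)
  dsimp only
  rw [enorm_mul, enorm_mul, ← ofReal_norm (ee _), norm_ee, ENNReal.ofReal_one, mul_one]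
  gcongr
  exact hmb q

lemma gaussian_fourier {b : ℝ} (hb : 0 < b) (t : ℝ) :
    ∫ c : ℝ, (Real.exp (-Real.pi * b * c ^ 2) : ℂ) * ee (c * t) =
      ((1 / b ^ (1 / 2 : ℝ) * Real.exp (-Real.pi / b * t ^ 2) : ℝ) : ℂ) := by
  have h := congrFun (fourier_gaussian_pi (b := (b : ℂ)) (by simpa using hb)) (-t)
  rw [Real.fourier_eq'] at h
  have e : ∀ c : ℝ, (Real.exp (-Real.pi * b * c ^ 2) : ℂ) * ee (c * t) =
      Complex.exp (↑(-2 * Real.pi * inner ℝ c (-t)) * Complex.I) •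
        Complex.exp (-Real.pi * b * c ^ 2) := fun c => by
    rw [smul_eq_mul, mul_comm, ee]
    push_cast
    congr 2
    simp only [RCLike.inner_apply, conj_trivial]
    push_cast; ring
  simp only [e]
  rw [h]
  push_cast
  rw [Complex.ofReal_cpow hb.le]
  push_cast
  congr 3
  ring

lemma integral_gaussian_dual {b : ℝ} (hb : 0 < b) :
    ∫ t : ℝ, 1 / b ^ (1 / 2 : ℝ) * Real.exp (-Real.pi / b * t ^ 2) = 1 := by
  rw [integral_const_mul]
  have := integral_gaussian (Real.pi / b)
  rw [show -(Real.pi / b) = -Real.pi / b by ring] at this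
  rw [this, show Real.pi / (Real.pi / b) = b by
    rw [div_div_eq_mul_div, mul_div_cancel_left₀ _ Real.pi_ne_zero], Real.sqrt_eq_rpow]
  have : (0 : ℝ) < b ^ (1 / 2 : ℝ) := by positivity
  field_simp

/-- Bessel's inequality for the Fourier transform on `ℝ²`. -/
lemma lintegral_fourier_sq_le (A : Coeffs) {F : ℝ × ℝ → ℂ} (hF : Integrable F) :
    ∫⁻ c, ‖extension A univ F (tr c)‖ₑ ^ 2 ≤ ∫⁻ q, ‖F q‖ₑ ^ 2 := by
  -- Gaussian weights that tend to 1 as b tends to 0, with Gaussian transforms of mass one. The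
  -- weighted bound is uniform in b and Fatou's lemma removes the weight.
  set κ : ℝ → ℝ × ℝ → ℝ := fun b c =>
    Real.exp (-Real.pi * b * c.1 ^ 2) * Real.exp (-Real.pi * b * c.2 ^ 2) with hκ
  have hE : Continuous fun c : ℝ × ℝ => extension A univ F (tr c) :=
    (continuous_extension A hF.integrableOn).comp (by fun_prop)
  have hb : ∀ n : ℕ, ∫⁻ c, ENNReal.ofReal (κ (1 / ((n : ℝ) + 1)) c) *
      ‖extension A univ F (tr c)‖ₑ ^ 2 ≤ ∫⁻ q, ‖F q‖ₑ ^ 2 := by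
    intro n
    set b : ℝ := 1 / ((n : ℝ) + 1)
    have hb : 0 < b := by positivity
    set γ : ℝ → ℝ := fun t => 1 / b ^ (1 / 2 : ℝ) * Real.exp (-Real.pi / b * t ^ 2) with hγ
    have hγ0 : ∀ t, 0 ≤ γ t := fun t => by rw [hγ]; positivity
    have hγi : Integrable γ := by
      refine Integrable.const_mul ?_ _
      have := integrable_exp_neg_mul_sq (b := Real.pi / b) (by positivity)
      simpa only [neg_div'] using this
    have hgi : Integrable fun c : ℝ => ((Real.exp (-Real.pi * b * c ^ 2) : ℝ) : ℂ) := by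
      have := integrable_exp_neg_mul_sq (b := Real.pi * b) (by positivity)
      simp only [neg_mul] at this ⊢
      exact this.ofReal
    refine lintegral_fourier_sq_mul_le A hF (κ := κ b) (Γ := fun u => γ u.1 * γ u.2) ?_
      (fun c => by positivity) (fun u => mul_nonneg (hγ0 _) (hγ0 _))
      (Continuous.measurable (by fun_prop)) ?_ (fun u => ?_)
    · refine (hgi.mul_prod hgi).congr (ae_of_all _ fun c => ?_)
      simp [hκ]
    · have h1 : Integrable fun u : ℝ × ℝ => γ u.1 * γ u.2 := hγi.mul_prod hγi
      rw [← ofReal_integral_eq_lintegral_ofReal h1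
        (ae_of_all _ fun u => mul_nonneg (hγ0 _) (hγ0 _))]
      rw [Measure.volume_eq_prod, integral_prod_mul, integral_gaussian_dual hb]
      simp
    · have := integral_prod_mul (μ := (volume : Measure ℝ)) (ν := (volume : Measure ℝ))
        (fun c => ((Real.exp (-Real.pi * b * c ^ 2) : ℝ) : ℂ) * ee (c * u.1))
        (fun c => ((Real.exp (-Real.pi * b * c ^ 2) : ℝ) : ℂ) * ee (c * u.2))
      rw [gaussian_fourier hb, gaussian_fourier hb, ← Complex.ofReal_mul] at this
      rw [← this, ← Measure.volume_eq_prod]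
      congr 1; funext c
      rw [ee_add, hκ]; push_cast; ring
  have hlim : ∀ c : ℝ × ℝ, Tendsto (fun n : ℕ => ENNReal.ofReal (κ (1 / ((n : ℝ) + 1)) c) *
      ‖extension A univ F (tr c)‖ₑ ^ 2) atTop (𝓝 (‖extension A univ F (tr c)‖ₑ ^ 2)) := by
    intro c
    have h0 : Tendsto (fun n : ℕ => 1 / ((n : ℝ) + 1)) atTop (𝓝 0) :=
      tendsto_one_div_add_atTop_nhds_zero_nat
    have h1 : Continuous fun b => ENNReal.ofReal (κ b c) :=
      ENNReal.continuous_ofReal.comp (by rw [hκ]; fun_prop)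
    have h2 := (h1.tendsto 0).comp h0
    have h3 : ENNReal.ofReal (κ 0 c) = 1 := by simp [hκ]
    rw [h3] at h2
    have h4 := ENNReal.Tendsto.mul_const (b := ‖extension A univ F (tr c)‖ₑ ^ 2) h2
      (Or.inl one_ne_zero)
    rw [one_mul] at h4
    exact h4
  calc ∫⁻ c, ‖extension A univ F (tr c)‖ₑ ^ 2
      = ∫⁻ c, liminf (fun n : ℕ => ENNReal.ofReal (κ (1 / ((n : ℝ) + 1)) c) *
          ‖extension A univ F (tr c)‖ₑ ^ 2) atTop :=
        lintegral_congr fun c => (hlim c).liminf_eq.symm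
    _ ≤ liminf (fun n : ℕ => ∫⁻ c, ENNReal.ofReal (κ (1 / ((n : ℝ) + 1)) c) *
          ‖extension A univ F (tr c)‖ₑ ^ 2) atTop := by
        refine lintegral_liminf_le fun n => ?_
        refine (ENNReal.measurable_ofReal.comp ?_).mul (hE.measurable.enorm.pow_const 2)
        exact Continuous.measurable (by rw [hκ]; fun_prop)
    _ ≤ _ := by
        refine liminf_le_of_le (by isBoundedDefault) fun b hb' => ?_
        obtain ⟨n, hn⟩ := hb'.exists
        exact hn.trans (hb n)

end SurfaceDecoupling
end

/-! ### Spreading a function over small frequency translations -/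

noncomputable section

namespace SurfaceDecoupling

lemma norm_extension_univ_le (A : Coeffs) (G : ℝ × ℝ → ℂ) (x : EuclideanSpace ℝ (Fin 4)) :
    ‖extension A univ G x‖ ≤ ∫ q, ‖G q‖ := by
  simpa using norm_extension_le A univ G x

/-- The average over small translations along the surface, centred at `c`. -/
def spread (A : Coeffs) (μ : Measure (ℝ × ℝ)) (G : ℝ × ℝ → ℂ) (c : EuclideanSpace ℝ (Fin 4))
    (q : ℝ × ℝ) : ℂ :=
  ∫ w, G (q - w) * ee (inner ℝ c (surface A (q - w)) - inner ℝ c (surface A q)) ∂μ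

/-- The action of `spread` on extensions. -/
def spreadExt (A : Coeffs) (μ : Measure (ℝ × ℝ)) (F : EuclideanSpace ℝ (Fin 4) → ℂ)
    (c x : EuclideanSpace ℝ (Fin 4)) : ℂ :=
  ∫ w, ee (inner ℝ (x - c) (surface A w)) * F (x + tr (grad A w (vpart (x - c)))) ∂μ

@[fun_prop]
lemma continuous_grad {X : Type*} [TopologicalSpace X] (A : Coeffs) {w v : X → ℝ × ℝ}
    (hw : Continuous w) (hv : Continuous v) : Continuous fun z => grad A (w z) (v z) := by
  unfold grad; fun_prop

lemma measurable_surface_inner {X : Type*} [MeasurableSpace X] (A : Coeffs)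
    {f : X → EuclideanSpace ℝ (Fin 4)} {g : X → ℝ × ℝ} (hf : Measurable f) (hg : Measurable g) :
    Measurable fun z => (inner ℝ (f z) (surface A (g z)) : ℝ) :=
  hf.inner ((continuous_surface A).measurable.comp hg)

section
variable (A : Coeffs) (μ : Measure (ℝ × ℝ))

/-- This keeps a spread piece inside its cap when the piece leaves room for translations in Q. -/
lemma spread_eq_zero {G : ℝ × ℝ → ℂ} {Q : Set (ℝ × ℝ)} (hQ : ∀ᵐ w ∂μ, w ∈ Q) (c : EuclideanSpace ℝ (Fin 4))
    {q : ℝ × ℝ} (h : ∀ w ∈ Q, G (q - w) = 0) : spread A μ G c q = 0 := by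
  refine integral_eq_zero_of_ae ?_
  filter_upwards [hQ] with w hw
  simp [h w hw]

lemma enorm_spreadExt_le {F : EuclideanSpace ℝ (Fin 4) → ℂ} (c x : EuclideanSpace ℝ (Fin 4)) :
    ‖spreadExt A μ F c x‖ₑ ≤ ∫⁻ w, ‖F (x + tr (grad A w (vpart (x - c))))‖ₑ ∂μ := by
  refine (enorm_integral_le_lintegral_enorm _).trans (le_of_eq (lintegral_congr fun w => ?_))
  rw [enorm_mul, ← ofReal_norm (ee _), norm_ee, ENNReal.ofReal_one, one_mul]

variable [IsProbabilityMeasure μ] {G : ℝ × ℝ → ℂ}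

lemma integrable_spread_prod (hGm : Measurable G) (hG : Integrable G)
    (c : EuclideanSpace ℝ (Fin 4)) :
    Integrable (fun z : (ℝ × ℝ) × (ℝ × ℝ) => G (z.1 - z.2) *
      ee (inner ℝ c (surface A (z.1 - z.2)) - inner ℝ c (surface A z.1)))
      ((volume : Measure (ℝ × ℝ)).prod μ) := by
  have h0 : Measurable fun z : (ℝ × ℝ) × (ℝ × ℝ) => G (z.1 - z.2) :=
    hGm.comp (measurable_fst.sub measurable_snd)
  have h1 : Integrable (fun z : (ℝ × ℝ) × (ℝ × ℝ) => G (z.1 - z.2))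
      ((volume : Measure (ℝ × ℝ)).prod μ) := by
    rw [integrable_prod_iff' h0.aestronglyMeasurable]
    refine ⟨ae_of_all _ fun w => hG.comp_sub_right w, ?_⟩
    have : (fun w : ℝ × ℝ => ∫ q : ℝ × ℝ, ‖G (q - w)‖) = fun _ => ∫ q, ‖G q‖ := by
      funext w
      exact integral_sub_right_eq_self (fun q => ‖G q‖) w
    simp only [this]
    exact integrable_const _
  refine integrable_mul_bdd h1 (Measurable.aestronglyMeasurable ?_) fun _ => (norm_ee _).le
  exact continuous_ee.measurable.comp
    ((measurable_surface_inner A measurable_const (measurable_fst.sub measurable_snd)).sub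
      (measurable_surface_inner A measurable_const measurable_fst))

lemma integrable_spread (hGm : Measurable G) (hG : Integrable G)
    (c : EuclideanSpace ℝ (Fin 4)) : Integrable (spread A μ G c) :=
  (integrable_spread_prod A μ hGm hG c).integral_prod_left

/-- After Fubini and q ↦ q + w, the expansion of (x - c)·Ψ(q + w) applies. The modulation by c makes
the resulting horizontal shift proportional to the vertical part of x - c, hence small near c. -/
lemma extension_spread (hGm : Measurable G) (hG : Integrable G)
    (c x : EuclideanSpace ℝ (Fin 4)) :
    extension A univ (spread A μ G c) x = spreadExt A μ (extension A univ G) c x := by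
  have hm : Measurable fun z : (ℝ × ℝ) × (ℝ × ℝ) => ee (inner ℝ x (surface A z.1)) :=
    continuous_ee.measurable.comp (measurable_surface_inner A measurable_const measurable_fst)
  have hn : ∀ z : (ℝ × ℝ) × (ℝ × ℝ), ‖ee (inner ℝ x (surface A z.1))‖ ≤ 1 :=
    fun z => (norm_ee _).le
  have hi := integrable_mul_bdd (integrable_spread_prod A μ hGm hG c) hm.aestronglyMeasurable hn
  simp only [extension_eq, spread, spreadExt, Measure.restrict_univ, ← integral_mul_const]
  rw [integral_integral_swap (f := fun q w => G (q - w) *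
    ee (inner ℝ c (surface A (q - w)) - inner ℝ c (surface A q)) *
      ee (inner ℝ x (surface A q))) hi]
  refine integral_congr_ae (ae_of_all _ fun w => ?_)
  dsimp only
  rw [← integral_add_right_eq_self (fun q => G (q - w) *
    ee (inner ℝ c (surface A (q - w)) - inner ℝ c (surface A q)) *
      ee (inner ℝ x (surface A q))) w, ← integral_const_mul]
  refine integral_congr_ae (ae_of_all _ fun q => ?_)
  dsimp only
  rw [add_sub_cancel_right, mul_assoc, ← ee_add, mul_left_comm, ← ee_add]
  congr 2
  have h1 := inner_surface_add A (x - c) q w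
  simp only [inner_sub_left, inner_add_left] at h1 ⊢
  linarith

variable {F : EuclideanSpace ℝ (Fin 4) → ℂ}

lemma measurable_spreadExt (hF : Continuous F) :
    Measurable fun z : EuclideanSpace ℝ (Fin 4) × EuclideanSpace ℝ (Fin 4) =>
      spreadExt A μ F z.1 z.2 := by
  have h1 : Measurable fun y : (EuclideanSpace ℝ (Fin 4) × EuclideanSpace ℝ (Fin 4)) × (ℝ × ℝ) =>
      ee (inner ℝ (y.1.2 - y.1.1) (surface A y.2)) :=
    continuous_ee.measurable.comp (measurable_surface_inner A
      ((measurable_snd.comp measurable_fst).sub (measurable_fst.comp measurable_fst))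
      measurable_snd)
  have h2 : Continuous fun y : (EuclideanSpace ℝ (Fin 4) × EuclideanSpace ℝ (Fin 4)) × (ℝ × ℝ) =>
      y.1.2 + tr (grad A y.2 (vpart (y.1.2 - y.1.1))) := by fun_prop
  exact (StronglyMeasurable.integral_prod_right
    (f := fun (z : EuclideanSpace ℝ (Fin 4) × EuclideanSpace ℝ (Fin 4)) (w : ℝ × ℝ) =>
      ee (inner ℝ (z.2 - z.1) (surface A w)) * F (z.2 + tr (grad A w (vpart (z.2 - z.1)))))
    (h1.mul (hF.comp h2).measurable).stronglyMeasurable).measurable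

lemma integrable_spreadExt (hF : Continuous F) {B : ℝ} (hB : ∀ x, ‖F x‖ ≤ B)
    (c x : EuclideanSpace ℝ (Fin 4)) :
    Integrable (fun w => ee (inner ℝ (x - c) (surface A w)) *
      F (x + tr (grad A w (vpart (x - c))))) μ := by
  have h2 : Continuous fun w : ℝ × ℝ => x + tr (grad A w (vpart (x - c))) := by fun_prop
  refine Integrable.of_bound (C := B) (Measurable.aestronglyMeasurable ?_)
    (ae_of_all _ fun w => ?_)
  · exact (continuous_ee.measurable.comp (measurable_surface_inner A measurable_const
      measurable_id)).mul (hF.comp h2).measurable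
  · rw [norm_mul, norm_ee, one_mul]; exact hB _

lemma spreadExt_sum {ι : Type*} (T : Finset ι) {F : ι → EuclideanSpace ℝ (Fin 4) → ℂ}
    (hF : ∀ i, Continuous (F i)) (hB : ∀ i, ∃ B : ℝ, ∀ x, ‖F i x‖ ≤ B)
    (c x : EuclideanSpace ℝ (Fin 4)) :
    spreadExt A μ (fun y => ∑ i ∈ T, F i y) c x = ∑ i ∈ T, spreadExt A μ (F i) c x := by
  simp only [spreadExt, Finset.mul_sum]
  exact integral_finsetSum _ fun i _ => (integrable_spreadExt A μ (hF i) (hB i).choose_spec c x)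

/-- `spreadExt` almost reproduces a function near the centre. -/
lemma enorm_sub_spreadExt_le (hF : Continuous F) {B : ℝ} (hB : ∀ x, ‖F x‖ ≤ B)
    (c x : EuclideanSpace ℝ (Fin 4)) {Q : Set (ℝ × ℝ)} (hQ : ∀ᵐ w ∂μ, w ∈ Q) {a b : ℝ≥0∞}
    (ha : ∀ w ∈ Q, ‖ee (inner ℝ (x - c) (surface A w)) - 1‖ₑ ≤ a)
    (hb : ∀ w ∈ Q, ‖F (x + tr (grad A w (vpart (x - c)))) - F x‖ₑ ≤ b) :
    ‖F x‖ₑ ≤ ‖spreadExt A μ F c x‖ₑ + (a * ‖F x‖ₑ + b) := by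
  have h1 : F x = spreadExt A μ F c x - ∫ w, (ee (inner ℝ (x - c) (surface A w)) *
      F (x + tr (grad A w (vpart (x - c)))) - F x) ∂μ := by
    rw [integral_sub (integrable_spreadExt A μ hF hB c x) (integrable_const _), spreadExt]
    simp
  calc ‖F x‖ₑ ≤ ‖spreadExt A μ F c x‖ₑ + ‖∫ w, (ee (inner ℝ (x - c) (surface A w)) *
      F (x + tr (grad A w (vpart (x - c)))) - F x) ∂μ‖ₑ := by
        conv_lhs => rw [h1]
        exact enorm_sub_le
    _ ≤ _ := by
        gcongr
        calc _ ≤ ∫⁻ w, ‖ee (inner ℝ (x - c) (surface A w)) *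
              F (x + tr (grad A w (vpart (x - c)))) - F x‖ₑ ∂μ :=
              enorm_integral_le_lintegral_enorm _
          _ ≤ ∫⁻ w, (a * ‖F x‖ₑ + b) ∂μ := by
              refine lintegral_mono_ae ?_
              filter_upwards [hQ] with w hw
              have e : ee (inner ℝ (x - c) (surface A w)) *
                  F (x + tr (grad A w (vpart (x - c)))) - F x =
                  (ee (inner ℝ (x - c) (surface A w)) - 1) * F x +
                  ee (inner ℝ (x - c) (surface A w)) *
                    (F (x + tr (grad A w (vpart (x - c)))) - F x) := by ring
              rw [e]
              refine (enorm_add_le _ _).trans ?_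
              rw [enorm_mul, enorm_mul, ← ofReal_norm (ee (inner ℝ (x - c) (surface A w))),
                norm_ee, ENNReal.ofReal_one, one_mul]
              exact add_le_add (mul_le_mul_left (ha w hw) _) (hb w hw)
          _ = _ := by simp

end

lemma lintegral_rpow_two_le {X : Type*} [MeasurableSpace X] {μ : Measure X}
    [IsProbabilityMeasure μ] {p : ℝ} (hp : 2 ≤ p) {h : X → ℝ≥0∞} (hh : Measurable h) :
    (∫⁻ z, h z ^ 2 ∂μ) ≤ (∫⁻ z, h z ^ p ∂μ) ^ (2 / p) := by
  have h1 := lintegral_kernel_rpow_le (μ := μ) (p := p / 2) (by linarith)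
    (κ := fun _ => 1) (h := fun z => h z ^ 2) measurable_const (hh.pow_const 2)
  simp only [one_mul, lintegral_const, measure_univ, mul_one, ENNReal.one_rpow] at h1
  have h2 : ∀ z, (h z ^ 2) ^ (p / 2) = h z ^ p := fun z => by
    rw [← ENNReal.rpow_natCast, ← ENNReal.rpow_mul]
    congr 1; push_cast; ring
  simp only [h2] at h1
  calc _ = ((∫⁻ z, h z ^ 2 ∂μ) ^ (p / 2)) ^ (2 / p) := by
        rw [← ENNReal.rpow_mul, show p / 2 * (2 / p) = 1 by field_simp, ENNReal.rpow_one]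
    _ ≤ _ := ENNReal.rpow_le_rpow h1 (by positivity)

/-- Wave packets spread in `c` are controlled by Bessel's inequality. -/
lemma lintegral_spreadExt_rpow_le (A : Coeffs) {Q : Set (ℝ × ℝ)} (hQ : MeasurableSet Q)
    (hQ0 : volume Q ≠ 0) (hQ1 : volume Q ≠ ⊤) {F : EuclideanSpace ℝ (Fin 4) → ℂ}
    (hF : Continuous F) {B : ℝ} (hB : ∀ x, ‖F x‖ ≤ B) {p : ℝ} (hp : 2 ≤ p)
    (x : EuclideanSpace ℝ (Fin 4)) (v : ℝ × ℝ) :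
    ∫⁻ u, ‖spreadExt A (ProbabilityTheory.cond volume Q) F (pt u v) x‖ₑ ^ p ≤
      (volume Q)⁻¹ * ∫⁻ w, ‖F (x + tr (grad A w (vpart x - v)))‖ₑ ^ p
        ∂(ProbabilityTheory.cond volume Q) := by
  set μ := ProbabilityTheory.cond volume Q with hμ
  have : IsProbabilityMeasure μ := ProbabilityTheory.cond_isProbabilityMeasure_of_finite hQ0 hQ1
  have hμ' : μ = (volume Q)⁻¹ • volume.restrict Q := rfl
  set Φ : ℝ × ℝ → ℂ := fun w => F (x + tr (grad A w (vpart x - v))) with hΦ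
  have hΦc : Continuous Φ := hF.comp (by fun_prop)
  set P : ℝ≥0∞ := ∫⁻ w, ‖Φ w‖ₑ ^ p ∂μ with hP
  have hv : ∀ u, vpart (x - pt u v) = vpart x - v := fun u => by ext <;> simp [vpart, pt]
  -- For fixed x and v all dependence on u sits in the linear phase, so u ↦ `spreadExt` is the
  -- Fourier transform of f evaluated at `hpart x - u`.
  set f : ℝ × ℝ → ℂ := Q.indicator fun w => (((volume Q)⁻¹).toReal : ℂ) *
    (Φ w * ee (inner ℝ (pt 0 (vpart x - v)) (surface A w))) with hf
  have hfi : Integrable f := by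
    rw [hf, integrable_indicator_iff hQ]
    refine Measure.integrableOn_of_bounded (M := ((volume Q)⁻¹).toReal * B) hQ1
      (Measurable.aestronglyMeasurable ?_) (ae_of_all _ fun w => ?_)
    · exact (hΦc.measurable.mul (continuous_ee.measurable.comp (measurable_surface_inner A
        measurable_const measurable_id))).const_mul _
    · rw [norm_mul, norm_mul, norm_ee, mul_one, Complex.norm_real, Real.norm_of_nonneg
        ENNReal.toReal_nonneg]
      exact mul_le_mul_of_nonneg_left (hB _) ENNReal.toReal_nonneg
  have h1 : ∀ u, spreadExt A μ F (pt u v) x = extension A univ f (tr (hpart x - u)) := by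
    intro u
    rw [extension_eq, spreadExt, hμ', integral_smul_measure, Measure.restrict_univ,
      ← integral_smul, ← integral_indicator hQ]
    refine integral_congr_ae (ae_of_all _ fun w => ?_)
    by_cases hw : w ∈ Q
    · simp only [hw, indicator_of_mem, hf, hv, hΦ]
      have e : x - pt u v = tr (hpart x - u) + pt 0 (vpart x - v) := by
        conv_lhs => rw [← pt_parts x]
        rw [pt_sub, tr, pt_add]; simp
      rw [e, inner_add_left, ee_add, Complex.real_smul]
      ring
    · simp [hw, hf]
  -- Bessel: the density of the normalized measure is |Q|⁻¹, so the squared L² norm of f is |Q|⁻¹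
  -- times a mean of |Φ|².
  have h2 : ∫⁻ u, ‖spreadExt A μ F (pt u v) x‖ₑ ^ 2 ≤ (volume Q)⁻¹ * P ^ (2 / p) := by
    simp only [h1]
    rw [lintegral_sub_left_eq_self (fun u => ‖extension A univ f (tr u)‖ₑ ^ 2) (hpart x)]
    refine (lintegral_fourier_sq_le A hfi).trans ?_
    have e : ∀ w, ‖f w‖ₑ ^ 2 = Q.indicator (fun w => ((volume Q)⁻¹) ^ 2 * ‖Φ w‖ₑ ^ 2) w := by
      intro w
      by_cases hw : w ∈ Q
      · simp only [hf, hw, indicator_of_mem]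
        rw [enorm_mul, enorm_mul, ← ofReal_norm (ee _), norm_ee, ENNReal.ofReal_one, mul_one,
          ← ofReal_norm, Complex.norm_real, Real.norm_of_nonneg ENNReal.toReal_nonneg,
          ENNReal.ofReal_toReal (ENNReal.inv_ne_top.2 hQ0), mul_pow]
      · simp [hf, hw]
    simp only [e]
    rw [lintegral_indicator hQ, lintegral_const_mul _ (hΦc.measurable.enorm.pow_const 2), sq,
      mul_assoc]
    gcongr
    have h3 := lintegral_rpow_two_le (μ := μ) hp (h := fun w => ‖Φ w‖ₑ) hΦc.measurable.enorm
    rwa [hμ', lintegral_smul_measure, smul_eq_mul] at h3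
  -- The supremum bound with which the L² estimate is interpolated to reach exponent p.
  have h4 : ∀ u, ‖spreadExt A μ F (pt u v) x‖ₑ ≤ P ^ (1 / p) := fun u => by
    refine (enorm_spreadExt_le A μ _ _).trans ?_
    simp only [hv]
    have h5 := lintegral_kernel_rpow_le (μ := μ) (p := p) (by linarith)
      (κ := fun _ => 1) (h := fun z => ‖Φ z‖ₑ) measurable_const hΦc.measurable.enorm
    simp only [one_mul, lintegral_const, measure_univ, mul_one, ENNReal.one_rpow] at h5
    rwa [one_div, ENNReal.le_rpow_inv_iff (by linarith)]
  calc ∫⁻ u, ‖spreadExt A μ F (pt u v) x‖ₑ ^ p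
      ≤ ∫⁻ u, (P ^ (1 / p)) ^ (p - 2) * ‖spreadExt A μ F (pt u v) x‖ₑ ^ 2 := by
        refine lintegral_mono fun u => ?_
        dsimp only
        calc ‖spreadExt A μ F (pt u v) x‖ₑ ^ p
            = ‖spreadExt A μ F (pt u v) x‖ₑ ^ (p - 2) * ‖spreadExt A μ F (pt u v) x‖ₑ ^ 2 := by
              rw [← ENNReal.rpow_natCast, ← ENNReal.rpow_add_of_nonneg _ _ (by linarith)
                (by norm_num)]
              congr 1; push_cast; ring
          _ ≤ _ := mul_le_mul_left (ENNReal.rpow_le_rpow (h4 u) (by linarith)) _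
    _ = (P ^ (1 / p)) ^ (p - 2) * ∫⁻ u, ‖spreadExt A μ F (pt u v) x‖ₑ ^ 2 := by
        rw [lintegral_const_mul]
        have h6 := measurable_spreadExt A μ hF
        exact ((h6.comp ((Continuous.measurable (by fun_prop : Continuous fun u : ℝ × ℝ =>
          pt u v)).prodMk measurable_const)).enorm).pow_const 2
    _ ≤ (P ^ (1 / p)) ^ (p - 2) * ((volume Q)⁻¹ * P ^ (2 / p)) := by gcongr
    _ = _ := by
        rw [← ENNReal.rpow_mul, mul_left_comm, ← ENNReal.rpow_add_of_nonneg]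
        · congr 1
          rw [show 1 / p * (p - 2) + 2 / p = 1 by field_simp; ring, ENNReal.rpow_one]
        · exact mul_nonneg (by positivity) (by linarith)
        · positivity

end SurfaceDecoupling
end

/-! ### Rescaled weights and the energy of localized packets -/

noncomputable section

namespace SurfaceDecoupling

/-- The weight of a ball, with values in `[0, ∞]`. -/
def bw (c : EuclideanSpace ℝ (Fin 4)) (r : ℝ) (x : EuclideanSpace ℝ (Fin 4)) : ℝ≥0∞ :=
  ENNReal.ofReal (ballWeight c r x)

/-- An integrable bump in the plane at scale `r`. -/
def bump (r : ℝ) (d v : ℝ × ℝ) : ℝ≥0∞ := ENNReal.ofReal ((brk (r⁻¹ • (v - d)) ^ 2)⁻¹)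

lemma measurable_bump {X : Type*} [MeasurableSpace X] (r : ℝ) {d v : X → ℝ × ℝ}
    (hd : Measurable d) (hv : Measurable v) : Measurable fun z => bump r (d z) (v z) := by
  have h : Measurable fun z : ℝ × ℝ => ENNReal.ofReal ((brk z ^ 2)⁻¹) := by
    simpa using measurable_brk_inv 1 2
  exact h.comp ((hv.sub hd).const_smul r⁻¹)

lemma lintegral_bump {r : ℝ} (hr : 0 < r) (d : ℝ × ℝ) :
    ∫⁻ v, bump r d v = ENNReal.ofReal (r ^ 2) * brkMass := by
  have h : Measurable fun z : ℝ × ℝ => ENNReal.ofReal ((brk z ^ 2)⁻¹) := by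
    simpa using measurable_brk_inv 1 2
  unfold bump
  rw [lintegral_sub_right_eq_self (fun v : ℝ × ℝ => ENNReal.ofReal ((brk (r⁻¹ • v) ^ 2)⁻¹)) d,
    brkMass]
  have h1 : Measure.map (fun z : ℝ × ℝ => r⁻¹ • z) volume = ENNReal.ofReal (r ^ 2) • volume := by
    have := Measure.map_addHaar_smul (volume : Measure (ℝ × ℝ)) (r := r⁻¹) (by positivity)
    rw [this]
    congr 2
    rw [Module.finrank_prod, Module.finrank_self, ← inv_pow, inv_inv, abs_of_nonneg (by positivity)]
  rw [← lintegral_map h (measurable_const_smul r⁻¹), h1, lintegral_smul_measure, smul_eq_mul]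

lemma abs_apply_le (x : EuclideanSpace ℝ (Fin 4)) (i : Fin 4) : |x i| ≤ ‖x‖ := by
  simpa using PiLp.norm_apply_le x i

lemma norm_pt_le (u v : ℝ × ℝ) : ‖pt u v‖ ≤ |u.1| + |u.2| + |v.1| + |v.2| := by
  rw [EuclideanSpace.norm_eq, Fin.sum_univ_four]
  refine Real.sqrt_le_iff.2 ⟨by positivity, ?_⟩
  simp only [pt, Real.norm_eq_abs]
  have := mul_nonneg (abs_nonneg u.1) (abs_nonneg u.2)
  have := mul_nonneg (abs_nonneg u.1) (abs_nonneg v.1)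
  have := mul_nonneg (abs_nonneg u.1) (abs_nonneg v.2)
  have := mul_nonneg (abs_nonneg u.2) (abs_nonneg v.1)
  have := mul_nonneg (abs_nonneg u.2) (abs_nonneg v.2)
  have := mul_nonneg (abs_nonneg v.1) (abs_nonneg v.2)
  simp
  nlinarith [sq_abs u.1, sq_abs u.2, sq_abs v.1, sq_abs v.2]

lemma abs_mul_add_le {L η a b x y : ℝ} (ha : |a| ≤ L) (hb : |b| ≤ L) (hx : |x| ≤ η)
    (hy : |y| ≤ η) : |a * x + b * y| ≤ 2 * L * η := by
  have hL : 0 ≤ L := (abs_nonneg _).trans ha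
  calc _ ≤ |a| * |x| + |b| * |y| := by rw [← abs_mul, ← abs_mul]; exact abs_add_le _ _
    _ ≤ L * η + L * η := by gcongr
    _ = _ := by ring

lemma abs_grad_le {A : Coeffs} {L η R : ℝ} (hA : ∀ i, |A i| ≤ L) {w v : ℝ × ℝ} (h1 : |w.1| ≤ η)
    (h2 : |w.2| ≤ η) (hv1 : |v.1| ≤ R) (hv2 : |v.2| ≤ R) :
    |(grad A w v).1| ≤ 8 * L * η * R ∧ |(grad A w v).2| ≤ 8 * L * η * R := by
  have key : ∀ s t : ℝ, |s| ≤ 2 * L * η → |t| ≤ 2 * L * η →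
      |2 * (v.1 * s + v.2 * t)| ≤ 8 * L * η * R := fun s t hs ht => by
    have hR : 0 ≤ R := (abs_nonneg _).trans hv1
    rw [abs_mul, abs_two]
    have : |v.1 * s + v.2 * t| ≤ R * (2 * L * η) + R * (2 * L * η) := by
      refine (abs_add_le _ _).trans ?_
      rw [abs_mul, abs_mul]
      gcongr
    linarith
  exact ⟨key _ _ (abs_mul_add_le (hA _) (hA _) h1 h2) (abs_mul_add_le (hA _) (hA _) h1 h2),
    key _ _ (abs_mul_add_le (hA _) (hA _) h1 h2) (abs_mul_add_le (hA _) (hA _) h1 h2)⟩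

lemma norm_tr_grad_le {A : Coeffs} {L η : ℝ} (hA : ∀ i, |A i| ≤ L) {w : ℝ × ℝ} (h1 : |w.1| ≤ η)
    (h2 : |w.2| ≤ η) (z : EuclideanSpace ℝ (Fin 4)) :
    ‖tr (grad A w (vpart z))‖ ≤ 16 * L * η * ‖z‖ := by
  obtain ⟨h3, h4⟩ := abs_grad_le hA h1 h2 (v := vpart z) (abs_apply_le z 2) (abs_apply_le z 3)
  have := norm_pt_le (grad A w (vpart z)) 0
  simp only [Prod.fst_zero, Prod.snd_zero, abs_zero] at this
  linarith

lemma abs_quad_le {L η a b c x y : ℝ} (ha : |a| ≤ L) (hb : |b| ≤ L) (hc : |c| ≤ L)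
    (hx : |x| ≤ η) (hy : |y| ≤ η) : |a * x ^ 2 + 2 * b * x * y + c * y ^ 2| ≤ 4 * L * η ^ 2 := by
  have hη : 0 ≤ η := (abs_nonneg _).trans hx
  have e : a * x ^ 2 + 2 * b * x * y + c * y ^ 2 = (a * x + b * y) * x + (b * x + c * y) * y := by
    ring
  rw [e]
  calc _ ≤ |a * x + b * y| * |x| + |b * x + c * y| * |y| := by
        rw [← abs_mul, ← abs_mul]; exact abs_add_le _ _
    _ ≤ 2 * L * η * η + 2 * L * η * η :=
        add_le_add (mul_le_mul (abs_mul_add_le ha hb hx hy) hx (abs_nonneg _)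
          ((abs_nonneg _).trans (abs_mul_add_le ha hb hx hy)))
          (mul_le_mul (abs_mul_add_le hb hc hx hy) hy (abs_nonneg _)
          ((abs_nonneg _).trans (abs_mul_add_le hb hc hx hy)))
    _ = _ := by ring

/-- The hypothesis on η makes the quadratic coordinates contribute at most η/2, so the two linear
coordinates dominate. -/
lemma abs_inner_surface_le {A : Coeffs} {L η : ℝ} (hA : ∀ i, |A i| ≤ L) (hη : 16 * L * η ≤ 1)
    {w : ℝ × ℝ} (h1 : |w.1| ≤ η) (h2 : |w.2| ≤ η) (z : EuclideanSpace ℝ (Fin 4)) :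
    |(inner ℝ z (surface A w) : ℝ)| ≤ 3 * η * ‖z‖ := by
  have hη0 : 0 ≤ η := (abs_nonneg _).trans h1
  refine (abs_real_inner_le_norm _ _).trans ?_
  rw [mul_comm]
  refine mul_le_mul_of_nonneg_right ?_ (norm_nonneg z)
  have h3 : surface A w = pt w (quad₁ A w, quad₂ A w) := rfl
  rw [h3]
  refine (norm_pt_le _ _).trans ?_
  have h4 := abs_quad_le (hA 0) (hA 1) (hA 2) h1 h2
  have h5 := abs_quad_le (hA 3) (hA 4) (hA 5) h1 h2
  have h6 : 16 * L * η * η ≤ 1 * η := by gcongr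
  simp only [quad₁, quad₂]
  nlinarith

lemma norm_ee_sub_one_le (t : ℝ) : ‖ee t - 1‖ ≤ 2 * Real.pi * |t| := by
  have h := Real.norm_exp_I_mul_ofReal_sub_one_le (x := 2 * Real.pi * t)
  rw [Real.norm_eq_abs, abs_mul, abs_of_pos (by positivity : (0:ℝ) < 2 * Real.pi)] at h
  rw [ee]
  convert h using 3
  push_cast
  ring_nf

lemma ballWeight_nonneg {c : EuclideanSpace ℝ (Fin 4)} {r : ℝ} (hr : 0 ≤ r)
    (x : EuclideanSpace ℝ (Fin 4)) : 0 ≤ ballWeight c r x := by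
  unfold ballWeight; positivity

/-- A displacement no larger than the distance to the centre at most doubles that distance. -/
lemma bw_le_bw_add {c x z : EuclideanSpace ℝ (Fin 4)} {r : ℝ} (hr : 0 < r)
    (hz : ‖z‖ ≤ ‖x - c‖) : bw c r x ≤ 2 ^ 100 * bw c r (x + z) := by
  have e : (2 : ℝ≥0∞) ^ 100 = ENNReal.ofReal (2 ^ 100) := by
    rw [ENNReal.ofReal_pow (by norm_num)]; norm_num
  rw [e, bw, bw, ← ENNReal.ofReal_mul (by positivity)]
  refine ENNReal.ofReal_le_ofReal ?_
  simp only [ballWeight, dist_eq_norm]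
  have h1 : ‖x + z - c‖ ≤ 2 * ‖x - c‖ := by
    rw [add_sub_right_comm]
    exact (norm_add_le _ _).trans (by linarith)
  have h2 : 1 + ‖x + z - c‖ / r ≤ 2 * (1 + ‖x - c‖ / r) := by
    have : ‖x + z - c‖ / r ≤ 2 * (‖x - c‖ / r) := by
      rw [← mul_div_assoc]; gcongr
    linarith
  rw [mul_one_div, div_le_div_iff₀ (by positivity) (by positivity), one_mul, ← mul_pow]
  gcongr

lemma measurable_bw {X : Type*} [MeasurableSpace X] {c x : X → EuclideanSpace ℝ (Fin 4)} (r : ℝ)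
    (hc : Measurable c) (hx : Measurable x) : Measurable fun z => bw (c z) r (x z) := by
  refine ENNReal.measurable_ofReal.comp ?_
  unfold ballWeight
  exact measurable_const.div (((hx.dist hc).div_const r).const_add 1 |>.pow_const 100)

/-- Weights adapted to the parabolic rescaling of a ball. -/
structure RescaledWeight (C r : ℝ) (W : EuclideanSpace ℝ (Fin 4) → ℝ≥0∞) : Prop where
  measurable : Measurable W
  lintegral_ne_top : ∫⁻ x, W x ≠ ⊤
  slow : ∀ x z, W (x + z) ≤ ENNReal.ofReal (C * (1 + ‖z‖ / r) ^ 100) * W x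
  -- The right side is integrable only in the vertical part of c. Integration over the horizontal
  -- part relies on Bessel's inequality for packets.
  focus : ∃ d, ∀ c x, W c * bw c r x ≤
    ENNReal.ofReal C * W x * (bump r d (vpart c) + bump r (vpart x) (vpart c))

lemma lintegral_le_swap_prod {X Y Z : Type*} [MeasurableSpace X] [MeasurableSpace Y]
    [MeasurableSpace Z] {κ : Measure X} {ρ : Measure Y} {μ : Measure Z} [SFinite κ] [SFinite ρ]
    [SFinite μ] {a : ℝ≥0∞} (ha : a ≠ ⊤) {H : X → Y × Z → ℝ≥0∞}
    (hH : Measurable fun w : X × (Y × Z) => H w.1 w.2) {g : X → Y → ℝ≥0∞}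
    (h : ∀ x y, g x y ≤ a * ∫⁻ z, H x (y, z) ∂μ) :
    ∫⁻ x, ∫⁻ y, g x y ∂ρ ∂κ ≤ a * ∫⁻ w, (∫⁻ x, H x w ∂κ) ∂(ρ.prod μ) := by
  calc ∫⁻ x, ∫⁻ y, g x y ∂ρ ∂κ ≤ ∫⁻ x, a * ∫⁻ w, H x w ∂(ρ.prod μ) ∂κ := by
        refine lintegral_mono fun x => ?_
        have hx : Measurable fun w => H x w := hH.comp (measurable_const.prodMk measurable_id)
        rw [lintegral_prod _ hx.aemeasurable, ← lintegral_const_mul' _ _ ha]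
        exact lintegral_mono (h x)
    _ = _ := by
        rw [lintegral_const_mul' _ _ ha]
        congr 1
        exact lintegral_lintegral_swap hH.aemeasurable

/-- The energy of localized wave packets, averaged over the centre of localization. -/
lemma RescaledWeight.packet_energy_le {C r : ℝ} {W : EuclideanSpace ℝ (Fin 4) → ℝ≥0∞}
    (hW : RescaledWeight C r W) (hr : 0 < r) {A : Coeffs} {L η : ℝ} (hA : ∀ i, |A i| ≤ L)
    (hη : 16 * L * η ≤ 1) {Q : Set (ℝ × ℝ)} (hQ : MeasurableSet Q)
    (hQ0 : volume Q ≠ 0) (hQ1 : volume Q ≠ ⊤) (hQη : ∀ w ∈ Q, |w.1| ≤ η ∧ |w.2| ≤ η)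
    {F : EuclideanSpace ℝ (Fin 4) → ℂ}
    (hF : Continuous F) {B : ℝ} (hB : ∀ x, ‖F x‖ ≤ B) {p : ℝ} (hp : 2 ≤ p) :
    ∫⁻ x, ∫⁻ c, W c * bw c r x * ‖spreadExt A (ProbabilityTheory.cond volume Q) F c x‖ₑ ^ p ≤
      (volume Q)⁻¹ * (2 ^ 100 * ENNReal.ofReal C) * (2 * (ENNReal.ofReal (r ^ 2) * brkMass)) *
        wint p W F := by
  set μ := ProbabilityTheory.cond volume Q with hμ
  have : IsProbabilityMeasure μ := ProbabilityTheory.cond_isProbabilityMeasure_of_finite hQ0 hQ1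
  obtain ⟨d, hd⟩ := hW.focus
  have hμQ : ∀ᵐ w ∂μ, w ∈ Q := ProbabilityTheory.ae_cond_mem hQ
  obtain ⟨β, hβ⟩ : ∃ β : ℝ × ℝ → ℝ × ℝ → ℝ≥0∞, ∀ v y, β v y = bump r d v + bump r y v :=
    ⟨fun v y => bump r d v + bump r y v, fun _ _ => rfl⟩
  obtain ⟨f, hf⟩ : ∃ f : EuclideanSpace ℝ (Fin 4) → ℝ≥0∞, f = fun x => ‖F x‖ₑ ^ p * W x := ⟨_, rfl⟩
  have hfm : Measurable f := hf ▸ (hF.measurable.enorm.pow_const p).mul hW.measurable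
  obtain ⟨D, hD⟩ : ∃ D : ℝ≥0∞, D = 2 ^ 100 * ENNReal.ofReal C := ⟨_, rfl⟩
  rw [← hD]
  have hsm := measurable_spreadExt A μ hF
  -- the pointwise weight bound
  have hwt : ∀ x u v, ∀ w ∈ Q, W (pt u v) * bw (pt u v) r x ≤
      D * W (x + tr (grad A w (vpart x - v))) * β v (vpart x) := by
    intro x u v w hw
    set z := tr (grad A w (vpart x - v)) with hz
    have hv : vpart (x - pt u v) = vpart x - v := by ext <;> simp [vpart, pt]
    have hzn : ‖z‖ ≤ ‖x - pt u v‖ := by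
      have := norm_tr_grad_le hA (hQη w hw).1 (hQη w hw).2 (x - pt u v)
      rw [hv] at this
      exact this.trans (mul_le_of_le_one_left (norm_nonneg _) hη)
    have h1 := hd (pt u v) (x + z)
    have hv2 : vpart (x + z) = vpart x := by ext <;> simp [vpart, pt, hz]
    rw [vpart_pt, hv2, ← hβ] at h1
    calc _ ≤ W (pt u v) * (2 ^ 100 * bw (pt u v) r (x + z)) := by
          gcongr; exact bw_le_bw_add hr hzn
      _ = 2 ^ 100 * (W (pt u v) * bw (pt u v) r (x + z)) := by ring
      _ ≤ 2 ^ 100 * (ENNReal.ofReal C * W (x + z) * β v (vpart x)) := by gcongr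
      _ = _ := by rw [hD]; ring
  have h1 : ∀ x v, ∫⁻ u, W (pt u v) * bw (pt u v) r x * ‖spreadExt A μ F (pt u v) x‖ₑ ^ p ≤
      (volume Q)⁻¹ * ∫⁻ w, D * f (x + tr (grad A w (vpart x - v))) * β v (vpart x) ∂μ := by
    intro x v
    -- The weight bound depends on w but not on u. The infimum over w therefore passes through the
    -- u-integral, and afterwards it is bounded by the value at each w under the average.
    set M : ℝ≥0∞ := ⨅ w ∈ Q, D * W (x + tr (grad A w (vpart x - v))) * β v (vpart x) with hM
    calc _ ≤ ∫⁻ u, M * ‖spreadExt A μ F (pt u v) x‖ₑ ^ p := by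
          refine lintegral_mono fun u => ?_
          refine mul_le_mul_left (le_iInf₂ fun w hw => hwt x u v w hw) _
      _ = M * ∫⁻ u, ‖spreadExt A μ F (pt u v) x‖ₑ ^ p := by
          rw [lintegral_const_mul]
          exact ((hsm.comp ((Continuous.measurable (by fun_prop : Continuous fun u : ℝ × ℝ =>
            pt u v)).prodMk measurable_const)).enorm).pow_const p
      _ ≤ M * ((volume Q)⁻¹ * ∫⁻ w, ‖F (x + tr (grad A w (vpart x - v)))‖ₑ ^ p ∂μ) := by
          gcongr
          exact lintegral_spreadExt_rpow_le A hQ hQ0 hQ1 hF hB hp x v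
      _ = (volume Q)⁻¹ * ∫⁻ w, M * ‖F (x + tr (grad A w (vpart x - v)))‖ₑ ^ p ∂μ := by
          rw [mul_left_comm, lintegral_const_mul]
          exact ((hF.comp (by fun_prop : Continuous fun w : ℝ × ℝ =>
            x + tr (grad A w (vpart x - v)))).measurable.enorm).pow_const p
      _ ≤ _ := by
          refine mul_le_mul_right (lintegral_mono_ae ?_) _
          filter_upwards [hμQ] with w hw
          refine (mul_le_mul_left (iInf₂_le w hw) _).trans (le_of_eq ?_)
          rw [hf]; ring
  have hβm : Measurable fun z : (ℝ × ℝ) × (ℝ × ℝ) => β z.1 z.2 := by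
    simp only [hβ]
    exact (measurable_bump r measurable_const measurable_fst).add
      (measurable_bump r measurable_snd measurable_fst)
  set ν : Measure ((ℝ × ℝ) × (ℝ × ℝ)) := (volume : Measure (ℝ × ℝ)).prod μ with hν
  have hm2 : Measurable fun y : EuclideanSpace ℝ (Fin 4) × ((ℝ × ℝ) × (ℝ × ℝ)) =>
      D * f (y.1 + tr (grad A y.2.2 (vpart y.1 - y.2.1))) * β y.2.1 (vpart y.1) :=
    ((hfm.comp (Continuous.measurable (by fun_prop))).const_mul D).mul
      (hβm.comp ((measurable_fst.comp measurable_snd).prodMk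
        (continuous_vpart.measurable.comp measurable_fst)))
  have h2 : ∫⁻ x, ∫⁻ c, W c * bw c r x * ‖spreadExt A μ F c x‖ₑ ^ p ≤
      (volume Q)⁻¹ * ∫⁻ y, (∫⁻ x, D * f (x + tr (grad A y.2 (vpart x - y.1))) *
        β y.1 (vpart x)) ∂ν := by
    refine le_trans (lintegral_mono fun x => ?_) (lintegral_le_swap_prod
      (ENNReal.inv_ne_top.2 hQ0) hm2 h1)
    refine (lintegral_pt _ ?_).le
    exact (hW.measurable.mul (measurable_bw r measurable_id measurable_const)).mul
        (((hsm.comp (measurable_id.prodMk measurable_const)).enorm).pow_const p)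
  -- For a fixed vertical part of x the shift is a fixed horizontal vector, so it disappears from
  -- the integral over u.
  have h3 : ∀ y : (ℝ × ℝ) × (ℝ × ℝ),
      ∫⁻ x, D * f (x + tr (grad A y.2 (vpart x - y.1))) * β y.1 (vpart x) =
      ∫⁻ x, D * f x * β y.1 (vpart x) := by
    intro y
    have hm4 : Measurable fun x : EuclideanSpace ℝ (Fin 4) =>
        D * f (x + tr (grad A y.2 (vpart x - y.1))) * β y.1 (vpart x) :=
      hm2.comp (measurable_id.prodMk measurable_const)
    rw [lintegral_pt _ hm4, lintegral_pt]
    swap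
    · exact (hfm.const_mul D).mul (hβm.comp (measurable_const.prodMk continuous_vpart.measurable))
    refine lintegral_congr fun v => ?_
    simp only [vpart_pt, tr, pt_add, add_zero]
    exact lintegral_add_right_eq_self (fun u => D * f (pt u v) * β y.1 v) _
  -- Each bump integrates to r² times the bracket mass: this is the vertical half of the r⁴ produced
  -- by averaging over centres.
  have h4 : ∀ x, ∫⁻ y, D * f x * β y.1 (vpart x) ∂ν =
      D * f x * (2 * (ENNReal.ofReal (r ^ 2) * brkMass)) := by
    intro x
    have hm6 : Measurable fun y : (ℝ × ℝ) × (ℝ × ℝ) => β y.1 (vpart x) := by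
      simp only [hβ]
      exact (measurable_bump r measurable_const measurable_fst).add
        (measurable_bump r measurable_const measurable_fst)
    rw [lintegral_const_mul _ hm6, hν, lintegral_prod _ hm6.aemeasurable]
    congr 1
    simp only [lintegral_const, measure_univ, mul_one, hβ]
    have hm8 : Measurable fun v => bump r d v := measurable_bump r measurable_const measurable_id
    rw [lintegral_add_left hm8, lintegral_bump hr, lintegral_bump hr, two_mul]
  have hm7 : Measurable fun w : ((ℝ × ℝ) × (ℝ × ℝ)) × EuclideanSpace ℝ (Fin 4) =>
      D * f w.2 * β w.1.1 (vpart w.2) :=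
    ((hfm.comp measurable_snd).const_mul D).mul (hβm.comp
      ((measurable_fst.comp measurable_fst).prodMk
        (continuous_vpart.measurable.comp measurable_snd)))
  have h5 : ∫⁻ y, (∫⁻ x, D * f x * β y.1 (vpart x)) ∂ν =
      ∫⁻ x, D * f x * (2 * (ENNReal.ofReal (r ^ 2) * brkMass)) :=
    (lintegral_lintegral_swap hm7.aemeasurable).trans (lintegral_congr h4)
  refine h2.trans (le_of_eq ?_)
  rw [lintegral_congr h3, h5, lintegral_mul_const _ (hfm.const_mul D),
    lintegral_const_mul _ hfm, wint, ← hf]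
  ring

end SurfaceDecoupling
end

/-! ### Dyadic squares and one-sided cutoffs -/

noncomputable section

namespace SurfaceDecoupling

open scoped ContDiff

lemma volume_fst_eq_zero (a : ℝ) : volume {q : ℝ × ℝ | q.1 = a} = 0 := by
  have : {q : ℝ × ℝ | q.1 = a} = {a} ×ˢ univ := by ext q; simp
  rw [this, Measure.volume_eq_prod, Measure.prod_prod]; simp

lemma volume_snd_eq_zero (a : ℝ) : volume {q : ℝ × ℝ | q.2 = a} = 0 := by
  have : {q : ℝ × ℝ | q.2 = a} = univ ×ˢ {a} := by ext q; simp
  rw [this, Measure.volume_eq_prod, Measure.prod_prod]; simp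

/-- A coordinate whose indices differ is forced, at a common point, to equal the larger index over
2^k, so the intersection lies on a line. -/
lemma aedisjoint_dsq (k : ℕ) {I J : ℕ × ℕ} (h : I ≠ J) :
    AEDisjoint volume (dsq k I) (dsq k J) := by
  have h2 : (0 : ℝ) < 2 ^ k := by positivity
  have key : ∀ {x : ℝ} {i j : ℕ}, (i : ℝ) ≤ 2 ^ k * x → 2 ^ k * x ≤ i + 1 → (j : ℝ) ≤ 2 ^ k * x →
      2 ^ k * x ≤ j + 1 → i ≠ j → x = (max i j : ℕ) / 2 ^ k := by
    intro x i j h1 h2' h3 h4 hij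
    rw [eq_div_iff h2.ne', mul_comm]
    rcases lt_or_gt_of_ne hij with h5 | h5
    · have : (i : ℝ) + 1 ≤ j := by exact_mod_cast h5
      rw [max_eq_right h5.le]; linarith
    · have : (j : ℝ) + 1 ≤ i := by exact_mod_cast h5
      rw [max_eq_left h5.le]; linarith
  rw [AEDisjoint]
  by_cases h1 : I.1 = J.1
  · refine measure_mono_null (fun q hq => ?_) (volume_snd_eq_zero ((max I.2 J.2 : ℕ) / 2 ^ k))
    obtain ⟨ha, hb⟩ := hq
    rw [mem_dsq] at ha hb
    exact key ha.2.1 ha.2.2 hb.2.1 hb.2.2 fun e => h (Prod.ext h1 e)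
  · refine measure_mono_null (fun q hq => ?_) (volume_fst_eq_zero ((max I.1 J.1 : ℕ) / 2 ^ k))
    obtain ⟨ha, hb⟩ := hq
    rw [mem_dsq] at ha hb
    exact key ha.1.1 ha.1.2 hb.1.1 hb.1.2 h1

/-- Indices of the dyadic squares of side `2^{-k}` in the unit square. -/
def grid (k : ℕ) : Finset (ℕ × ℕ) := Finset.range (2 ^ k) ×ˢ Finset.range (2 ^ k)

lemma mem_grid {k : ℕ} {I : ℕ × ℕ} : I ∈ grid k ↔ I.1 < 2 ^ k ∧ I.2 < 2 ^ k := by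
  simp [grid]

lemma card_grid (k : ℕ) : (grid k).card = 4 ^ k := by
  simp [grid, Finset.card_product, ← mul_pow]

/-- The index of a dyadic subsquare. -/
def sub (k : ℕ) (J I : ℕ × ℕ) : ℕ × ℕ := (J.1 * 2 ^ k + I.1, J.2 * 2 ^ k + I.2)

lemma sub_injective (k : ℕ) (J : ℕ × ℕ) : Function.Injective (sub k J) := by
  intro I I' h
  simp only [sub, Prod.mk.injEq, Nat.add_left_cancel_iff] at h
  exact Prod.ext h.1 h.2

lemma exists_subindex {x : ℝ} {m k j : ℕ} (h1 : (j : ℝ) ≤ 2 ^ m * x) (h2 : 2 ^ m * x ≤ j + 1) :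
    ∃ i < 2 ^ k, ((j * 2 ^ k + i : ℕ) : ℝ) ≤ 2 ^ (m + k) * x ∧
      2 ^ (m + k) * x ≤ (j * 2 ^ k + i : ℕ) + 1 := by
  set t : ℝ := 2 ^ k * (2 ^ m * x - j) with ht
  have hk : (0 : ℝ) < 2 ^ k := by positivity
  have ht0 : 0 ≤ t := mul_nonneg hk.le (by linarith)
  have ht1 : t ≤ 2 ^ k := by rw [ht]; nlinarith
  have e : 2 ^ (m + k) * x = j * 2 ^ k + t := by rw [ht, pow_add]; ring
  rcases ht1.lt_or_eq with h | h
  · refine ⟨⌊t⌋₊, ?_, ?_, ?_⟩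
    · rw [Nat.floor_lt ht0]; exact_mod_cast h
    · rw [e]; push_cast; linarith [Nat.floor_le ht0]
    · rw [e]; push_cast; linarith [Nat.lt_floor_add_one t]
  -- The squares are closed, so the right endpoint is assigned to the last subinterval.
  · have h3 : 1 ≤ 2 ^ k := Nat.one_le_two_pow
    refine ⟨2 ^ k - 1, by omega, ?_, ?_⟩
    · rw [e, h]; push_cast [h3]; linarith
    · rw [e, h]; push_cast [h3]; linarith

lemma subindex_bounds {x : ℝ} {m k j i : ℕ} (hi : i < 2 ^ k)
    (h1 : ((j * 2 ^ k + i : ℕ) : ℝ) ≤ 2 ^ (m + k) * x)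
    (h2 : 2 ^ (m + k) * x ≤ (j * 2 ^ k + i : ℕ) + 1) :
    (j : ℝ) ≤ 2 ^ m * x ∧ 2 ^ m * x ≤ j + 1 := by
  have hk : (0 : ℝ) < 2 ^ k := by positivity
  have hi' : (i : ℝ) + 1 ≤ 2 ^ k := by exact_mod_cast hi
  have e : 2 ^ (m + k) * x = (2 ^ m * x) * 2 ^ k := by rw [pow_add]; ring
  rw [e] at h1 h2
  push_cast at h1 h2
  constructor
  · refine le_of_mul_le_mul_right (a := (2 : ℝ) ^ k) ?_ hk
    have : (0 : ℝ) ≤ i := by positivity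
    linarith
  · refine le_of_mul_le_mul_right (a := (2 : ℝ) ^ k) ?_ hk
    linarith

lemma dsq_sub_subset {m k : ℕ} {J I : ℕ × ℕ} (hI : I ∈ grid k) :
    dsq (m + k) (sub k J I) ⊆ dsq m J := by
  intro q hq
  rw [mem_dsq] at hq ⊢
  rw [mem_grid] at hI
  exact ⟨subindex_bounds hI.1 hq.1.1 hq.1.2, subindex_bounds hI.2 hq.2.1 hq.2.2⟩

lemma dsq_eq_biUnion (m k : ℕ) (J : ℕ × ℕ) :
    dsq m J = ⋃ I : grid k, dsq (m + k) (sub k J I) := by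
  refine Subset.antisymm (fun q hq => ?_) (iUnion_subset fun I => dsq_sub_subset I.2)
  rw [mem_dsq] at hq
  obtain ⟨i, hi, h1, h2⟩ := exists_subindex (k := k) hq.1.1 hq.1.2
  obtain ⟨j, hj, h3, h4⟩ := exists_subindex (k := k) hq.2.1 hq.2.2
  exact mem_iUnion.2 ⟨⟨(i, j), mem_grid.2 ⟨hi, hj⟩⟩, mem_dsq.2 ⟨⟨h1, h2⟩, h3, h4⟩⟩

lemma extension_dsq_eq_sum (A : Coeffs) (m k : ℕ) (J : ℕ × ℕ) {g : ℝ × ℝ → ℂ} {S : Set (ℝ × ℝ)}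
    (hS : MeasurableSet S) (hg : IntegrableOn g (dsq m J ∩ S)) (x : EuclideanSpace ℝ (Fin 4)) :
    extension A (dsq m J ∩ S) g x =
      ∑ I ∈ grid k, extension A (dsq (m + k) (sub k J I) ∩ S) g x := by
  have e : dsq m J ∩ S = ⋃ I : grid k, dsq (m + k) (sub k J I) ∩ S := by
    rw [dsq_eq_biUnion m k J, iUnion_inter]
  rw [e] at hg
  rw [e, extension_eq, integral_iUnion_ae
    (fun I => ((measurableSet_dsq _ _).inter hS).nullMeasurableSet)
    (fun I I' h => (aedisjoint_dsq (m + k) fun e => h (Subtype.ext (sub_injective k J e))).mono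
      inter_subset_left inter_subset_left) (integrable_phase A hg x),
    tsum_fintype, ← Finset.sum_coe_sort (grid k)]
  rfl

lemma unitSquare_eq_dsq : unitSquare = dsq 0 (0, 0) := by
  simp [unitSquare, dsq, square]

lemma sub_zero_index (k : ℕ) (I : ℕ × ℕ) : sub k (0, 0) I = I := by simp [sub]

lemma dsq_subset_unitSquare {k : ℕ} {I : ℕ × ℕ} (hI : I ∈ grid k) : dsq k I ⊆ unitSquare := by
  have := dsq_sub_subset (m := 0) (J := (0, 0)) hI
  rwa [sub_zero_index, zero_add, ← unitSquare_eq_dsq] at this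

lemma measurableSet_unitSquare : MeasurableSet unitSquare :=
  measurableSet_Icc.prod measurableSet_Icc

lemma extension_unitSquare_eq_sum (A : Coeffs) (k : ℕ) {g : ℝ × ℝ → ℂ}
    (hg : IntegrableOn g unitSquare) (x : EuclideanSpace ℝ (Fin 4)) :
    extension A unitSquare g x = ∑ I ∈ grid k, extension A (dsq k I) g x := by
  have h := extension_dsq_eq_sum A 0 k (0, 0) MeasurableSet.univ (g := g)
    (by rwa [inter_univ, ← unitSquare_eq_dsq]) x
  simp only [inter_univ, sub_zero_index, zero_add, ← unitSquare_eq_dsq] at h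
  exact h

lemma extension_sum (A : Coeffs) {S : Set (ℝ × ℝ)} {ι : Type*} (T : Finset ι)
    {h : ι → ℝ × ℝ → ℂ} (hh : ∀ i ∈ T, IntegrableOn (h i) S) (x : EuclideanSpace ℝ (Fin 4)) :
    extension A S (fun q => ∑ i ∈ T, h i q) x = ∑ i ∈ T, extension A S (h i) x := by
  simp only [extension_eq, Finset.sum_mul]
  exact integral_finsetSum _ fun i hi => integrable_phase A (hh i hi) x

lemma extension_eq_univ (A : Coeffs) {S : Set (ℝ × ℝ)} {h : ℝ × ℝ → ℂ}
    (h0 : ∀ q ∉ S, h q = 0) (x : EuclideanSpace ℝ (Fin 4)) :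
    extension A S h x = extension A univ h x := by
  rw [extension_eq, extension_eq, Measure.restrict_univ]
  exact setIntegral_eq_integral_of_forall_compl_eq_zero fun q hq => by rw [h0 q hq, zero_mul]

lemma extension_eq_zero (A : Coeffs) {S T : Set (ℝ × ℝ)} {h : ℝ × ℝ → ℂ}
    (h0 : ∀ q ∉ T, h q = 0) (hST : AEDisjoint volume T S) (x : EuclideanSpace ℝ (Fin 4)) :
    extension A S h x = 0 := by
  rw [extension_eq]
  refine setIntegral_eq_zero_of_ae_eq_zero ?_
  have : ∀ᵐ q, q ∉ T ∩ S := measure_eq_zero_iff_ae_notMem.1 hST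
  filter_upwards [this] with q hq hqS
  rw [h0 q fun hT => hq ⟨hT, hqS⟩, zero_mul]

/-- A smooth partition of unity on `[0,1]` into two pieces. -/
def cutoff : Bool → ℝ → ℂ
  | true, u => (Real.smoothTransition (2 * u - 1 / 2) : ℂ)
  | false, u => 1 - (Real.smoothTransition (2 * u - 1 / 2) : ℂ)

lemma contDiff_cutoff (b : Bool) : ContDiff ℝ ∞ (cutoff b) := by
  have h : ContDiff ℝ ∞ fun u : ℝ => (Real.smoothTransition (2 * u - 1 / 2) : ℂ) :=
    Complex.ofRealCLM.contDiff.comp (Real.smoothTransition.contDiff.comp (by fun_prop))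
  cases b
  · exact contDiff_const.sub h
  · exact h

lemma norm_cutoff_le (b : Bool) (u : ℝ) : ‖cutoff b u‖ ≤ 1 := by
  have h0 := Real.smoothTransition.nonneg (2 * u - 1 / 2)
  have h1 := Real.smoothTransition.le_one (2 * u - 1 / 2)
  cases b
  · rw [cutoff, ← Complex.ofReal_one, ← Complex.ofReal_sub, Complex.norm_real, Real.norm_eq_abs,
      abs_le]
    constructor <;> linarith
  · rw [cutoff, Complex.norm_real, Real.norm_eq_abs, abs_le]
    constructor <;> linarith

/-- The admissible translations for each piece of the partition of unity. -/
def shiftInterval (η : ℝ) : Bool → Set ℝ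
  | true => Icc (-η) 0
  | false => Icc 0 η

lemma measurableSet_shiftInterval (η : ℝ) (b : Bool) : MeasurableSet (shiftInterval η b) := by
  cases b <;> exact measurableSet_Icc

lemma volume_shiftInterval (η : ℝ) (b : Bool) :
    volume (shiftInterval η b) = ENNReal.ofReal η := by
  cases b <;> simp [shiftInterval]

lemma abs_le_of_mem_shiftInterval {η w : ℝ} {b : Bool} (hw : w ∈ shiftInterval η b) :
    |w| ≤ η := by
  cases b <;> rw [abs_le] <;> constructor <;> linarith [hw.1, hw.2]

/-- Each piece stays at distance 1/4 from one end of the interval and is moved only towards that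
end, by at most 1/4. -/
lemma cutoff_shift {η u w : ℝ} {b : Bool} (hη : η ≤ 1 / 4) (hw : w ∈ shiftInterval η b)
    (hu : u ∈ Icc (0 : ℝ) 1) (hc : cutoff b u ≠ 0) : u + w ∈ Icc (0 : ℝ) 1 := by
  cases b
  · have h : u < 3 / 4 := by
      by_contra! h
      refine hc ?_
      rw [cutoff, Real.smoothTransition.one_of_one_le (by linarith)]; simp
    exact ⟨by linarith [hw.1, hu.1], by linarith [hw.2]⟩
  · have h : 1 / 4 < u := by
      by_contra! h
      refine hc ?_
      rw [cutoff, Real.smoothTransition.zero_of_nonpos (by linarith)]; simp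
    exact ⟨by linarith [hw.1], by linarith [hw.2, hu.2]⟩

lemma sum_cutoff (u : ℝ) : ∑ b, cutoff b u = 1 := by
  simp [cutoff]

end SurfaceDecoupling
end

/-! ### Reproduction near the centre and averaging over centres -/

noncomputable section

namespace SurfaceDecoupling

lemma RescaledWeight.trSlow {C r : ℝ} {W : EuclideanSpace ℝ (Fin 4) → ℝ≥0∞}
    (hW : RescaledWeight C r W) (hC : 0 ≤ C) (hr : 0 < r) : TrSlow C r 100 W := by
  refine ⟨hW.measurable, fun x z => (hW.slow x (tr z)).trans ?_⟩
  refine mul_le_mul_left (ENNReal.ofReal_le_ofReal ?_) _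
  have h1 : ‖tr z‖ ≤ |z.1| + |z.2| := by simpa using norm_pt_le z 0
  have h2 : 1 + ‖tr z‖ / r ≤ brk (r⁻¹ • z) := by
    have e : brk (r⁻¹ • z) = (1 + |z.1| / r) * (1 + |z.2| / r) := by
      simp only [brk, Prod.smul_fst, Prod.smul_snd, smul_eq_mul, abs_mul, abs_inv, abs_of_pos hr]
      ring
    have h3 : ‖tr z‖ / r ≤ |z.1| / r + |z.2| / r := by
      rw [← add_div]; gcongr
    have h4 : 0 ≤ |z.1| / r * (|z.2| / r) := by positivity
    rw [e]; nlinarith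
  gcongr

/-- For translations of size δ/r and |x - c| ≤ r both the phase and the horizontal shift are O(δ).
Local constancy at unit scale converts the shift into an error of relative size δ. -/
lemma exists_near_bound {L : ℝ} (hL : 0 < L) : ∃ D : ℝ, 0 < D ∧ ∀ (A : Coeffs), (∀ i, |A i| ≤ L) →
    ∀ r δ : ℝ, 0 < r → 0 < δ → 16 * L * δ ≤ 1 → 1 ≤ r →
    ∀ (μ : Measure (ℝ × ℝ)) [IsProbabilityMeasure μ],
      (∀ᵐ w ∂μ, |w.1| ≤ δ / r ∧ |w.2| ≤ δ / r) →
    ∀ G : ℝ × ℝ → ℂ, Integrable G → (∀ q ∉ unitSquare, G q = 0) →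
    ∀ c x : EuclideanSpace ℝ (Fin 4), ‖x - c‖ ≤ r →
      ‖extension A univ G x‖ₑ ≤ ‖spreadExt A μ (extension A univ G) c x‖ₑ +
        (ENNReal.ofReal (20 * δ) * ‖extension A univ G x‖ₑ +
          ∫⁻ z, ENNReal.ofReal (D * δ * (brk z ^ 102)⁻¹) *
            ‖extension A univ G (x + tr ((1 : ℝ) • z))‖ₑ) := by
  obtain ⟨C, hC, hlc⟩ := exists_local_constancy 102 (by norm_num)
  refine ⟨C * (16 * L), by positivity, fun A hA r δ hr hδ hLδ hr1 μ _ hμ G hG hG0 c x hx => ?_⟩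
  have hF : Continuous (extension A univ G) := continuous_extension A hG.integrableOn
  have hB := norm_extension_univ_le A G
  have hη : 16 * L * (δ / r) ≤ 1 := by
    have : δ / r ≤ δ := div_le_self hδ.le hr1
    have : 16 * L * (δ / r) ≤ 16 * L * δ := by gcongr
    linarith
  have hη0 : 0 < δ / r := by positivity
  have hηr : δ / r * r = δ := by field_simp
  refine enorm_sub_spreadExt_le A μ hF hB c x (Q := {w | |w.1| ≤ δ / r ∧ |w.2| ≤ δ / r}) hμ
    (fun w hw => ?_) (fun w hw => ?_)
  · rw [← ofReal_norm]
    refine ENNReal.ofReal_le_ofReal ((norm_ee_sub_one_le _).trans ?_)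
    have h1 := abs_inner_surface_le hA hη hw.1 hw.2 (x - c)
    have h2 : 3 * (δ / r) * ‖x - c‖ ≤ 3 * δ := by
      have : 3 * (δ / r) * ‖x - c‖ ≤ 3 * (δ / r) * r := by gcongr
      linarith
    have h3 := Real.pi_lt_d2
    have h4 := Real.pi_pos
    -- The constant 20 exceeds 2 · 3.15 · 3.
    calc _ ≤ 2 * 3.15 * (3 * δ) := by
          refine mul_le_mul (by linarith) (h1.trans h2) (abs_nonneg _) (by norm_num)
      _ ≤ _ := by linarith
  · obtain ⟨h1, h2⟩ := abs_grad_le hA hw.1 hw.2 (v := vpart (x - c)) (R := r)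
      ((abs_apply_le (x - c) 2).trans hx) ((abs_apply_le (x - c) 3).trans hx)
    have e : 8 * L * (δ / r) * r = 8 * L * δ := by rw [mul_assoc, hηr]
    rw [e] at h1 h2
    have h3 := hlc A unitSquare measurableSet_unitSquare Subset.rfl G hG.integrableOn
      (grad A w (vpart (x - c))) (by linarith) (by linarith) x
    have h4 : extension A unitSquare G = extension A univ G := by
      funext y; exact extension_eq_univ A hG0 y
    rw [h4] at h3
    refine h3.trans (lintegral_mono fun z => ?_)
    dsimp only
    rw [one_smul]
    have := brk_pos z
    refine mul_le_mul_left (ENNReal.ofReal_le_ofReal ?_) _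
    have h5 : |(grad A w (vpart (x - c))).1| + |(grad A w (vpart (x - c))).2| ≤ 16 * L * δ := by
      linarith
    calc _ ≤ C * (16 * L * δ) * (brk z ^ 102)⁻¹ := by gcongr
      _ = _ := by ring

lemma enorm_absorb {a s t : ℝ≥0∞} (ha : a ≠ ⊤) (h : a ≤ s + (1 / 4 * a + t)) :
    a ≤ 2 * s + 2 * t := by
  by_cases hs : s = ⊤
  · simp [hs]
  by_cases ht : t = ⊤
  · simp [ht]
  have h4 : (1 / 4 : ℝ≥0∞) * a ≠ ⊤ := ENNReal.mul_ne_top (by simp) ha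
  have h' := (ENNReal.toReal_le_toReal ha
    (ENNReal.add_ne_top.2 ⟨hs, ENNReal.add_ne_top.2 ⟨h4, ht⟩⟩)).2 h
  rw [ENNReal.toReal_add hs (ENNReal.add_ne_top.2 ⟨h4, ht⟩), ENNReal.toReal_add h4 ht, ENNReal.toReal_mul] at h'
  have e : (1 / 4 : ℝ≥0∞).toReal = 1 / 4 := by simp
  rw [e] at h'
  have h2s : (2 : ℝ≥0∞) * s ≠ ⊤ := ENNReal.mul_ne_top (by simp) hs
  have h2t : (2 : ℝ≥0∞) * t ≠ ⊤ := ENNReal.mul_ne_top (by simp) ht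
  rw [← ENNReal.toReal_le_toReal ha (by simp [h2s, h2t]), ENNReal.toReal_add h2s h2t,
    ENNReal.toReal_mul, ENNReal.toReal_mul]
  have := ENNReal.toReal_nonneg (a := s)
  have := ENNReal.toReal_nonneg (a := t)
  simp only [ENNReal.toReal_ofNat]
  linarith

lemma le_two_mul_of_le_add_half {a b : ℝ≥0∞} (ha : a ≠ ⊤) (h : a ≤ b + 1 / 2 * a) : a ≤ 2 * b := by
  by_cases hb : b = ⊤
  · simp [hb]
  have h4 : (1 / 2 : ℝ≥0∞) * a ≠ ⊤ := ENNReal.mul_ne_top (by simp) ha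
  have h' := (ENNReal.toReal_le_toReal ha (ENNReal.add_ne_top.2 ⟨hb, h4⟩)).2 h
  rw [ENNReal.toReal_add hb h4, ENNReal.toReal_mul] at h'
  have e : (1 / 2 : ℝ≥0∞).toReal = 1 / 2 := by simp
  rw [e] at h'
  have h2b : (2 : ℝ≥0∞) * b ≠ ⊤ := ENNReal.mul_ne_top (by simp) hb
  rw [← ENNReal.toReal_le_toReal ha h2b, ENNReal.toReal_mul, ENNReal.toReal_ofNat]
  linarith

lemma rpow_two_mul_add_le (s t : ℝ≥0∞) {p : ℝ} (hp : 1 ≤ p) :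
    (2 * s + 2 * t) ^ p ≤ 4 ^ p * s ^ p + (4 * t) ^ p := by
  have hp0 : 0 ≤ p := by linarith
  calc (2 * s + 2 * t) ^ p ≤ 2 ^ (p - 1) * ((2 * s) ^ p + (2 * t) ^ p) :=
        ENNReal.rpow_add_le_mul_rpow_add_rpow _ _ hp
    _ ≤ 2 ^ p * ((2 * s) ^ p + (2 * t) ^ p) := by
        gcongr
        · norm_num
        · linarith
    _ = (4 * s) ^ p + (4 * t) ^ p := by
        rw [mul_add, ← ENNReal.mul_rpow_of_nonneg _ _ hp0, ← ENNReal.mul_rpow_of_nonneg _ _ hp0,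
          ← mul_assoc, ← mul_assoc]
        norm_num
    _ = _ := by rw [ENNReal.mul_rpow_of_nonneg _ _ hp0]

lemma RescaledWeight.le_near {C r : ℝ} {W : EuclideanSpace ℝ (Fin 4) → ℝ≥0∞}
    (hW : RescaledWeight C r W) (hC : 0 ≤ C) (hr : 0 < r) {c x : EuclideanSpace ℝ (Fin 4)}
    (hx : ‖x - c‖ ≤ r) :
    W x ≤ ENNReal.ofReal (C * 2 ^ 100) * ENNReal.ofReal (2 ^ 100) * (W c * bw c r x) := by
  have h0 : ‖x - c‖ / r ≤ 1 := (div_le_one hr).2 hx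
  have h0' : 0 ≤ ‖x - c‖ / r := by positivity
  have h1 : W x ≤ ENNReal.ofReal (C * 2 ^ 100) * W c := by
    have := hW.slow c (x - c)
    rw [add_sub_cancel] at this
    refine this.trans (mul_le_mul_left (ENNReal.ofReal_le_ofReal ?_) _)
    gcongr
    linarith
  have h2 : 1 ≤ ENNReal.ofReal (2 ^ 100) * bw c r x := by
    rw [bw, ← ENNReal.ofReal_mul (by positivity), ← ENNReal.ofReal_one]
    refine ENNReal.ofReal_le_ofReal ?_
    rw [ballWeight, dist_eq_norm, mul_one_div, le_div_iff₀ (by positivity), one_mul]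
    gcongr
    linarith
  calc W x ≤ ENNReal.ofReal (C * 2 ^ 100) * W c * 1 := by rwa [mul_one]
    _ ≤ ENNReal.ofReal (C * 2 ^ 100) * W c * (ENNReal.ofReal (2 ^ 100) * bw c r x) := by gcongr
    _ = _ := by ring

/-- Finiteness is what permits the absorption of error terms in [0, ∞]. -/
lemma wint_ne_top {W : EuclideanSpace ℝ (Fin 4) → ℝ≥0∞} (hW : ∫⁻ x, W x ≠ ⊤)
    {F : EuclideanSpace ℝ (Fin 4) → ℂ} {B : ℝ} (hB : ∀ x, ‖F x‖ ≤ B) {p : ℝ} (hp : 0 ≤ p) :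
    wint p W F ≠ ⊤ := by
  have h : wint p W F ≤ ENNReal.ofReal B ^ p * ∫⁻ x, W x := by
    rw [← lintegral_const_mul' _ _ (ENNReal.rpow_ne_top_of_nonneg hp ENNReal.ofReal_ne_top)]
    refine lintegral_mono fun x => mul_le_mul_left (ENNReal.rpow_le_rpow ?_ hp) _
    rw [← ofReal_norm]
    exact ENNReal.ofReal_le_ofReal (hB x)
  exact ne_top_of_le_ne_top (ENNReal.mul_ne_top
    (ENNReal.rpow_ne_top_of_nonneg hp ENNReal.ofReal_ne_top) hW) h

/-- Averaging local bounds over the centre of localization. -/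
lemma RescaledWeight.average_le {C r : ℝ} {W : EuclideanSpace ℝ (Fin 4) → ℝ≥0∞}
    (hW : RescaledWeight C r W) (hC : 1 ≤ C) (hr : 1 ≤ r) {F : EuclideanSpace ℝ (Fin 4) → ℂ}
    (hF : Continuous F) {B : ℝ} (hB : ∀ x, ‖F x‖ ≤ B) {D : ℝ} (hD : 0 ≤ D)
    (hD' : 4 * (ENNReal.ofReal (D * C) * brkMass) ≤ 1 / 2)
    {S : EuclideanSpace ℝ (Fin 4) → EuclideanSpace ℝ (Fin 4) → ℝ≥0∞}
    (hS : Measurable fun z : EuclideanSpace ℝ (Fin 4) × EuclideanSpace ℝ (Fin 4) => S z.1 z.2)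
    (h : ∀ c x, ‖x - c‖ ≤ r → ‖F x‖ₑ ≤ S c x + (1 / 4 * ‖F x‖ₑ +
      ∫⁻ z, ENNReal.ofReal (D * (brk z ^ 102)⁻¹) * ‖F (x + tr ((1 : ℝ) • z))‖ₑ))
    {p : ℝ} (hp : 1 ≤ p) :
    volume (Metric.closedBall (0 : EuclideanSpace ℝ (Fin 4)) r) * wint p W F ≤
      2 * (4 ^ p * (ENNReal.ofReal (C * 2 ^ 100) * ENNReal.ofReal (2 ^ 100)) *
        ∫⁻ x, ∫⁻ c, W c * bw c r x * S c x ^ p) := by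
  have hr0 : 0 < r := by linarith
  have hp0 : 0 ≤ p := by linarith
  obtain ⟨D₃, hD₃⟩ : ∃ D₃, D₃ = ENNReal.ofReal (C * 2 ^ 100) * ENNReal.ofReal (2 ^ 100) := ⟨_, rfl⟩
  have hD₃t : D₃ ≠ ⊤ := by rw [hD₃]; exact ENNReal.mul_ne_top ENNReal.ofReal_ne_top ENNReal.ofReal_ne_top
  obtain ⟨T, hT⟩ : ∃ T : EuclideanSpace ℝ (Fin 4) → ℝ≥0∞, ∀ x, T x =
    ∫⁻ z, ENNReal.ofReal (D * (brk z ^ 102)⁻¹) * ‖F (x + tr ((1 : ℝ) • z))‖ₑ := ⟨_, fun _ => rfl⟩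
  simp only [← hT] at h
  rw [← hD₃]
  set v := volume (Metric.closedBall (0 : EuclideanSpace ℝ (Fin 4)) r) with hv
  have hvt : v ≠ ⊤ := measure_closedBall_lt_top.ne
  -- The error has L^p(W) norm small enough for half of the total to be absorbed: 1/2 raised to any
  -- p ≥ 1 is still at most 1/2.
  have hTW : ∫⁻ x, (4 * T x) ^ p * W x ≤ 1 / 2 * wint p W F := by
    have h1 := (hW.trSlow (by linarith) hr0).wint_le hC hr0 hD zero_le_one hr hp hF.measurable
      (F := T) (fun x => (hT x).le)
    calc ∫⁻ x, (4 * T x) ^ p * W x = 4 ^ p * ∫⁻ x, T x ^ p * W x := by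
          rw [← lintegral_const_mul' _ _ (ENNReal.rpow_ne_top_of_nonneg hp0 (by simp))]
          refine lintegral_congr fun x => ?_
          rw [ENNReal.mul_rpow_of_nonneg _ _ hp0, mul_assoc]
      _ ≤ 4 ^ p * ((ENNReal.ofReal (D * C) * brkMass) ^ p * wint p W F) := by gcongr
      _ = (4 * (ENNReal.ofReal (D * C) * brkMass)) ^ p * wint p W F := by
          rw [ENNReal.mul_rpow_of_nonneg 4 _ hp0, mul_assoc]
      _ ≤ 1 / 2 * wint p W F := by
          gcongr
          calc _ ≤ (1 / 2 : ℝ≥0∞) ^ p := ENNReal.rpow_le_rpow hD' hp0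
            _ ≤ (1 / 2 : ℝ≥0∞) ^ (1 : ℝ) :=
                ENNReal.rpow_le_rpow_of_exponent_ge (by simp) hp
            _ = _ := ENNReal.rpow_one _
  have hpt : ∀ c x, ‖x - c‖ ≤ r → ‖F x‖ₑ ^ p * W x ≤
      4 ^ p * D₃ * (W c * bw c r x * S c x ^ p) + (4 * T x) ^ p * W x := by
    intro c x hx
    calc ‖F x‖ₑ ^ p * W x ≤ (4 ^ p * S c x ^ p + (4 * T x) ^ p) * W x := by
          refine mul_le_mul_left ?_ _
          exact (ENNReal.rpow_le_rpow (enorm_absorb enorm_ne_top (h c x hx)) hp0).trans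
            (rpow_two_mul_add_le _ _ hp)
      _ = 4 ^ p * S c x ^ p * W x + (4 * T x) ^ p * W x := by rw [add_mul]
      _ ≤ 4 ^ p * S c x ^ p * (D₃ * (W c * bw c r x)) + (4 * T x) ^ p * W x := by
          gcongr
          rw [hD₃]
          exact hW.le_near (by linarith) hr0 hx
      _ = _ := by ring
  have hSm : Measurable fun z : EuclideanSpace ℝ (Fin 4) × EuclideanSpace ℝ (Fin 4) =>
      W z.2 * bw z.2 r z.1 * S z.2 z.1 ^ p :=
    ((hW.measurable.comp measurable_snd).mul (measurable_bw r measurable_snd measurable_fst)).mul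
      ((hS.comp measurable_swap).pow_const p)
  have hX : wint p W F ≠ ⊤ := wint_ne_top hW.lintegral_ne_top hB hp0
  refine le_two_mul_of_le_add_half (ENNReal.mul_ne_top hvt hX) ?_
  have hc4 : (4 : ℝ≥0∞) ^ p * D₃ ≠ ⊤ :=
    ENNReal.mul_ne_top (ENNReal.rpow_ne_top_of_nonneg hp0 (by simp)) hD₃t
  -- The bound at x holds for every centre c within r of x. Integrating it over these centres
  -- produces the volume of the ball on the left.
  calc v * wint p W F = ∫⁻ x, ∫⁻ _ in Metric.closedBall x r, ‖F x‖ₑ ^ p * W x := by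
        rw [wint, ← lintegral_const_mul' _ _ hvt]
        refine lintegral_congr fun x => ?_
        rw [setLIntegral_const, Measure.addHaar_closedBall_center, mul_comm]
    _ ≤ ∫⁻ x, (4 ^ p * D₃ * (∫⁻ c, W c * bw c r x * S c x ^ p) + v * ((4 * T x) ^ p * W x)) := by
        refine lintegral_mono fun x => ?_
        dsimp only
        calc _ ≤ ∫⁻ c in Metric.closedBall x r,
              (4 ^ p * D₃ * (W c * bw c r x * S c x ^ p) + (4 * T x) ^ p * W x) := by
              refine setLIntegral_mono' Metric.isClosed_closedBall.measurableSet fun c hc => ?_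
              refine hpt c x ?_
              rwa [← dist_eq_norm, dist_comm]
          _ = (∫⁻ c in Metric.closedBall x r, 4 ^ p * D₃ * (W c * bw c r x * S c x ^ p)) +
              v * ((4 * T x) ^ p * W x) := by
              rw [lintegral_add_right _ measurable_const, setLIntegral_const,
                Measure.addHaar_closedBall_center, mul_comm v]
          _ ≤ _ := by
              rw [← lintegral_const_mul' _ _ hc4]
              gcongr
              exact Measure.restrict_le_self
    _ = 4 ^ p * D₃ * (∫⁻ x, ∫⁻ c, W c * bw c r x * S c x ^ p) +
        v * ∫⁻ x, (4 * T x) ^ p * W x := by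
        rw [lintegral_add_left, lintegral_const_mul' _ _ hc4, lintegral_const_mul' _ _ hvt]
        exact hSm.lintegral_prod_right'.const_mul _
    _ ≤ 4 ^ p * D₃ * (∫⁻ x, ∫⁻ c, W c * bw c r x * S c x ^ p) + v * (1 / 2 * wint p W F) := by
        gcongr
    _ = _ := by rw [mul_left_comm v]

end SurfaceDecoupling
end

/-! ### From balls to rescaled weights -/

noncomputable section

namespace SurfaceDecoupling

open scoped ContDiff

/-- Decoupling on balls at scale `r`, in integrated form. -/
def BallDecoupling (A : Coeffs) (k : ℕ) (r p : ℝ) (D : ℝ≥0∞) : Prop :=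
  ∀ g : ℝ × ℝ → ℂ, IntegrableOn g unitSquare → ∀ c,
    wint p (bw c r) (extension A unitSquare g) ≤
      D * ∑ I ∈ grid k, wint p (bw c r) (extension A (dsq k I) g)

/-- Each spread piece still lives in its own cap, so the hypothesis applies to the sum of the spread
pieces, and restricting that sum to one cap returns a single piece. -/
lemma lintegral_spread_le_of_ballDecoupling {A : Coeffs} {k : ℕ} {r p : ℝ} {D : ℝ≥0∞}
    (hD : BallDecoupling A k r p D) {μ : Measure (ℝ × ℝ)} [IsProbabilityMeasure μ]
    {Q : Set (ℝ × ℝ)} (hQ : ∀ᵐ w ∂μ, w ∈ Q) {G : ℕ × ℕ → ℝ × ℝ → ℂ}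
    (hGm : ∀ I, Measurable (G I)) (hG : ∀ I, Integrable (G I))
    (hGQ : ∀ I, ∀ q ∉ dsq k I, ∀ w ∈ Q, G I (q - w) = 0) (c : EuclideanSpace ℝ (Fin 4)) :
    wint p (bw c r) (spreadExt A μ (fun x => ∑ I ∈ grid k, extension A univ (G I) x) c) ≤
      D * ∑ I ∈ grid k, wint p (bw c r) (spreadExt A μ (extension A univ (G I)) c) := by
  have hs : ∀ I, Integrable (spread A μ (G I) c) := fun I =>
    integrable_spread A μ (hGm I) (hG I) c
  have hs0 : ∀ I, ∀ q ∉ dsq k I, spread A μ (G I) c q = 0 := fun I q hq =>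
    spread_eq_zero A μ hQ c (hGQ I q hq)
  have h1 := hD (fun q => ∑ I ∈ grid k, spread A μ (G I) c q)
    (integrable_finsetSum _ fun I _ => hs I).integrableOn c
  have h2 : extension A unitSquare (fun q => ∑ I ∈ grid k, spread A μ (G I) c q) =
      spreadExt A μ (fun x => ∑ I ∈ grid k, extension A univ (G I) x) c := by
    funext x
    rw [extension_sum A _ fun I _ => (hs I).integrableOn, spreadExt_sum A μ _
      (fun I => continuous_extension A (hG I).integrableOn)
      (fun I => ⟨_, norm_extension_univ_le A (G I)⟩)]
    refine Finset.sum_congr rfl fun I hI => ?_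
    rw [extension_eq_univ A fun q hq => hs0 I q fun h => hq (dsq_subset_unitSquare hI h),
      extension_spread A μ (hGm I) (hG I)]
  have h3 : ∀ J ∈ grid k, extension A (dsq k J) (fun q => ∑ I ∈ grid k, spread A μ (G I) c q) =
      spreadExt A μ (extension A univ (G J)) c := by
    intro J hJ
    funext x
    rw [extension_sum A _ fun I _ => (hs I).integrableOn, Finset.sum_eq_single_of_mem J hJ
      fun I _ hIJ => extension_eq_zero A (hs0 I) (aedisjoint_dsq k hIJ) x,
      extension_eq_univ A (hs0 J), extension_spread A μ (hGm J) (hG J)]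
  rw [h2] at h1
  refine h1.trans (le_of_eq ?_)
  congr 1
  exact Finset.sum_congr rfl fun J hJ => by rw [h3 J hJ]

/-- Decoupling on balls implies decoupling for rescaled weights, for functions whose pieces leave
room for small translations. -/
lemma exists_packet_sum_le {L Cw : ℝ} (hL : 0 < L) (hCw : 1 ≤ Cw) :
    ∃ δ : ℝ, 0 < δ ∧ δ ≤ 1 / 4 ∧ ∃ K : ℝ≥0∞, K ≠ ⊤ ∧ ∀ (A : Coeffs), (∀ i, |A i| ≤ L) →
    ∀ (k : ℕ) (r p : ℝ) (D : ℝ≥0∞), 1 ≤ r → 2 ≤ p → BallDecoupling A k r p D →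
    ∀ W, RescaledWeight Cw r W →
    ∀ Q : Set (ℝ × ℝ), MeasurableSet Q → volume Q = ENNReal.ofReal (δ / r) * ENNReal.ofReal (δ / r) →
    (∀ w ∈ Q, |w.1| ≤ δ / r ∧ |w.2| ≤ δ / r) →
    ∀ G : ℕ × ℕ → ℝ × ℝ → ℂ, (∀ I, Measurable (G I)) → (∀ I, Integrable (G I)) →
    (∀ I, ∀ q ∉ dsq k I, G I q = 0) →
    (∀ I, ∀ q ∉ dsq k I, ∀ w ∈ Q, G I (q - w) = 0) →
    wint p W (fun x => ∑ I ∈ grid k, extension A univ (G I) x) ≤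
      4 ^ p * K * D * ∑ I ∈ grid k, wint p W (extension A univ (G I)) := by
  obtain ⟨D₂, hD₂, hnear⟩ := exists_near_bound hL
  set b := brkMass.toReal with hb
  have hb0 : 0 ≤ b := ENNReal.toReal_nonneg
  have hbr : brkMass = ENNReal.ofReal b := (ENNReal.ofReal_toReal brkMass_ne_top).symm
  -- The three summands of the denominator make the phase error 20δ at most 1/4, the horizontal
  -- shifts at most 1, and the averaged error, with its factor 4, at most 1/2.
  set δ : ℝ := 1 / (80 + 16 * L + 8 * (D₂ * Cw * b)) with hδ
  have hden : 0 < 80 + 16 * L + 8 * (D₂ * Cw * b) := by positivity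
  have hδ0 : 0 < δ := by positivity
  have hδden : δ * (80 + 16 * L + 8 * (D₂ * Cw * b)) = 1 := by rw [hδ]; field_simp
  have hx1 : 0 ≤ δ * L := by positivity
  have hx2 : 0 ≤ δ * (D₂ * Cw * b) := by positivity
  have hδ80 : 80 * δ ≤ 1 := by nlinarith
  have hδL : 16 * L * δ ≤ 1 := by nlinarith
  have hδb : 8 * (δ * (D₂ * Cw * b)) ≤ 1 := by nlinarith
  set v₁ := volume (Metric.ball (0 : EuclideanSpace ℝ (Fin 4)) 1) with hv₁
  have hv0 : v₁ ≠ 0 := (Metric.measure_ball_pos volume _ one_pos).ne'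
  have hvt : v₁ ≠ ⊤ := measure_ball_lt_top.ne
  obtain ⟨D₃, hD₃⟩ : ∃ D₃ : ℝ≥0∞, D₃ = ENNReal.ofReal (Cw * 2 ^ 100) * ENNReal.ofReal (2 ^ 100) :=
    ⟨_, rfl⟩
  obtain ⟨D₄, hD₄⟩ : ∃ D₄ : ℝ≥0∞, D₄ = 2 ^ 100 * ENNReal.ofReal Cw := ⟨_, rfl⟩
  have hD₃t : D₃ ≠ ⊤ := by
    rw [hD₃]; exact ENNReal.mul_ne_top ENNReal.ofReal_ne_top ENNReal.ofReal_ne_top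
  have hD₄t : D₄ ≠ ⊤ := by
    rw [hD₄]; exact ENNReal.mul_ne_top (ENNReal.pow_ne_top (by simp)) ENNReal.ofReal_ne_top
  set K : ℝ≥0∞ := v₁⁻¹ * (4 * (D₃ * D₄) * ENNReal.ofReal (1 / δ ^ 2) * brkMass) with hK
  have hKt : K ≠ ⊤ := by
    refine ENNReal.mul_ne_top (ENNReal.inv_ne_top.2 hv0) (ENNReal.mul_ne_top (ENNReal.mul_ne_top
      (ENNReal.mul_ne_top (by simp) (ENNReal.mul_ne_top hD₃t hD₄t)) ENNReal.ofReal_ne_top)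
      brkMass_ne_top)
  refine ⟨δ, hδ0, by linarith, K, hKt, fun A hA k r p D hr hp hD W hW Q hQm hQv hQ G hGm hG hG0
    hGQ => ?_⟩
  have hr0 : 0 < r := by linarith
  have hη : 16 * L * (δ / r) ≤ 1 := by
    have : δ / r ≤ δ := div_le_self hδ0.le hr
    have : 16 * L * (δ / r) ≤ 16 * L * δ := by gcongr
    linarith
  have hδr : 0 < ENNReal.ofReal (δ / r) := ENNReal.ofReal_pos.2 (by positivity)
  have hQ0 : volume Q ≠ 0 := by rw [hQv]; exact mul_ne_zero hδr.ne' hδr.ne'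
  have hQ1 : volume Q ≠ ⊤ := by
    rw [hQv]; exact ENNReal.mul_ne_top ENNReal.ofReal_ne_top ENNReal.ofReal_ne_top
  set μ := ProbabilityTheory.cond volume Q with hμ
  have : IsProbabilityMeasure μ := ProbabilityTheory.cond_isProbabilityMeasure_of_finite hQ0 hQ1
  have hμQ : ∀ᵐ w ∂μ, w ∈ Q := ProbabilityTheory.ae_cond_mem hQm
  have hFc : ∀ I, Continuous (extension A univ (G I)) := fun I =>
    continuous_extension A (hG I).integrableOn
  have hGs : Integrable fun q => ∑ I ∈ grid k, G I q := integrable_finsetSum _ fun I _ => hG I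
  have hF : (fun x => ∑ I ∈ grid k, extension A univ (G I) x) =
      extension A univ fun q => ∑ I ∈ grid k, G I q := by
    funext x
    rw [extension_sum A _ fun I _ => (hG I).integrableOn]
  have h1 := hW.average_le hCw hr (F := fun x => ∑ I ∈ grid k, extension A univ (G I) x)
    (by rw [hF]; exact continuous_extension A hGs.integrableOn)
    (B := ∫ q, ‖∑ I ∈ grid k, G I q‖)
    (fun x => by rw [congrFun hF x]; exact norm_extension_univ_le A _ x)
    (D := D₂ * δ) (by positivity)
    (by
      rw [hbr, ← ENNReal.ofReal_mul (by positivity)]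
      have e4 : (4 : ℝ≥0∞) = ENNReal.ofReal 4 := by simp
      have e2 : (1 / 2 : ℝ≥0∞) = ENNReal.ofReal (1 / 2) := by
        rw [ENNReal.ofReal_div_of_pos (by norm_num)]; simp
      rw [e4, e2, ← ENNReal.ofReal_mul (by norm_num)]
      refine ENNReal.ofReal_le_ofReal ?_
      nlinarith)
    (S := fun c x => ‖spreadExt A μ (fun x => ∑ I ∈ grid k, extension A univ (G I) x) c x‖ₑ)
    (by
      rw [hF]
      exact (measurable_spreadExt A μ (continuous_extension A hGs.integrableOn)).enorm)
    (fun c x hx => by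
      have h2 := hnear A hA r δ hr0 hδ0 hδL hr μ (by filter_upwards [hμQ] with w hw using hQ w hw)
        (fun q => ∑ I ∈ grid k, G I q) hGs (fun q hq => Finset.sum_eq_zero fun I hI =>
          hG0 I q fun h => hq (dsq_subset_unitSquare hI h)) c x hx
      rw [← hF] at h2
      refine h2.trans ?_
      gcongr
      rw [show (1 / 4 : ℝ≥0∞) = ENNReal.ofReal (1 / 4) by
        rw [ENNReal.ofReal_div_of_pos (by norm_num)]; simp]
      exact ENNReal.ofReal_le_ofReal (by linarith))
    (p := p) (by linarith)
  rw [← hD₃] at h1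
  have hmeas : ∀ {F : EuclideanSpace ℝ (Fin 4) → ℂ}, Continuous F →
      Measurable fun z : EuclideanSpace ℝ (Fin 4) × EuclideanSpace ℝ (Fin 4) =>
        W z.2 * bw z.2 r z.1 * ‖spreadExt A μ F z.2 z.1‖ₑ ^ p := fun hF =>
    ((hW.measurable.comp measurable_snd).mul (measurable_bw r measurable_snd measurable_fst)).mul
      (((measurable_spreadExt A μ hF).comp measurable_swap).enorm.pow_const p)
  have hswap : ∀ {F : EuclideanSpace ℝ (Fin 4) → ℂ}, Continuous F →
      ∫⁻ x, ∫⁻ c, W c * bw c r x * ‖spreadExt A μ F c x‖ₑ ^ p =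
      ∫⁻ c, W c * wint p (bw c r) (spreadExt A μ F c) := fun {F} hF => by
    rw [lintegral_lintegral_swap (hmeas hF).aemeasurable]
    refine lintegral_congr fun c => ?_
    rw [wint, ← lintegral_const_mul]
    · exact lintegral_congr fun x => by ring
    · exact (((measurable_spreadExt A μ hF).comp (measurable_const.prodMk
        measurable_id)).enorm.pow_const p).mul (measurable_bw r measurable_const measurable_id)
  have hswapm : ∀ {F : EuclideanSpace ℝ (Fin 4) → ℂ}, Continuous F →
      Measurable fun c => W c * wint p (bw c r) (spreadExt A μ F c) := fun {F} hF => by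
    refine hW.measurable.mul (Measurable.lintegral_prod_right'
      (f := fun z : EuclideanSpace ℝ (Fin 4) × EuclideanSpace ℝ (Fin 4) =>
        ‖spreadExt A μ F z.1 z.2‖ₑ ^ p * bw z.1 r z.2) ?_)
    exact ((measurable_spreadExt A μ hF).enorm.pow_const p).mul
      (measurable_bw r measurable_fst measurable_snd)
  have h2 : ∫⁻ x, ∫⁻ c, W c * bw c r x *
      ‖spreadExt A μ (fun x => ∑ I ∈ grid k, extension A univ (G I) x) c x‖ₑ ^ p ≤
      D * ∑ I ∈ grid k, (volume Q)⁻¹ * D₄ * (2 * (ENNReal.ofReal (r ^ 2) * brkMass)) *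
        wint p W (extension A univ (G I)) := by
    rw [hswap (by rw [hF]; exact continuous_extension A hGs.integrableOn)]
    calc _ ≤ ∫⁻ c, D * ∑ I ∈ grid k, W c * wint p (bw c r)
            (spreadExt A μ (extension A univ (G I)) c) := by
          refine lintegral_mono fun c => ?_
          dsimp only
          rw [← Finset.mul_sum, mul_left_comm]
          exact mul_le_mul_right
            (lintegral_spread_le_of_ballDecoupling hD hμQ hGm hG hGQ c) _
      _ = D * ∑ I ∈ grid k, ∫⁻ c, W c * wint p (bw c r)
            (spreadExt A μ (extension A univ (G I)) c) := by
          rw [lintegral_const_mul, lintegral_finsetSum _ fun I _ => hswapm (hFc I)]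
          exact Finset.measurable_fun_sum _ fun I _ => hswapm (hFc I)
      _ ≤ _ := by
          gcongr with I hI
          rw [← hswap (hFc I), hD₄]
          exact hW.packet_energy_le hr0 hA hη hQm hQ0 hQ1 hQ (hFc I)
            (norm_extension_univ_le A (G I)) hp
  set X := wint p W (fun x => ∑ I ∈ grid k, extension A univ (G I) x) with hX
  set R := ENNReal.ofReal (r ^ 2) with hR
  have hR0 : R ≠ 0 := (ENNReal.ofReal_pos.2 (by positivity)).ne'
  have hRt : R ≠ ⊤ := ENNReal.ofReal_ne_top
  have hvol : volume (Metric.closedBall (0 : EuclideanSpace ℝ (Fin 4)) r) = R * R * v₁ := by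
    rw [Measure.addHaar_closedBall _ _ hr0.le, hR, ← ENNReal.ofReal_mul (by positivity)]
    congr 2
    rw [finrank_euclideanSpace_fin]; ring
  -- Q has side δ/r, so |Q|⁻¹ contributes r². Multiplied by the r² of the vertical bumps it cancels
  -- the r⁴ in the volume of the ball.
  have hQinv : (volume Q)⁻¹ = ENNReal.ofReal (1 / δ ^ 2) * R := by
    rw [hQv, ← ENNReal.ofReal_mul (by positivity), ← ENNReal.ofReal_inv_of_pos (by positivity), hR,
      ← ENNReal.ofReal_mul (by positivity)]
    congr 1
    field_simp
  rw [hvol] at h1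
  have h3 : R * R * (v₁ * X) ≤ R * R * (v₁ * (4 ^ p * K * D *
      ∑ I ∈ grid k, wint p W (extension A univ (G I)))) := by
    calc R * R * (v₁ * X) = R * R * v₁ * X := by ring
      _ ≤ _ := h1
      _ ≤ 2 * (4 ^ p * D₃ * (D * ∑ I ∈ grid k, (volume Q)⁻¹ * D₄ * (2 * (R * brkMass)) *
        wint p W (extension A univ (G I)))) := by gcongr
      _ = R * R * ((4 ^ p * (4 * (D₃ * D₄) * ENNReal.ofReal (1 / δ ^ 2) * brkMass) * D *
          ∑ I ∈ grid k, wint p W (extension A univ (G I)))) := by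
          rw [← Finset.mul_sum, hQinv]; ring
      _ = R * R * ((v₁ * v₁⁻¹) * (4 ^ p * (4 * (D₃ * D₄) * ENNReal.ofReal (1 / δ ^ 2) * brkMass) * D
          * ∑ I ∈ grid k, wint p W (extension A univ (G I)))) := by
          rw [ENNReal.mul_inv_cancel hv0 hvt, one_mul]
      _ = _ := by rw [hK]; ring
  rwa [ENNReal.mul_le_mul_iff_right (mul_ne_zero hR0 hR0) (ENNReal.mul_ne_top hRt hRt),
    ENNReal.mul_le_mul_iff_right hv0 hvt] at h3

lemma enorm_rpow_sum_le {ι : Type*} (s : Finset ι) (f : ι → ℂ) {p : ℝ} (hp : 1 ≤ p) :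
    ‖∑ i ∈ s, f i‖ₑ ^ p ≤ (s.card : ℝ≥0∞) ^ p * ∑ i ∈ s, ‖f i‖ₑ ^ p := by
  rcases s.eq_empty_or_nonempty with rfl | hs
  · simp [show 0 < p by linarith]
  have hp0 : 0 ≤ p := by linarith
  calc ‖∑ i ∈ s, f i‖ₑ ^ p ≤ (∑ i ∈ s, ‖f i‖ₑ) ^ p := ENNReal.rpow_le_rpow (enorm_sum_le _ _) hp0
    _ ≤ (s.card : ℝ≥0∞) ^ (p - 1) * ∑ i ∈ s, ‖f i‖ₑ ^ p :=
        ENNReal.rpow_sum_le_const_mul_sum_rpow _ _ hp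
    _ ≤ _ := by
        refine mul_le_mul_left (ENNReal.rpow_le_rpow_of_exponent_le ?_ (by linarith)) _
        exact_mod_cast hs.card_pos

/-- Decoupling on balls implies decoupling for rescaled weights. -/
theorem exists_localized_decoupling {L Cw : ℝ} (hL : 0 < L) (hCw : 1 ≤ Cw) :
    ∃ C : ℝ≥0∞, C ≠ ⊤ ∧ 1 ≤ C ∧ ∀ (A : Coeffs), (∀ i, |A i| ≤ L) →
    ∀ (k : ℕ) (r p : ℝ) (D : ℝ≥0∞), 2 ^ k ≤ r → 2 ≤ p → BallDecoupling A k r p D →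
    ∀ W, RescaledWeight Cw r W → ∀ g : ℝ × ℝ → ℂ, IntegrableOn g unitSquare →
    wint p W (extension A unitSquare g) ≤
      C ^ p * D * ∑ I ∈ grid k, wint p W (extension A (dsq k I) g) := by
  obtain ⟨δ, hδ, hδ4, K, hK, hmain⟩ := exists_packet_sum_le hL hCw
  choose Cm hCm hmult using fun j : Bool × Bool => exists_multiplier_bound (cutoff j.1)
    (cutoff j.2) (contDiff_cutoff _) (contDiff_cutoff _) 102 (by norm_num)
  obtain ⟨M, hMt, hM1, hMj, hMK⟩ : ∃ M : ℝ≥0∞, M ≠ ⊤ ∧ 1 ≤ M ∧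
      (∀ j, ENNReal.ofReal (Cm j * Cw) * brkMass ≤ M) ∧ K ≤ M := by
    refine ⟨1 + (∑ j, ENNReal.ofReal (Cm j * Cw) * brkMass) + K, ?_, ?_, fun j => ?_, ?_⟩
    · refine ENNReal.add_ne_top.2 ⟨ENNReal.add_ne_top.2 ⟨by simp, ?_⟩, hK⟩
      exact ENNReal.sum_ne_top.2 fun j _ => ENNReal.mul_ne_top ENNReal.ofReal_ne_top brkMass_ne_top
    · rw [add_assoc]; exact le_self_add
    · refine le_trans ?_ (le_trans le_add_self le_self_add)
      exact Finset.single_le_sum (f := fun j => ENNReal.ofReal (Cm j * Cw) * brkMass)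
        (fun _ _ => zero_le) (Finset.mem_univ j)
    · exact le_add_self
  refine ⟨4 * (4 * (4 * (M * M))), ENNReal.mul_ne_top (by simp) (ENNReal.mul_ne_top (by simp)
    (ENNReal.mul_ne_top (by simp) (ENNReal.mul_ne_top hMt hMt))), ?_,
    fun A hA k r p D hkr hp hD W hW g hg => ?_⟩
  · have h4 : (1 : ℝ≥0∞) ≤ 4 := by norm_num
    exact one_le_mul h4 (one_le_mul h4 (one_le_mul h4 (one_le_mul hM1 hM1)))
  have hk0 : (0 : ℝ) < 2 ^ k := by positivity
  have hr : 1 ≤ r := (one_le_pow₀ (by norm_num)).trans hkr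
  have hr0 : 0 < r := by linarith
  have hp0 : 0 ≤ p := by linarith
  -- reduce to a measurable function
  wlog hgm : Measurable g with hwlog
  · have h0 := hg.aestronglyMeasurable
    have hae := h0.ae_eq_mk
    have hcongr : ∀ S ⊆ unitSquare, extension A S g = extension A S (h0.mk g) := fun S hS => by
      funext x
      refine integral_congr_ae ?_
      filter_upwards [ae_restrict_of_ae_restrict_of_subset hS hae] with q hq
      rw [hq]
    have h1 := hwlog hL hCw δ hδ hδ4 K hK hmain Cm hCm hmult M hMt hM1 hMj hMK A hA k r p D hkr hp
      hD W hW (h0.mk g) (Integrable.congr hg hae) hk0 hr hr0 hp0 h0.stronglyMeasurable_mk.measurable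
    rw [hcongr _ Subset.rfl, Finset.sum_congr rfl fun I hI => by
      rw [hcongr _ (dsq_subset_unitSquare hI)]]
    exact h1
  set η := δ / r with hη
  have hη0 : 0 < η := by positivity
  -- A translation of size δ/r, measured in units of the cap side, is at most δ because 2^k ≤ r.
  have hkη : 2 ^ k * η ≤ 1 / 4 := by
    rw [hη, ← mul_div_assoc, div_le_iff₀ hr0]; nlinarith
  set cut : Bool × Bool → ℕ × ℕ → ℝ × ℝ → ℂ := fun j I q =>
    cutoff j.1 ((q.1 - (I.1 : ℝ) / 2 ^ k) / (1 / 2 ^ k)) *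
      cutoff j.2 ((q.2 - (I.2 : ℝ) / 2 ^ k) / (1 / 2 ^ k)) with hcut
  have hcutm : ∀ j I, Continuous (cut j I) := fun j I => by
    have h1 := (contDiff_cutoff j.1).continuous
    have h2 := (contDiff_cutoff j.2).continuous
    rw [hcut]
    fun_prop
  have hcutb : ∀ j I q, ‖cut j I q‖ ≤ 1 := fun j I q => by
    rw [hcut, norm_mul]
    exact mul_le_one₀ (norm_cutoff_le _ _) (norm_nonneg _) (norm_cutoff_le _ _)
  have hgi : ∀ I ∈ grid k, IntegrableOn g (dsq k I) := fun I hI =>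
    hg.mono_set (dsq_subset_unitSquare hI)
  set G : Bool × Bool → ℕ × ℕ → ℝ × ℝ → ℂ := fun j I =>
    (dsq k I ∩ unitSquare).indicator fun q => g q * cut j I q with hG
  have hmeas : ∀ I, MeasurableSet (dsq k I ∩ unitSquare) := fun I =>
    (measurableSet_dsq k I).inter measurableSet_unitSquare
  have hint : ∀ j I, IntegrableOn (fun q => g q * cut j I q) (dsq k I ∩ unitSquare) := fun j I =>
    integrable_mul_bdd (hg.mono_set inter_subset_right) (hcutm j I).aestronglyMeasurable (hcutb j I)
  have hGext : ∀ j, ∀ I ∈ grid k, extension A univ (G j I) =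
      extension A (dsq k I) fun q => g q * cut j I q := fun j I hI => by
    rw [hG]
    dsimp only
    rw [extension_univ_indicator A (hmeas I), inter_eq_left.2 (dsq_subset_unitSquare hI)]
  have hpiece : ∀ j, wint p W (fun x => ∑ I ∈ grid k, extension A univ (G j I) x) ≤
      4 ^ p * K * D * (M ^ p * ∑ I ∈ grid k, wint p W (extension A (dsq k I) g)) := by
    intro j
    -- Each of the four cutoffs is paired with the quadrant of translations for which its pieces
    -- have room.
    refine (hmain A hA k r p D hr hp hD W hW (shiftInterval η j.1 ×ˢ shiftInterval η j.2)
      ((measurableSet_shiftInterval _ _).prod (measurableSet_shiftInterval _ _)) ?_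
      (fun w hw => ⟨abs_le_of_mem_shiftInterval hw.1, abs_le_of_mem_shiftInterval hw.2⟩) (G j)
      (fun I => (hgm.mul (hcutm j I).measurable).indicator (hmeas I))
      (fun I => (integrable_indicator_iff (hmeas I)).2 (hint j I))
      (fun I q hq => indicator_of_notMem (fun h => hq h.1) _)
      (fun I q hq w hw => ?_)).trans ?_
    · rw [Measure.volume_eq_prod, Measure.prod_prod, volume_shiftInterval, volume_shiftInterval]
    · by_contra hne
      have hmem : q - w ∈ dsq k I := by
        by_contra h
        exact hne (indicator_of_notMem (fun h' => h h'.1) _)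
      have hc : cut j I (q - w) ≠ 0 := fun h => hne (by
        exact indicator_apply_eq_zero.2 fun _ => by rw [h, mul_zero])
      refine hq ?_
      rw [hcut] at hc
      have e1 : ∀ a i : ℝ, (a - i / 2 ^ k) / (1 / 2 ^ k) = 2 ^ k * a - i := fun a i => by
        field_simp
      simp only [e1] at hc
      rw [mem_dsq] at hmem ⊢
      have key : ∀ {b : Bool} {a t : ℝ} {i : ℕ}, t ∈ shiftInterval η b →
          (i : ℝ) ≤ 2 ^ k * (a - t) → 2 ^ k * (a - t) ≤ i + 1 →
          cutoff b (2 ^ k * (a - t) - i) ≠ 0 → (i : ℝ) ≤ 2 ^ k * a ∧ 2 ^ k * a ≤ i + 1 := by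
        intro b a t i ht h1 h2 h3
        have ht' : 2 ^ k * t ∈ shiftInterval (2 ^ k * η) b := by
          cases b
          · exact ⟨mul_nonneg hk0.le ht.1, mul_le_mul_of_nonneg_left ht.2 hk0.le⟩
          · refine ⟨?_, mul_nonpos_of_nonneg_of_nonpos hk0.le ht.2⟩
            rw [← mul_neg]
            exact mul_le_mul_of_nonneg_left ht.1 hk0.le
        have := cutoff_shift hkη ht' ⟨by linarith, by linarith⟩ h3
        constructor <;> linarith [this.1, this.2]
      exact ⟨key hw.1 hmem.1.1 hmem.1.2 (left_ne_zero_of_mul hc),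
        key hw.2 hmem.2.1 hmem.2.2 (right_ne_zero_of_mul hc)⟩
    · rw [Finset.mul_sum (a := M ^ p)]
      gcongr with I hI
      rw [hGext j I hI]
      refine le_trans ?_ (mul_le_mul_left (ENNReal.rpow_le_rpow (hMj j) hp0) _)
      -- The cutoff is a multiplier adapted to the cap. Its kernel lives at scale 2^k ≤ r, where W
      -- is slowly varying, so the smooth piece is controlled by the sharp one.
      refine (hW.trSlow (by linarith) hr0).wint_le hCw hr0 (hCm j).le hk0.le hkr (by linarith)
        (continuous_extension A (hgi I hI)).measurable fun x => ?_
      have := hmult j A ((I.1 : ℝ) / 2 ^ k, (I.2 : ℝ) / 2 ^ k) (1 / 2 ^ k) (by positivity)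
        (dsq k I) (measurableSet_dsq k I) Subset.rfl g (hgi I hI) x
      have e : ((1 : ℝ) / 2 ^ k)⁻¹ = 2 ^ k := by simp
      simp only [e] at this
      exact this
  have hsum : ∀ x, extension A unitSquare g x =
      ∑ j, ∑ I ∈ grid k, extension A univ (G j I) x := by
    intro x
    rw [extension_unitSquare_eq_sum A k hg, Finset.sum_comm]
    refine Finset.sum_congr rfl fun I hI => ?_
    rw [Finset.sum_congr rfl fun j _ => by rw [hGext j I hI], ← extension_sum A _ fun j _ => by
      have := hint j I
      rwa [inter_eq_left.2 (dsq_subset_unitSquare hI)] at this]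
    refine congrFun (extension_congr A (measurableSet_dsq k I) fun q _ => ?_) x
    rw [← Finset.mul_sum, hcut, Fintype.sum_prod_type]
    simp only [← Finset.mul_sum, sum_cutoff, mul_one]
  have hWm := hW.measurable
  have hFc : ∀ j, Continuous fun x => ∑ I ∈ grid k, extension A univ (G j I) x := fun j =>
    continuous_finsetSum _ fun I _ => continuous_extension A
      ((integrable_indicator_iff (hmeas I)).2 (hint j I)).integrableOn
  calc wint p W (extension A unitSquare g)
      ≤ ∫⁻ x, ∑ j, 4 ^ p * (‖∑ I ∈ grid k, extension A univ (G j I) x‖ₑ ^ p * W x) := by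
        refine lintegral_mono fun x => ?_
        dsimp only
        rw [hsum x, ← Finset.mul_sum, ← Finset.sum_mul, ← mul_assoc]
        refine mul_le_mul_left ?_ _
        have := enorm_rpow_sum_le Finset.univ
          (fun j : Bool × Bool => ∑ I ∈ grid k, extension A univ (G j I) x) (p := p) (by linarith)
        simpa using this
    _ = ∑ j, 4 ^ p * wint p W (fun x => ∑ I ∈ grid k, extension A univ (G j I) x) := by
        rw [lintegral_finsetSum]
        · refine Finset.sum_congr rfl fun j _ => ?_
          rw [lintegral_const_mul' _ _ (ENNReal.rpow_ne_top_of_nonneg hp0 (by simp)), wint]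
        · exact fun j _ => ((((hFc j).measurable.enorm).pow_const p).mul hWm).const_mul _
    _ ≤ ∑ _j : Bool × Bool, 4 ^ p * (4 ^ p * K * D *
          (M ^ p * ∑ I ∈ grid k, wint p W (extension A (dsq k I) g))) := by
        gcongr with j _
        exact hpiece j
    _ = 4 * (4 ^ p * (4 ^ p * (M ^ p * K))) *
          D * ∑ I ∈ grid k, wint p W (extension A (dsq k I) g) := by
        rw [Finset.sum_const]
        simp only [Finset.card_univ, Fintype.card_prod, Fintype.card_bool, nsmul_eq_mul]
        push_cast
        ring
    _ ≤ _ := by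
        have hself : ∀ {y : ℝ≥0∞}, 1 ≤ y → y ≤ y ^ p := fun {y} hy => by
          conv_lhs => rw [← ENNReal.rpow_one y]
          exact ENNReal.rpow_le_rpow_of_exponent_le hy (by linarith)
        have h4 : (4 : ℝ≥0∞) ≤ 4 ^ p := hself (by norm_num)
        have hK' : K ≤ M ^ p := hMK.trans (hself hM1)
        simp only [ENNReal.mul_rpow_of_nonneg _ _ hp0]
        gcongr

end SurfaceDecoupling
end

/-! ### Parabolic rescaling -/

noncomputable section

namespace SurfaceDecoupling

lemma lintegral_comp_inv_smul {R : ℝ} (hR : 0 < R) {f : ℝ × ℝ → ℝ≥0∞} (hf : Measurable f) :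
    ∫⁻ u : ℝ × ℝ, f (R⁻¹ • u) = ENNReal.ofReal (R ^ 2) * ∫⁻ u, f u := by
  have h1 : Measure.map (fun z : ℝ × ℝ => R⁻¹ • z) volume = ENNReal.ofReal (R ^ 2) • volume := by
    have := Measure.map_addHaar_smul (volume : Measure (ℝ × ℝ)) (r := R⁻¹) (by positivity)
    rw [this]
    congr 2
    rw [Module.finrank_prod, Module.finrank_self, ← inv_pow, inv_inv, abs_of_nonneg (by positivity)]
  rw [← lintegral_map hf (measurable_const_smul R⁻¹), h1, lintegral_smul_measure, smul_eq_mul]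

/-- The action on space of the parabolic rescaling `q ↦ a + K⁻¹ q`. -/
def rescale (A : Coeffs) (a : ℝ × ℝ) (K : ℝ) (x : EuclideanSpace ℝ (Fin 4)) :
    EuclideanSpace ℝ (Fin 4) :=
  pt (K⁻¹ • (hpart x + grad A a (vpart x))) ((K ^ 2)⁻¹ • vpart x)

/-- The inverse of `rescale`. -/
def unscale (A : Coeffs) (a : ℝ × ℝ) (K : ℝ) (y : EuclideanSpace ℝ (Fin 4)) :
    EuclideanSpace ℝ (Fin 4) :=
  pt (K • hpart y - grad A a (K ^ 2 • vpart y)) (K ^ 2 • vpart y)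

lemma unscale_rescale (A : Coeffs) (a : ℝ × ℝ) {K : ℝ} (hK : 0 < K)
    (x : EuclideanSpace ℝ (Fin 4)) : unscale A a K (rescale A a K x) = x := by
  rw [unscale, rescale, hpart_pt, vpart_pt, smul_smul, smul_smul,
    mul_inv_cancel₀ (by positivity), mul_inv_cancel₀ (by positivity), one_smul, one_smul,
    add_sub_cancel_right, pt_parts]

lemma grad_sub_right (A : Coeffs) (a v w : ℝ × ℝ) :
    grad A a (v - w) = grad A a v - grad A a w := by
  ext <;> simp [grad] <;> ring

lemma unscale_sub (A : Coeffs) (a : ℝ × ℝ) (K : ℝ) (x y : EuclideanSpace ℝ (Fin 4)) :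
    unscale A a K (x - y) = unscale A a K x - unscale A a K y := by
  have h1 : hpart (x - y) = hpart x - hpart y := by ext <;> simp [hpart]
  have h2 : vpart (x - y) = vpart x - vpart y := by ext <;> simp [vpart]
  simp only [unscale, h1, h2, smul_sub, grad_sub_right, pt_sub]
  congr 1
  abel

@[fun_prop]
lemma continuous_rescale (A : Coeffs) (a : ℝ × ℝ) (K : ℝ) : Continuous (rescale A a K) := by
  unfold rescale; fun_prop

@[fun_prop]
lemma continuous_unscale (A : Coeffs) (a : ℝ × ℝ) (K : ℝ) : Continuous (unscale A a K) := by
  unfold unscale; fun_prop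

/-- Horizontal scaling by K gives K² and vertical scaling by K² gives K⁴. The shear by the gradient
is a horizontal translation for each v and does not affect the integral. -/
lemma lintegral_rescale (A : Coeffs) (a : ℝ × ℝ) {K : ℝ} (hK : 0 < K)
    {H : EuclideanSpace ℝ (Fin 4) → ℝ≥0∞} (hH : Measurable H) :
    ∫⁻ x, H (rescale A a K x) =
      ENNReal.ofReal (K ^ 2) * ENNReal.ofReal ((K ^ 2) ^ 2) * ∫⁻ x, H x := by
  have hm : ∀ v, Measurable fun u => H (pt u v) := fun v =>
    hH.comp (Continuous.measurable (by fun_prop))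
  have hm' : Measurable fun x => H (rescale A a K x) := hH.comp (continuous_rescale A a K).measurable
  rw [lintegral_pt _ hm', lintegral_pt _ hH]
  have h1 : ∀ v, ∫⁻ u, H (rescale A a K (pt u v)) =
      ENNReal.ofReal (K ^ 2) * ∫⁻ u, H (pt u ((K ^ 2)⁻¹ • v)) := fun v => by
    simp only [rescale, hpart_pt, vpart_pt]
    rw [lintegral_add_right_eq_self (fun u => H (pt (K⁻¹ • u) ((K ^ 2)⁻¹ • v))),
      lintegral_comp_inv_smul hK (hm _)]
  simp only [h1]
  rw [lintegral_const_mul' _ _ ENNReal.ofReal_ne_top, mul_assoc]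
  congr 1
  refine lintegral_comp_inv_smul (by positivity) (f := fun v => ∫⁻ u, H (pt u v)) ?_
  refine Measurable.lintegral_prod_right' (f := fun w : (ℝ × ℝ) × (ℝ × ℝ) => H (pt w.2 w.1)) ?_
  exact hH.comp (Continuous.measurable (by fun_prop))

/-- The cross term of a and q joins the linear coordinates and the quadratic coordinates are
homogeneous of degree two; this is exactly the affine invariance of the surface. -/
lemma inner_rescale (A : Coeffs) (a : ℝ × ℝ) {K : ℝ} (hK : 0 < K) (x : EuclideanSpace ℝ (Fin 4))
    (q : ℝ × ℝ) : inner ℝ x (surface A (a + K⁻¹ • q)) =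
      inner ℝ (rescale A a K x) (surface A q) + inner ℝ x (surface A a) := by
  rw [add_comm a, inner_surface_add]
  congr 1
  obtain ⟨u, v, rfl⟩ : ∃ u v, x = pt u v := ⟨_, _, (pt_parts x).symm⟩
  rw [vpart_pt, inner_tr, rescale, hpart_pt, vpart_pt, inner_pt, inner_pt]
  simp only [quad₁, quad₂, grad, Prod.fst_add, Prod.snd_add, Prod.smul_fst, Prod.smul_snd,
    smul_eq_mul]
  field_simp
  ring

lemma enorm_extension_rescale (A : Coeffs) (a : ℝ × ℝ) {K : ℝ} (hK : 0 < K) {S S' : Set (ℝ × ℝ)}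
    (hS : MeasurableSet S) (hS' : MeasurableSet S') (hSS' : ∀ q, a + K⁻¹ • q ∈ S ↔ q ∈ S')
    (g : ℝ × ℝ → ℂ) (x : EuclideanSpace ℝ (Fin 4)) :
    ‖extension A S g x‖ₑ = ENNReal.ofReal ((K ^ 2)⁻¹) *
      ‖extension A S' (fun q => g (a + K⁻¹ • q)) (rescale A a K x)‖ₑ := by
  have h1 : extension A S g x = ((K ^ 2)⁻¹ : ℝ) • (ee (inner ℝ x (surface A a)) *
      extension A S' (fun q => g (a + K⁻¹ • q)) (rescale A a K x)) := by
    rw [extension_eq, extension_eq, ← integral_indicator hS, ← integral_indicator hS',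
      ← integral_const_mul]
    have h2 := Measure.integral_comp_smul (volume : Measure (ℝ × ℝ))
      (fun q => S.indicator (fun q => g q * ee (inner ℝ x (surface A q))) (a + q)) K⁻¹
    rw [integral_add_left_eq_self (fun q => S.indicator
      (fun q => g q * ee (inner ℝ x (surface A q))) q) a, Module.finrank_prod,
      Module.finrank_self, ← inv_pow, inv_inv, abs_of_nonneg (by positivity)] at h2
    have h3 : ∀ q : ℝ × ℝ, S.indicator (fun q => g q * ee (inner ℝ x (surface A q)))
        (a + K⁻¹ • q) = ee (inner ℝ x (surface A a)) * S'.indicator (fun q => g (a + K⁻¹ • q) *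
          ee (inner ℝ (rescale A a K x) (surface A q))) q := by
      intro q
      by_cases hq : q ∈ S'
      · rw [indicator_of_mem ((hSS' q).2 hq), indicator_of_mem hq, inner_rescale A a hK, ee_add]
        ring
      · rw [indicator_of_notMem (fun h => hq ((hSS' q).1 h)), indicator_of_notMem hq, mul_zero]
    simp only [h3] at h2
    rw [h2, smul_smul]
    have : (K ^ 2)⁻¹ * K ^ (1 + 1) = 1 := by norm_num; field_simp
    rw [this, one_smul]
  rw [h1, enorm_smul, enorm_mul, ← ofReal_norm (ee _), norm_ee, ENNReal.ofReal_one, one_mul,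
    Real.enorm_of_nonneg (by positivity)]

lemma norm_unscale_le {A : Coeffs} {L : ℝ} (hA : ∀ i, |A i| ≤ L) {a : ℝ × ℝ} (h1 : |a.1| ≤ 1)
    (h2 : |a.2| ≤ 1) {K : ℝ} (hK : 1 ≤ K) (z : EuclideanSpace ℝ (Fin 4)) :
    ‖unscale A a K z‖ ≤ (4 + 16 * L) * (K ^ 2 * ‖z‖) := by
  have hz : ∀ i, |z i| ≤ ‖z‖ := abs_apply_le z
  have hz0 := norm_nonneg z
  have hK2 : ∀ i, |K ^ 2 * z i| ≤ K ^ 2 * ‖z‖ := fun i => by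
    rw [abs_mul, abs_of_nonneg (by positivity)]
    exact mul_le_mul_of_nonneg_left (hz i) (by positivity)
  have hK1 : ∀ i, |K * z i| ≤ K ^ 2 * ‖z‖ := fun i => by
    rw [abs_mul, abs_of_nonneg (by positivity)]
    exact mul_le_mul (by nlinarith) (hz i) (abs_nonneg _) (by positivity)
  obtain ⟨h3, h4⟩ := abs_grad_le hA h1 h2 (v := K ^ 2 • vpart z) (hK2 2) (hK2 3)
  refine (norm_pt_le _ _).trans ?_
  have h5 := (abs_sub (K * z 0) (grad A a (K ^ 2 • vpart z)).1).trans (add_le_add (hK1 0) h3)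
  have h6 := (abs_sub (K * z 1) (grad A a (K ^ 2 • vpart z)).2).trans (add_le_add (hK1 1) h4)
  have h7 := hK2 2
  have h8 := hK2 3
  simp only [Prod.fst_sub, Prod.snd_sub, Prod.smul_fst, Prod.smul_snd, smul_eq_mul, hpart, vpart]
    at h5 h6 ⊢
  linarith

lemma lintegral_bw_ne_top (c : EuclideanSpace ℝ (Fin 4)) {N : ℝ} (hN : 1 ≤ N) :
    ∫⁻ x, bw c N x ≠ ⊤ := by
  have h1 : ∫⁻ x : EuclideanSpace ℝ (Fin 4), ENNReal.ofReal ((1 + ‖x‖) ^ (-(100 : ℝ))) < ⊤ :=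
    finite_integral_one_add_norm (by rw [finrank_euclideanSpace_fin]; norm_num)
  have h2 : ∀ x, bw c N x ≤ ENNReal.ofReal (N ^ 100) *
      ENNReal.ofReal ((1 + ‖x - c‖) ^ (-(100 : ℝ))) := fun x => by
    rw [bw, ← ENNReal.ofReal_mul (by positivity), ballWeight, dist_eq_norm]
    refine ENNReal.ofReal_le_ofReal ?_
    rw [Real.rpow_neg (by positivity), ← div_eq_mul_inv, show (100 : ℝ) = (100 : ℕ) by norm_num,
      Real.rpow_natCast, div_le_div_iff₀ (by positivity) (by positivity), one_mul, ← mul_pow]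
    gcongr
    rw [mul_add, mul_one, mul_div_cancel₀ _ (by positivity)]
    linarith
  refine ne_top_of_le_ne_top ?_ (lintegral_mono h2)
  rw [lintegral_const_mul' _ _ ENNReal.ofReal_ne_top, lintegral_sub_right_eq_self
    (fun x : EuclideanSpace ℝ (Fin 4) => ENNReal.ofReal ((1 + ‖x‖) ^ (-(100 : ℝ)))) c]
  exact ENNReal.mul_ne_top ENNReal.ofReal_ne_top h1.ne

/-- The larger of α and β controls γ and supplies the full decay in γ. Of the 100 powers of the
smaller one only four are retained. -/
lemma pow_inv_le_aux {α β γ M : ℝ} (hα : 0 ≤ α) (hβ : 0 ≤ β) (hγ : 0 ≤ γ) (hM : 1 ≤ M)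
    (h : γ ≤ α + M * β) :
    ((1 + α) ^ 100)⁻¹ * ((1 + β) ^ 100)⁻¹ ≤
      (2 * M) ^ 100 * ((1 + γ) ^ 100)⁻¹ * (((1 + α) ^ 4)⁻¹ + ((1 + β) ^ 4)⁻¹) := by
  have key : ∀ {s t : ℝ}, 0 ≤ s → 0 ≤ t → 1 + γ ≤ 2 * M * (1 + s) →
      ((1 + s) ^ 100)⁻¹ * ((1 + t) ^ 100)⁻¹ ≤ (2 * M) ^ 100 * ((1 + γ) ^ 100)⁻¹ * ((1 + t) ^ 4)⁻¹ := by
    intro s t hs ht h1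
    refine mul_le_mul ?_ ?_ (by positivity) (by positivity)
    · rw [← div_eq_mul_inv, inv_eq_one_div, div_le_div_iff₀ (by positivity) (by positivity),
        one_mul, ← mul_pow]
      gcongr
    · gcongr
      · linarith
      · norm_num
  have hX : 0 ≤ (2 * M) ^ 100 * ((1 + γ) ^ 100)⁻¹ := by positivity
  rw [mul_add]
  have ha : 0 ≤ ((1 + α) ^ 4)⁻¹ := by positivity
  have hb : 0 ≤ ((1 + β) ^ 4)⁻¹ := by positivity
  have := mul_nonneg hX ha
  have := mul_nonneg hX hb
  rcases le_total α β with hab | hab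
  · have := key hβ hα (by nlinarith)
    rw [mul_comm] at this
    linarith
  · have := key hα hβ (by nlinarith)
    linarith

/-- The square of a product of two brackets has total degree four, which is why four powers suffice
for an integrable bump. -/
lemma inv_le_bump {r t : ℝ} (hr : 0 < r) {d v : ℝ × ℝ} (h1 : |v.1 - d.1| ≤ r * t)
    (h2 : |v.2 - d.2| ≤ r * t) : ENNReal.ofReal (((1 + t) ^ 4)⁻¹) ≤ bump r d v := by
  refine ENNReal.ofReal_le_ofReal ?_
  have hb := brk_pos (r⁻¹ • (v - d))
  have h0 : brk (r⁻¹ • (v - d)) ≤ (1 + t) * (1 + t) := by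
    simp only [brk, Prod.smul_fst, Prod.smul_snd, smul_eq_mul, abs_mul, abs_inv, abs_of_pos hr,
      Prod.fst_sub, Prod.snd_sub]
    have h3 : r⁻¹ * |v.1 - d.1| ≤ t := by rwa [inv_mul_le_iff₀ hr]
    have h4 : r⁻¹ * |v.2 - d.2| ≤ t := by rwa [inv_mul_le_iff₀ hr]
    have h5 : 0 ≤ r⁻¹ * |v.1 - d.1| := by positivity
    exact mul_le_mul (by linarith) (by linarith) (by positivity) (by linarith)
  rw [show (1 + t) ^ 4 = ((1 + t) * (1 + t)) ^ 2 by ring]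
  gcongr

/-- The inverse rescaling stretches by at most a constant times K², so the weight is slowly varying
at scale N/K². It stretches vertical coordinates by exactly K², so the weight also decays vertically
at that scale. -/
lemma rescaledWeight_unscale {A : Coeffs} {L : ℝ} (hL : 0 < L) (hA : ∀ i, |A i| ≤ L) {a : ℝ × ℝ}
    (h1 : |a.1| ≤ 1) (h2 : |a.2| ≤ 1) {K N : ℝ} (hK : 1 ≤ K) (hN : 1 ≤ N)
    (c₀ : EuclideanSpace ℝ (Fin 4)) :
    RescaledWeight ((2 * (4 + 16 * L)) ^ 100) (N / K ^ 2) fun y => bw c₀ N (unscale A a K y) := by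
  set M := 4 + 16 * L with hM
  have hM1 : 1 ≤ M := by linarith
  have hK0 : 0 < K := by linarith
  have hN0 : 0 < N := by linarith
  have hr : 0 < N / K ^ 2 := by positivity
  have hU : ∀ z, ‖unscale A a K z‖ / N ≤ M * (‖z‖ / (N / K ^ 2)) := fun z => by
    rw [div_div_eq_mul_div, ← mul_div_assoc]
    have := norm_unscale_le hA h1 h2 hK z
    gcongr
    linarith
  have hm : Measurable fun y => bw c₀ N (unscale A a K y) :=
    measurable_bw N measurable_const (continuous_unscale A a K).measurable
  refine ⟨hm, ?_, fun x z => ?_, (K ^ 2)⁻¹ • vpart c₀, fun c x => ?_⟩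
  · have h3 := lintegral_rescale A a hK0 hm
    simp only [unscale_rescale A a hK0] at h3
    intro h4
    rw [h4, ENNReal.mul_top] at h3
    · exact lintegral_bw_ne_top c₀ hN h3
    · exact mul_ne_zero (ENNReal.ofReal_pos.2 (by positivity)).ne'
        (ENNReal.ofReal_pos.2 (by positivity)).ne'
  · have h3 : unscale A a K x - c₀ = (unscale A a K (x + z) - c₀) - unscale A a K z := by
      have := unscale_sub A a K (x + z) z
      rw [add_sub_cancel_right] at this
      rw [this]; abel
    have h4 : ‖unscale A a K x - c₀‖ / N ≤ ‖unscale A a K (x + z) - c₀‖ / N +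
        M * (‖z‖ / (N / K ^ 2)) := by
      refine le_trans ?_ (add_le_add_right (hU z) _)
      rw [← add_div, h3]
      gcongr
      exact norm_sub_le _ _
    simp only [bw]
    rw [← ENNReal.ofReal_mul (by positivity)]
    refine ENNReal.ofReal_le_ofReal ?_
    simp only [ballWeight, dist_eq_norm]
    rw [mul_one_div, div_le_div_iff₀ (by positivity) (by positivity), one_mul, ← mul_pow, ← mul_pow]
    gcongr
    set α := ‖unscale A a K (x + z) - c₀‖ / N
    set β := ‖z‖ / (N / K ^ 2)
    have hα : 0 ≤ α := by positivity
    have hβ : 0 ≤ β := by positivity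
    have : 0 ≤ M * β := by positivity
    have : 0 ≤ M * β * α := by positivity
    nlinarith
  · set α := ‖unscale A a K c - c₀‖ / N with hα
    set β := ‖x - c‖ / (N / K ^ 2) with hβ
    set γ := ‖unscale A a K x - c₀‖ / N with hγ
    have h3 : γ ≤ α + M * β := by
      refine le_trans ?_ (add_le_add_right (hU (x - c)) _)
      rw [hγ, hα, ← add_div, unscale_sub]
      gcongr
      refine (le_of_eq ?_).trans (norm_add_le _ _)
      congr 1; abel
    have h4 := pow_inv_le_aux (by positivity : 0 ≤ α) (by positivity : 0 ≤ β)
      (by positivity : 0 ≤ γ) hM1 h3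
    have hαr : N / K ^ 2 * α = (K ^ 2)⁻¹ * ‖unscale A a K c - c₀‖ := by
      rw [hα]; field_simp
    -- Only the last two coordinates of the stretched displacement are used; the horizontal ones
    -- would live at the larger scale N/K.
    have hb1 : ENNReal.ofReal (((1 + α) ^ 4)⁻¹) ≤
        bump (N / K ^ 2) ((K ^ 2)⁻¹ • vpart c₀) (vpart c) := by
      have e : ∀ i j, (unscale A a K c - c₀) i = K ^ 2 * c i - j →
          |c i - (K ^ 2)⁻¹ * j| ≤ N / K ^ 2 * α := fun i j h => by
        rw [hαr]
        have h5 := abs_apply_le (unscale A a K c - c₀) i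
        rw [h] at h5
        rw [show c i - (K ^ 2)⁻¹ * j = (K ^ 2)⁻¹ * (K ^ 2 * c i - j) by field_simp, abs_mul,
          abs_of_nonneg (by positivity)]
        gcongr
      refine inv_le_bump hr (e 2 (c₀ 2) ?_) (e 3 (c₀ 3) ?_)
      · simp [unscale, pt, vpart]
      · simp [unscale, pt, vpart]
    have hb2 : ENNReal.ofReal (((1 + β) ^ 4)⁻¹) ≤ bump (N / K ^ 2) (vpart x) (vpart c) := by
      have hβr : N / K ^ 2 * β = ‖x - c‖ := by rw [hβ]; field_simp
      refine inv_le_bump hr ?_ ?_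
      · rw [hβr, abs_sub_comm]; exact abs_apply_le (x - c) 2
      · rw [hβr, abs_sub_comm]; exact abs_apply_le (x - c) 3
    refine le_trans ?_ (mul_le_mul_right (add_le_add hb1 hb2) _)
    simp only [bw]
    rw [← ENNReal.ofReal_add (by positivity) (by positivity),
      ← ENNReal.ofReal_mul (ballWeight_nonneg hN0.le _), ← ENNReal.ofReal_mul (by positivity),
      ← ENNReal.ofReal_mul (mul_nonneg (by positivity) (ballWeight_nonneg hN0.le _))]
    refine ENNReal.ofReal_le_ofReal ?_
    simp only [ballWeight, dist_eq_norm, one_div]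
    exact h4

/-- Parabolic rescaling: decoupling on balls of radius `N / 4 ^ m` decouples a cap of side
`2 ^ (-m)` on balls of radius `N`. -/
theorem exists_rescaled_decoupling {L : ℝ} (hL : 0 < L) :
    ∃ C : ℝ≥0∞, C ≠ ⊤ ∧ 1 ≤ C ∧ ∀ (A : Coeffs), (∀ i, |A i| ≤ L) →
    ∀ (m k : ℕ) (N p : ℝ) (D : ℝ≥0∞), 1 ≤ N → 2 ^ k ≤ N / 4 ^ m → 2 ≤ p →
    BallDecoupling A k (N / 4 ^ m) p D →
    ∀ J ∈ grid m, ∀ g : ℝ × ℝ → ℂ, IntegrableOn g (dsq m J) → ∀ c,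
    wint p (bw c N) (extension A (dsq m J) g) ≤
      C ^ p * D * ∑ I ∈ grid k, wint p (bw c N) (extension A (dsq (m + k) (sub k J I)) g) := by
  have hM1 : (1 : ℝ) ≤ (2 * (4 + 16 * L)) ^ 100 := one_le_pow₀ (by linarith)
  obtain ⟨C, hC, hC1, hmain⟩ := exists_localized_decoupling hL hM1
  refine ⟨C, hC, hC1, fun A hA m k N p D hN hk hp hD J hJ g hg c => ?_⟩
  have hp0 : 0 ≤ p := by linarith
  set K : ℝ := 2 ^ m with hK
  have hK1 : 1 ≤ K := one_le_pow₀ (by norm_num)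
  have hK0 : 0 < K := by linarith
  have h4 : (4 : ℝ) ^ m = K ^ 2 := by rw [hK, ← pow_mul, mul_comm, pow_mul]; norm_num
  rw [h4] at hk hD
  set a : ℝ × ℝ := ((J.1 : ℝ) / K, (J.2 : ℝ) / K) with ha
  rw [mem_grid] at hJ
  have ha' : ∀ n : ℕ, n < 2 ^ m → |(n : ℝ) / K| ≤ 1 := fun n hn => by
    rw [abs_of_nonneg (by positivity), div_le_one hK0, hK]
    exact_mod_cast hn.le
  have hW := rescaledWeight_unscale hL hA (a := a) (ha' _ hJ.1) (ha' _ hJ.2) hK1 hN c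
  set g' : ℝ × ℝ → ℂ := fun q => g (a + K⁻¹ • q) with hg'
  have hmem : ∀ I q, a + K⁻¹ • q ∈ dsq (m + k) (sub k J I) ↔ q ∈ dsq k I := by
    intro I q
    rw [mem_dsq, mem_dsq]
    have e : ∀ (j i : ℕ) (t : ℝ), (2 : ℝ) ^ (m + k) * ((j : ℝ) / K + K⁻¹ * t) =
        j * 2 ^ k + 2 ^ k * t := fun j i t => by
      rw [pow_add, ← hK]; field_simp
    simp only [ha, Prod.fst_add, Prod.snd_add, Prod.smul_fst, Prod.smul_snd, smul_eq_mul, sub]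
    rw [e J.1 I.1, e J.2 I.2]
    push_cast
    constructor <;> rintro ⟨⟨h1, h2⟩, h3, h4⟩ <;> exact ⟨⟨by linarith, by linarith⟩, by linarith,
      by linarith⟩
  have hmem0 : ∀ q, a + K⁻¹ • q ∈ dsq m J ↔ q ∈ unitSquare := by
    intro q
    rw [mem_dsq, unitSquare_eq_dsq, mem_dsq]
    have e : ∀ (j : ℕ) (t : ℝ), (2 : ℝ) ^ m * ((j : ℝ) / K + K⁻¹ * t) = j + t := fun j t => by
      rw [← hK]; field_simp
    simp only [ha, Prod.fst_add, Prod.snd_add, Prod.smul_fst, Prod.smul_snd, smul_eq_mul]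
    rw [e, e]
    simp only [pow_zero, one_mul, Nat.cast_zero, zero_add]
    constructor <;> rintro ⟨⟨h1, h2⟩, h3, h4⟩ <;> exact ⟨⟨by linarith, by linarith⟩, by linarith,
      by linarith⟩
  have hg'i : IntegrableOn g' unitSquare := by
    rw [← integrable_indicator_iff measurableSet_unitSquare]
    have h1 : Integrable ((dsq m J).indicator g) :=
      (integrable_indicator_iff (measurableSet_dsq m J)).2 hg
    have h2 := (h1.comp_add_left a).comp_smul (R := K⁻¹) (by positivity)
    refine h2.congr (ae_of_all _ fun q => ?_)
    by_cases hq : q ∈ unitSquare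
    · simp only [indicator_of_mem hq, indicator_of_mem ((hmem0 q).2 hq), hg']
    · simp only [indicator_of_notMem hq, indicator_of_notMem fun h => hq ((hmem0 q).1 h)]
  -- The frequency and space Jacobians are the same for the large cap and for its subcaps, so they
  -- cancel between the two sides.
  obtain ⟨κ, hκ⟩ : ∃ κ, κ = ENNReal.ofReal ((K ^ 2)⁻¹) ^ p *
    (ENNReal.ofReal (K ^ 2) * ENNReal.ofReal ((K ^ 2) ^ 2)) := ⟨_, rfl⟩
  have key : ∀ {S S' : Set (ℝ × ℝ)}, MeasurableSet S → MeasurableSet S' →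
      (∀ q, a + K⁻¹ • q ∈ S ↔ q ∈ S') → IntegrableOn g' S' →
      wint p (bw c N) (extension A S g) =
        κ * wint p (fun y => bw c N (unscale A a K y)) (extension A S' g') := by
    intro S S' hS hS' hSS' hi
    rw [hκ, mul_assoc, wint, wint, ← lintegral_rescale A a hK0, ← lintegral_const_mul']
    · refine lintegral_congr fun x => ?_
      rw [enorm_extension_rescale A a hK0 hS hS' hSS', ENNReal.mul_rpow_of_nonneg _ _ hp0,
        unscale_rescale A a hK0, mul_assoc]
    · exact ENNReal.rpow_ne_top_of_nonneg hp0 ENNReal.ofReal_ne_top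
    · exact ((continuous_extension A hi).measurable.enorm.pow_const p).mul hW.measurable
  rw [key (measurableSet_dsq m J) measurableSet_unitSquare hmem0 hg'i, Finset.sum_congr rfl
    fun I hI => key (measurableSet_dsq _ _) (measurableSet_dsq k I) (hmem I)
      (hg'i.mono_set (dsq_subset_unitSquare hI)), ← Finset.mul_sum, mul_left_comm]
  exact mul_le_mul_right (hmain A hA k (N / K ^ 2) p D hk hp hD _ hW g' hg'i) _

end SurfaceDecoupling
end

/-! ### Non-transverse families lie in strips -/

noncomputable section

namespace SurfaceDecoupling

/-- The quadratic form that measures transversality. -/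
def transForm (A : Coeffs) (d : ℝ × ℝ) : ℝ :=
  minor₁ A * d.1 ^ 2 + minor₂ A * (d.1 * d.2) + minor₃ A * d.2 ^ 2

/-- The linear functional with coefficients `l`. -/
def lin (l d : ℝ × ℝ) : ℝ := l.1 * d.1 + l.2 * d.2

lemma lin_sub (l d d' : ℝ × ℝ) : lin l (d - d') = lin l d - lin l d' := by
  simp only [lin, Prod.fst_sub, Prod.snd_sub]; ring

lemma abs_lin_le {l d : ℝ × ℝ} {C s : ℝ} (h1 : |l.1| ≤ C) (h2 : |l.2| ≤ C) (h3 : |d.1| ≤ s)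
    (h4 : |d.2| ≤ s) : |lin l d| ≤ 2 * C * s := by
  have hC : 0 ≤ C := (abs_nonneg _).trans h1
  calc _ ≤ |l.1| * |d.1| + |l.2| * |d.2| := by rw [← abs_mul, ← abs_mul]; exact abs_add_le _ _
    _ ≤ C * s + C * s := by gcongr
    _ = _ := by ring

lemma abs_minor_le {A : Coeffs} {L : ℝ} (hA : ∀ i, |A i| ≤ L) :
    |minor₁ A| ≤ 2 * L ^ 2 ∧ |minor₂ A| ≤ 2 * L ^ 2 ∧ |minor₃ A| ≤ 2 * L ^ 2 := by
  have hL : 0 ≤ L := (abs_nonneg _).trans (hA 0)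
  have key : ∀ i j k l, |A i * A j - A k * A l| ≤ 2 * L ^ 2 := fun i j k l => by
    calc _ ≤ |A i| * |A j| + |A k| * |A l| := by rw [← abs_mul, ← abs_mul]; exact abs_sub _ _
      _ ≤ L * L + L * L := by gcongr <;> exact hA _
      _ = _ := by ring
  simp only [minor₁, minor₂, minor₃, Matrix.det_fin_two_of]
  exact ⟨key _ _ _ _, key _ _ _ _, key _ _ _ _⟩

/-- A binary quadratic form dominates a product of two nondegenerate linear functionals. -/
lemma exists_factorization {c₁ c₂ c₃ a e₁ e₂ L : ℝ} (hL : 0 < L) (h1 : |c₁| ≤ 2 * L ^ 2)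
    (h2 : |c₂| ≤ 2 * L ^ 2) (h3 : |c₃| ≤ 2 * L ^ 2)
    (ha : a = c₁ * e₁ ^ 2 + c₂ * (e₁ * e₂) + c₃ * e₂ ^ 2) (haL : L⁻¹ ≤ |a|)
    (he₁ : |e₁| ≤ 1) (he₂ : |e₂| ≤ 1) :
    ∃ l : Fin 2 → ℝ × ℝ, (∀ i, |(l i).1| ≤ 6 * L ^ 3 ∧ |(l i).2| ≤ 6 * L ^ 3 ∧
      lin (l i) (e₁, e₂) = 1) ∧
      ∀ t s : ℝ, |lin (l 0) (t, s)| * |lin (l 1) (t, s)| ≤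
        L * |c₁ * t ^ 2 + c₂ * (t * s) + c₃ * s ^ 2| := by
  have ha0 : 0 < |a| := lt_of_lt_of_le (by positivity) haL
  have ha0' : a ≠ 0 := abs_pos.1 ha0
  have hainv : |a|⁻¹ ≤ L := by
    rw [inv_le_comm₀ ha0 hL]; exact haL
  set Δ : ℝ := c₂ ^ 2 / 4 - c₁ * c₃ with hΔ
  -- A negative Δ is replaced by 0: for a definite form both functionals become the polar form with
  -- the chosen vector, whose square the form already dominates.
  set δ : ℝ := Real.sqrt (max Δ 0) with hδ
  have hδ0 : 0 ≤ δ := Real.sqrt_nonneg _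
  have hδ2 : δ ^ 2 = max Δ 0 := Real.sq_sqrt (le_max_right _ _)
  have hX : ∀ {x y : ℝ}, |x| ≤ 2 * L ^ 2 → |y| ≤ 1 → |x * y| ≤ 2 * L ^ 2 := fun {x y} hx hy => by
    rw [abs_mul]
    calc |x| * |y| ≤ 2 * L ^ 2 * 1 := by gcongr
      _ = _ := mul_one _
  have hδL : δ ≤ 3 * L ^ 2 := by
    refine Real.sqrt_le_iff.2 ⟨by positivity, max_le ?_ (by positivity)⟩
    have h4 : c₂ ^ 2 ≤ (2 * L ^ 2) ^ 2 := sq_le_sq' (by linarith [abs_le.1 h2]) (abs_le.1 h2).2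
    have h5 : |c₁ * c₃| ≤ 2 * L ^ 2 * (2 * L ^ 2) := by
      rw [abs_mul]; gcongr
    have h6 := (abs_le.1 h5).1
    nlinarith
  set y₁ : ℝ := c₁ * e₁ + c₂ / 2 * e₂ with hy₁
  set y₂ : ℝ := c₂ / 2 * e₁ + c₃ * e₂ with hy₂
  have hy₁b : |y₁| ≤ 3 * L ^ 2 := by
    have h4 := hX h1 he₁
    have h5 := hX h2 he₂
    rw [abs_le] at h4 h5 ⊢
    constructor <;> rw [hy₁] <;> linarith
  have hy₂b : |y₂| ≤ 3 * L ^ 2 := by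
    have h4 := hX h3 he₂
    have h5 := hX h2 he₁
    rw [abs_le] at h4 h5 ⊢
    constructor <;> rw [hy₂] <;> linarith
  have hbound : ∀ {y z : ℝ}, |y| ≤ 3 * L ^ 2 → |z| ≤ 1 → |(y + δ * z) / a| ≤ 6 * L ^ 3 ∧
      |(y - δ * z) / a| ≤ 6 * L ^ 3 := by
    intro y z hy hz
    have h4 : |δ * z| ≤ 3 * L ^ 2 := by
      rw [abs_mul, abs_of_nonneg hδ0]
      calc δ * |z| ≤ 3 * L ^ 2 * 1 := by gcongr
        _ = _ := mul_one _
    have key : ∀ w : ℝ, |w| ≤ 6 * L ^ 2 → |w / a| ≤ 6 * L ^ 3 := fun w hw => by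
      rw [abs_div, div_eq_mul_inv]
      calc |w| * |a|⁻¹ ≤ 6 * L ^ 2 * L := by gcongr
        _ = _ := by ring
    exact ⟨key _ ((abs_add_le _ _).trans (by linarith)), key _ ((abs_sub _ _).trans (by linarith))⟩
  have hye : y₁ * e₁ + y₂ * e₂ = a := by rw [ha, hy₁, hy₂]; ring
  have hneg : |-e₁| ≤ 1 := by rwa [abs_neg]
  -- The functionals are (y ± δ z)/a, where y is the polar form with e and z is the determinant
  -- against e. As z vanishes at e and y equals a there, both take the value 1 at e.
  refine ⟨![((y₁ + δ * e₂) / a, (y₂ + δ * -e₁) / a), ((y₁ - δ * e₂) / a, (y₂ - δ * -e₁) / a)],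
    fun i => ?_, fun t s => ?_⟩
  · fin_cases i
    · refine ⟨(hbound hy₁b he₂).1, (hbound hy₂b hneg).1, ?_⟩
      simp only [lin, Fin.zero_eta, Matrix.cons_val_zero]
      rw [div_mul_eq_mul_div, div_mul_eq_mul_div, ← add_div, div_eq_one_iff_eq ha0', ← hye]
      ring
    · refine ⟨(hbound hy₁b he₂).2, (hbound hy₂b hneg).2, ?_⟩
      simp only [lin, Fin.mk_one, Matrix.cons_val_one, Matrix.cons_val_fin_one]
      rw [div_mul_eq_mul_div, div_mul_eq_mul_div, ← add_div, div_eq_one_iff_eq ha0', ← hye]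
      ring
  · set q := c₁ * t ^ 2 + c₂ * (t * s) + c₃ * s ^ 2 with hq
    set y := y₁ * t + y₂ * s with hy
    set z := e₂ * t - e₁ * s with hz
    -- Lagrange's identity, which completes the square along e.
    have hlag : a * q = y ^ 2 - Δ * z ^ 2 := by
      rw [ha, hq, hy, hz, hΔ, hy₁, hy₂]; ring
    have e0 : lin ((y₁ + δ * e₂) / a, (y₂ + δ * -e₁) / a) (t, s) = (y + δ * z) / a := by
      simp only [lin]; rw [hy, hz]; field_simp; ring
    have e1 : lin ((y₁ - δ * e₂) / a, (y₂ - δ * -e₁) / a) (t, s) = (y - δ * z) / a := by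
      simp only [lin]; rw [hy, hz]; field_simp; ring
    simp only [Matrix.cons_val_zero, Matrix.cons_val_one, Matrix.cons_val_fin_one]
    rw [e0, e1, ← abs_mul]
    have e2 : (y + δ * z) / a * ((y - δ * z) / a) = (y ^ 2 - max Δ 0 * z ^ 2) / a ^ 2 := by
      rw [← hδ2]; field_simp; ring
    rw [e2, abs_div, abs_of_nonneg (sq_nonneg a), div_le_iff₀ (by positivity)]
    have h5 : |y ^ 2 - max Δ 0 * z ^ 2| ≤ |a * q| := by
      rw [hlag]
      rcases le_total Δ 0 with h | h
      · rw [max_eq_right h, zero_mul, sub_zero, abs_of_nonneg (sq_nonneg y)]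
        refine le_trans ?_ (le_abs_self _)
        nlinarith [sq_nonneg z]
      · rw [max_eq_left h]
    refine h5.trans ?_
    rw [abs_mul, ← sq_abs a]
    have h6 : 1 ≤ L * |a| := by
      have := mul_le_mul_of_nonneg_left haL hL.le
      rwa [mul_inv_cancel₀ hL.ne'] at this
    have h7 : 0 ≤ |a| * |q| := by positivity
    calc |a| * |q| = 1 * (|a| * |q|) := (one_mul _).symm
      _ ≤ (L * |a|) * (|a| * |q|) := by gcongr
      _ = _ := by ring

/-- The form is at least L⁻¹ in absolute value at one of (1,0), (0,1), (1,±1). When the middle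
coefficient is the large one, the sign is chosen so that it does not cancel the sum of the other
two. A functional equal to 1 at such a point cannot have both coefficients below 1/2. -/
lemma exists_linear_factors {A : Coeffs} {L : ℝ} (hL : 0 < L) (hA : A ∈ admissible L) :
    ∃ l : Fin 2 → ℝ × ℝ, (∀ i, |(l i).1| ≤ 6 * L ^ 3 ∧ |(l i).2| ≤ 6 * L ^ 3 ∧
      (1 / 2 ≤ |(l i).1| ∨ 1 / 2 ≤ |(l i).2|)) ∧
      ∀ d, |lin (l 0) d| * |lin (l 1) d| ≤ L * |transForm A d| := by
  obtain ⟨hA1, hA2⟩ := hA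
  obtain ⟨h1, h2, h3⟩ := abs_minor_le hA1
  obtain ⟨e₁, e₂, he₁, he₂, ha⟩ : ∃ e₁ e₂ : ℝ, |e₁| ≤ 1 ∧ |e₂| ≤ 1 ∧
      L⁻¹ ≤ |minor₁ A * e₁ ^ 2 + minor₂ A * (e₁ * e₂) + minor₃ A * e₂ ^ 2| := by
    rcases le_max_iff.1 hA2 with h | h
    · exact ⟨1, 0, by simp, by simp, by simpa using h⟩
    rcases le_max_iff.1 h with h | h
    · rcases le_total 0 ((minor₁ A + minor₃ A) * minor₂ A) with h4 | h4
      · refine ⟨1, 1, by simp, by simp, h.trans ?_⟩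
        refine sq_le_sq.1 ?_
        nlinarith [sq_nonneg (minor₁ A + minor₃ A)]
      · refine ⟨1, -1, by simp, by simp, h.trans ?_⟩
        refine sq_le_sq.1 ?_
        nlinarith [sq_nonneg (minor₁ A + minor₃ A)]
    · exact ⟨0, 1, by simp, by simp, by simpa using h⟩
  obtain ⟨l, hl, hq⟩ := exists_factorization hL h1 h2 h3 rfl ha he₁ he₂
  refine ⟨l, fun i => ⟨(hl i).1, (hl i).2.1, ?_⟩, fun d => hq d.1 d.2⟩
  by_contra! hlt
  have h4 := (hl i).2.2
  simp only [lin] at h4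
  have h5 : |(l i).1 * e₁ + (l i).2 * e₂| < 1 := by
    calc _ ≤ |(l i).1| * |e₁| + |(l i).2| * |e₂| := by
          rw [← abs_mul, ← abs_mul]; exact abs_add_le _ _
      _ ≤ |(l i).1| * 1 + |(l i).2| * 1 := by gcongr
      _ < 1 := by linarith
  rw [h4, abs_one] at h5
  exact lt_irrefl _ h5

/-- An index of a dyadic square as a point of the plane. -/
def toPlane (I : ℕ × ℕ) : ℝ × ℝ := ((I.1 : ℝ), (I.2 : ℝ))

/-- Squares that are not transverse are close in the direction of one of the two factors. -/
lemma close_of_not_transverse {A : Coeffs} {L : ℝ} (hL : 0 < L) {l : Fin 2 → ℝ × ℝ} {C : ℝ}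
    (hl : ∀ i, |(l i).1| ≤ C ∧ |(l i).2| ≤ C)
    (hq : ∀ d, |lin (l 0) d| * |lin (l 1) d| ≤ L * |transForm A d|) {m : ℕ} {ν : ℝ}
    (hν : ν ≤ 1 / 4 ^ m) {I J : ℕ × ℕ} (h : ¬ Transverse A ν (dsq m I) (dsq m J)) :
    ∃ i, |lin (l i) (toPlane I) - lin (l i) (toPlane J)| ≤ L + 1 + 2 * C := by
  simp only [Transverse, not_forall, not_le] at h
  obtain ⟨q₁, h1, q₂, h2, h3⟩ := h
  change |transForm A (q₁ - q₂)| < ν at h3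
  rw [mem_dsq] at h1 h2
  set K : ℝ := 2 ^ m with hK
  have hK0 : 0 < K := by positivity
  have h4 : (4 : ℝ) ^ m = K ^ 2 := by rw [hK, ← pow_mul, mul_comm, pow_mul]; norm_num
  rw [h4] at hν
  -- Dilating by 2^m compares points with indices of squares, and the condition on ν makes the
  -- dilated form at most 1.
  have hQ : |transForm A (K • (q₁ - q₂))| ≤ 1 := by
    have : transForm A (K • (q₁ - q₂)) = K ^ 2 * transForm A (q₁ - q₂) := by
      simp only [transForm, Prod.smul_fst, Prod.smul_snd, smul_eq_mul]; ring
    rw [this, abs_mul, abs_of_nonneg (by positivity)]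
    calc K ^ 2 * |transForm A (q₁ - q₂)| ≤ K ^ 2 * (1 / K ^ 2) := by gcongr; linarith
      _ = 1 := by field_simp
  have hprod := (hq (K • (q₁ - q₂))).trans (mul_le_of_le_one_right hL.le hQ)
  -- Two factors both above L + 1 would have a product above L.
  have hone : ∃ i, |lin (l i) (K • (q₁ - q₂))| ≤ L + 1 := by
    by_contra! hc
    have h5 := hc 0
    have h6 := hc 1
    nlinarith
  obtain ⟨i, hi⟩ := hone
  refine ⟨i, ?_⟩
  -- Passing from dilated points to indices changes each coordinate of the difference by at most 1.
  have h5 : |lin (l i) (toPlane I - toPlane J - K • (q₁ - q₂))| ≤ 2 * C * 1 := by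
    refine abs_lin_le (hl i).1 (hl i).2 ?_ ?_
    · simp only [toPlane, Prod.fst_sub, Prod.smul_fst, smul_eq_mul]
      rw [abs_le]; constructor <;> linarith [h1.1.1, h1.1.2, h2.1.1, h2.1.2]
    · simp only [toPlane, Prod.snd_sub, Prod.smul_snd, smul_eq_mul]
      rw [abs_le]; constructor <;> linarith [h1.2.1, h1.2.2, h2.2.1, h2.2.2]
  rw [lin_sub, lin_sub] at h5
  rw [abs_le] at h5 hi ⊢
  constructor <;> linarith [h5.1, h5.2, hi.1, hi.2]

/-- If any two points are close for one of two functions, then all points are close to a fixed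
one for the same function. -/
lemma exists_uniformly_close {ι : Type*} {S : Set ι} (hS : S.Nonempty) (f : Fin 2 → ι → ℝ) {H : ℝ}
    (hH : 0 ≤ H) (h : ∀ a ∈ S, ∀ b ∈ S, ∃ i, |f i a - f i b| ≤ H) :
    ∃ i, ∃ a ∈ S, ∀ b ∈ S, |f i b - f i a| ≤ 2 * H := by
  by_cases h0 : ∀ a ∈ S, ∀ b ∈ S, |f 0 b - f 0 a| ≤ 2 * H
  · obtain ⟨a, ha⟩ := hS
    exact ⟨0, a, ha, h0 a ha⟩
  · push Not at h0
    obtain ⟨a, ha, b, hb, hab⟩ := h0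
    -- Points further apart than H for the first function must be close for the second. If a and b
    -- differ by more than 2H for the first, every c is far from at least one of them.
    have key : ∀ x ∈ S, ∀ y ∈ S, H < |f 0 x - f 0 y| → |f 1 x - f 1 y| ≤ H := by
      intro x hx y hy hxy
      obtain ⟨i, hi⟩ := h x hx y hy
      fin_cases i
      · exact absurd hi (not_le.2 hxy)
      · exact hi
    refine ⟨1, a, ha, fun c hc => ?_⟩
    by_cases hca : |f 0 c - f 0 a| ≤ H
    · have h1 : H < |f 0 c - f 0 b| := by
        by_contra! h2
        have h3 : f 0 b - f 0 a = (f 0 c - f 0 a) - (f 0 c - f 0 b) := by ring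
        rw [h3] at hab
        have := abs_sub (f 0 c - f 0 a) (f 0 c - f 0 b)
        linarith
      have h2 := key c hc b hb h1
      have h3 := key b hb a ha (by linarith)
      have h4 : f 1 c - f 1 a = (f 1 c - f 1 b) + (f 1 b - f 1 a) := by ring
      rw [h4]
      exact (abs_add_le _ _).trans (by linarith)
    · exact (key c hc a ha (not_le.1 hca)).trans (by linarith)

/-- The strip number of a dyadic square with respect to a linear functional. -/
def strip (H : ℝ) (l : ℝ × ℝ) (I : ℕ × ℕ) : ℤ := ⌊lin l (toPlane I) / H⌋

/-- The dyadic squares whose strip number is within one of `τ`. -/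
def stripFinset (m : ℕ) (H : ℝ) (l : ℝ × ℝ) (τ : ℤ) : Finset (ℕ × ℕ) :=
  (grid m).filter fun I => |strip H l I - τ| ≤ 1

lemma abs_strip_sub_le {H : ℝ} (hH : 0 < H) {l : ℝ × ℝ} {I J : ℕ × ℕ}
    (h : |lin l (toPlane I) - lin l (toPlane J)| ≤ H) : |strip H l I - strip H l J| ≤ 1 := by
  unfold strip
  have h1 : |lin l (toPlane I) / H - lin l (toPlane J) / H| ≤ 1 := by
    rw [← sub_div, abs_div, abs_of_pos hH, div_le_one hH]; exact h
  rw [abs_le] at h1 ⊢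
  constructor
  · have : ⌊lin l (toPlane J) / H⌋ ≤ ⌊lin l (toPlane I) / H + 1⌋ := Int.floor_le_floor (by linarith)
    rw [Int.floor_add_one] at this
    linarith
  · have : ⌊lin l (toPlane I) / H⌋ ≤ ⌊lin l (toPlane J) / H + 1⌋ := Int.floor_le_floor (by linarith)
    rw [Int.floor_add_one] at this
    linarith

lemma lin_bounds_of_mem_stripFinset {m : ℕ} {H : ℝ} (hH : 0 < H) {l : ℝ × ℝ} {τ : ℤ} {I J : ℕ × ℕ}
    (hI : I ∈ stripFinset m H l τ) (hJ : J ∈ stripFinset m H l τ) :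
    lin l (toPlane I) - lin l (toPlane J) ≤ 3 * H := by
  simp only [stripFinset, Finset.mem_filter, strip, abs_le] at hI hJ
  have h1 := Int.lt_floor_add_one (lin l (toPlane I) / H)
  have h2 := Int.floor_le (lin l (toPlane J) / H)
  have h3 : ((⌊lin l (toPlane I) / H⌋ : ℤ) : ℝ) ≤ τ + 1 := by exact_mod_cast (by linarith [hI.2.2])
  have h4 : (τ : ℝ) - 1 ≤ ((⌊lin l (toPlane J) / H⌋ : ℤ) : ℝ) := by
    have : τ - 1 ≤ ⌊lin l (toPlane J) / H⌋ := by linarith [hJ.2.1]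
    exact_mod_cast this
  have h5 : (lin l (toPlane I) - lin l (toPlane J)) / H ≤ 3 := by
    rw [sub_div]; linarith
  rwa [div_le_iff₀ hH] at h5

lemma card_le_of_diam {s : Finset ℕ} {n : ℕ} (h : ∀ a ∈ s, ∀ b ∈ s, a ≤ b + n) :
    s.card ≤ n + 1 := by
  rcases s.eq_empty_or_nonempty with rfl | hs
  · simp
  have : s ⊆ Finset.Icc (s.min' hs) (s.min' hs + n) := fun a ha =>
    Finset.mem_Icc.2 ⟨Finset.min'_le _ _ ha, h a ha _ (Finset.min'_mem s hs)⟩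
  refine (Finset.card_le_card this).trans ?_
  rw [Nat.card_Icc]
  omega

/-- A strip contains few dyadic squares. -/
lemma card_stripFinset_le {m : ℕ} {H : ℝ} (hH : 0 < H) {l : ℝ × ℝ} (τ : ℤ)
    (hl : 1 / 2 ≤ |l.1| ∨ 1 / 2 ≤ |l.2|) :
    (stripFinset m H l τ).card ≤ (⌊6 * H⌋₊ + 1) * 2 ^ m := by
  -- Within a row or column only the variable with coefficient at least 1/2 moves, so a range 3H of
  -- the functional confines it to length 6H.
  have key : ∀ {u x y : ℝ}, 1 / 2 ≤ |u| → u * x - u * y ≤ 3 * H → u * y - u * x ≤ 3 * H →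
      x ≤ y + 6 * H := by
    intro u x y hu h1 h2
    by_contra! h3
    have h4 : |u| * (x - y) ≤ 3 * H := by
      rw [← abs_of_pos (by linarith : 0 < x - y), ← abs_mul, abs_le]
      constructor <;> nlinarith
    nlinarith
  have hfl : ∀ {a b : ℕ}, (a : ℝ) ≤ b + 6 * H → a ≤ b + ⌊6 * H⌋₊ := by
    intro a b hab
    have h1 : a = b + (a - b) ∨ a ≤ b := by omega
    rcases h1 with h1 | h1
    · have h2 : ((a - b : ℕ) : ℝ) ≤ 6 * H := by
        have : (a : ℝ) = b + (a - b : ℕ) := by exact_mod_cast h1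
        linarith
      have := Nat.le_floor h2
      omega
    · omega
  have hcard : (Finset.range (2 ^ m)).card = 2 ^ m := Finset.card_range _
  rcases hl with hl | hl
  · rw [← hcard]
    refine Finset.card_le_mul_card_image_of_maps_to (f := Prod.snd) (fun I hI => ?_) _ fun b _ => ?_
    · rw [Finset.mem_range]
      exact (mem_grid.1 (Finset.mem_filter.1 hI).1).2
    · rw [← Finset.card_image_of_injOn (f := Prod.fst) fun I hI J hJ hIJ => Prod.ext hIJ
        ((Finset.mem_filter.1 hI).2.trans (Finset.mem_filter.1 hJ).2.symm)]
      refine card_le_of_diam fun x hx y hy => ?_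
      obtain ⟨I, hI, rfl⟩ := Finset.mem_image.1 hx
      obtain ⟨J, hJ, rfl⟩ := Finset.mem_image.1 hy
      rw [Finset.mem_filter] at hI hJ
      have h1 := lin_bounds_of_mem_stripFinset hH hI.1 hJ.1
      have h2 := lin_bounds_of_mem_stripFinset hH hJ.1 hI.1
      simp only [lin, toPlane, hI.2, hJ.2] at h1 h2
      exact hfl (key hl (by linarith) (by linarith))
  · rw [← hcard]
    refine Finset.card_le_mul_card_image_of_maps_to (f := Prod.fst) (fun I hI => ?_) _ fun b _ => ?_
    · rw [Finset.mem_range]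
      exact (mem_grid.1 (Finset.mem_filter.1 hI).1).1
    · rw [← Finset.card_image_of_injOn (f := Prod.snd) fun I hI J hJ hIJ => Prod.ext
        ((Finset.mem_filter.1 hI).2.trans (Finset.mem_filter.1 hJ).2.symm) hIJ]
      refine card_le_of_diam fun x hx y hy => ?_
      obtain ⟨I, hI, rfl⟩ := Finset.mem_image.1 hx
      obtain ⟨J, hJ, rfl⟩ := Finset.mem_image.1 hy
      rw [Finset.mem_filter] at hI hJ
      have h1 := lin_bounds_of_mem_stripFinset hH hI.1 hJ.1
      have h2 := lin_bounds_of_mem_stripFinset hH hJ.1 hI.1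
      simp only [lin, toPlane, hI.2, hJ.2] at h1 h2
      exact hfl (key hl (by linarith) (by linarith))

/-- A family of dyadic squares contains a transverse pair or lies in a strip. -/
lemma exists_transverse_or_strip {L : ℝ} (hL : 0 < L) : ∃ H : ℝ, 0 < H ∧ ∀ A ∈ admissible L,
    ∃ l : Fin 2 → ℝ × ℝ, (∀ i, 1 / 2 ≤ |(l i).1| ∨ 1 / 2 ≤ |(l i).2|) ∧
    ∀ (m : ℕ) (ν : ℝ), ν ≤ 1 / 4 ^ m → ∀ S ⊆ grid m, S.Nonempty →
      (∃ I ∈ S, ∃ J ∈ S, Transverse A ν (dsq m I) (dsq m J)) ∨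
      ∃ i, ∃ I ∈ grid m, S ⊆ stripFinset m H (l i) (strip H (l i) I) := by
  -- The closeness of pairs is doubled when all members are compared with one fixed member.
  set H : ℝ := 2 * (L + 1 + 2 * (6 * L ^ 3)) with hH
  have hH0 : 0 < H := by positivity
  refine ⟨H, hH0, fun A hA => ?_⟩
  obtain ⟨l, hl, hq⟩ := exists_linear_factors hL hA
  refine ⟨l, fun i => (hl i).2.2, fun m ν hν S hS hne => ?_⟩
  by_cases htr : ∃ I ∈ S, ∃ J ∈ S, Transverse A ν (dsq m I) (dsq m J)
  · exact Or.inl htr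
  · push Not at htr
    refine Or.inr ?_
    obtain ⟨i, I, hI, hclose⟩ := exists_uniformly_close (S := (S : Set (ℕ × ℕ))) hne
      (fun i I => lin (l i) (toPlane I)) (H := L + 1 + 2 * (6 * L ^ 3)) (by positivity)
      fun I hI J hJ => close_of_not_transverse hL (fun i => ⟨(hl i).1, (hl i).2.1⟩) hq hν
        (htr I hI J hJ)
    refine ⟨i, I, hS hI, fun J hJ => ?_⟩
    exact Finset.mem_filter.2 ⟨hS hJ, abs_strip_sub_le hH0 (hclose J hJ)⟩

end SurfaceDecoupling
end

/-! ### The broad–narrow dichotomy -/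

noncomputable section

namespace SurfaceDecoupling

lemma rpow_add_le_two_rpow (a b : ℝ≥0∞) {p : ℝ} (hp : 1 ≤ p) :
    (a + b) ^ p ≤ 2 ^ p * (a ^ p + b ^ p) := by
  refine (ENNReal.rpow_add_le_mul_rpow_add_rpow a b hp).trans (mul_le_mul_left ?_ _)
  exact ENNReal.rpow_le_rpow_of_exponent_le (by norm_num) (by linarith)

/-- The broad-narrow dichotomy: either two significant terms form a good pair, or all significant
terms lie in one of the given families. -/
lemma broad_narrow {ι κ : Type*} [DecidableEq ι] (s : Finset ι) (e : ι → ℂ) (R : Finset (ι × ι))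
    (𝒯 : Finset κ) (T : κ → Finset ι) (hT : ∀ t ∈ 𝒯, T t ⊆ s)
    (h : ∀ S ⊆ s, S.Nonempty → (∃ a ∈ S, ∃ b ∈ S, (a, b) ∈ R) ∨ ∃ t ∈ 𝒯, S ⊆ T t)
    {p : ℝ} (hp : 1 ≤ p) :
    ‖∑ a ∈ s, e a‖ₑ ^ p ≤ 2 ^ p * (∑ a ∈ s, ‖e a‖ₑ ^ p) +
      2 ^ p * (∑ t ∈ 𝒯, ‖∑ a ∈ T t, e a‖ₑ ^ p) +
      ((s.card : ℝ≥0∞) ^ 2) ^ p * ∑ r ∈ R, (‖e r.1‖ₑ * ‖e r.2‖ₑ) ^ (p / 2) := by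
  have hp0 : 0 ≤ p := by linarith
  rcases s.eq_empty_or_nonempty with rfl | hs
  · simp [show 0 < p by linarith]
  obtain ⟨a₀, ha₀, hmax⟩ := s.exists_max_image (fun a => ‖e a‖ₑ) hs
  set M := ‖e a₀‖ₑ with hM
  set n : ℝ≥0∞ := ((s.card : ℕ) : ℝ≥0∞) with hn
  have hn1 : 1 ≤ n := by rw [hn]; exact_mod_cast hs.card_pos
  have hn0 : n ≠ 0 := (one_pos.trans_le hn1).ne'
  have hnt : n ≠ ⊤ := by simp [hn]
  -- A term is significant when it is at least the fraction 1/n of the largest one.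
  set S := s.filter fun a => M ≤ n * ‖e a‖ₑ with hS
  have hSs : S ⊆ s := Finset.filter_subset _ _
  have hSne : S.Nonempty := ⟨a₀, Finset.mem_filter.2 ⟨ha₀, le_mul_of_one_le_left' hn1⟩⟩
  rcases h S hSs hSne with ⟨a, ha, b, hb, hab⟩ | ⟨t, ht, hSt⟩
  · refine le_trans ?_ le_add_self
    have h1 : ‖∑ a ∈ s, e a‖ₑ ≤ n * M := by
      refine (enorm_sum_le _ _).trans ((Finset.sum_le_sum hmax).trans (le_of_eq ?_))
      rw [Finset.sum_const, nsmul_eq_mul]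
    have h2 : M ^ p ≤ n ^ p * (‖e a‖ₑ * ‖e b‖ₑ) ^ (p / 2) := by
      have h3 : M ^ 2 ≤ n ^ 2 * (‖e a‖ₑ * ‖e b‖ₑ) := by
        rw [sq, sq, mul_mul_mul_comm]
        exact mul_le_mul' (Finset.mem_filter.1 ha).2 (Finset.mem_filter.1 hb).2
      have h4 := ENNReal.rpow_le_rpow h3 (by linarith : 0 ≤ p / 2)
      rw [ENNReal.mul_rpow_of_nonneg _ _ (by linarith), ← ENNReal.rpow_natCast,
        ← ENNReal.rpow_natCast, ← ENNReal.rpow_mul, ← ENNReal.rpow_mul] at h4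
      simpa only [Nat.cast_ofNat, mul_div_cancel₀ p (two_ne_zero' ℝ)] using h4
    calc ‖∑ a ∈ s, e a‖ₑ ^ p ≤ (n * M) ^ p := ENNReal.rpow_le_rpow h1 hp0
      _ = n ^ p * M ^ p := ENNReal.mul_rpow_of_nonneg _ _ hp0
      _ ≤ n ^ p * (n ^ p * (‖e a‖ₑ * ‖e b‖ₑ) ^ (p / 2)) := by gcongr
      _ = (n ^ 2) ^ p * (‖e a‖ₑ * ‖e b‖ₑ) ^ (p / 2) := by
          rw [sq, ENNReal.mul_rpow_of_nonneg _ _ hp0, mul_assoc]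
      _ ≤ _ := by
          gcongr
          exact Finset.single_le_sum (f := fun r : ι × ι => (‖e r.1‖ₑ * ‖e r.2‖ₑ) ^ (p / 2))
            (fun _ _ => zero_le) hab
  · refine le_trans ?_ le_self_add
    -- The terms outside the family are insignificant, so all of them together weigh no more than
    -- the largest term.
    have h1 : ∑ a ∈ s \ T t, ‖e a‖ₑ ≤ M := by
      have h2 : ∀ a ∈ s \ T t, ‖e a‖ₑ ≤ M / n := fun a ha => by
        rw [Finset.mem_sdiff] at ha
        have h3 : ¬ M ≤ n * ‖e a‖ₑ := fun h3 => ha.2 (hSt (Finset.mem_filter.2 ⟨ha.1, h3⟩))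
        rw [ENNReal.le_div_iff_mul_le (Or.inl hn0) (Or.inl hnt), mul_comm]
        exact (not_le.1 h3).le
      calc _ ≤ ∑ _a ∈ s \ T t, M / n := Finset.sum_le_sum h2
        _ = (s \ T t).card * (M / n) := by rw [Finset.sum_const, nsmul_eq_mul]
        _ ≤ n * (M / n) := by
            gcongr
            rw [hn]
            exact_mod_cast Finset.card_le_card Finset.sdiff_subset
        _ = M := ENNReal.mul_div_cancel hn0 hnt
    have h4 : ‖∑ a ∈ s, e a‖ₑ ≤ ‖∑ a ∈ T t, e a‖ₑ + M := by
      rw [← Finset.sum_sdiff (hT t ht), add_comm]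
      refine (enorm_add_le _ _).trans ?_
      gcongr
      exact (enorm_sum_le _ _).trans h1
    calc ‖∑ a ∈ s, e a‖ₑ ^ p ≤ (‖∑ a ∈ T t, e a‖ₑ + M) ^ p := ENNReal.rpow_le_rpow h4 hp0
      _ ≤ 2 ^ p * (‖∑ a ∈ T t, e a‖ₑ ^ p + M ^ p) := rpow_add_le_two_rpow _ _ hp
      _ ≤ 2 ^ p * ((∑ t ∈ 𝒯, ‖∑ a ∈ T t, e a‖ₑ ^ p) + ∑ a ∈ s, ‖e a‖ₑ ^ p) := by
          gcongr
          · exact Finset.single_le_sum (f := fun t => ‖∑ a ∈ T t, e a‖ₑ ^ p)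
              (fun _ _ => zero_le) ht
          · exact Finset.single_le_sum (f := fun a => ‖e a‖ₑ ^ p) (fun _ _ => zero_le) ha₀
      _ = _ := by rw [mul_add, add_comm]

end SurfaceDecoupling
end

/-! ### Decoupling constants as attained infima -/

noncomputable section

namespace SurfaceDecoupling

lemma weightedNorm_rpow {F : Type*} [NormedAddCommGroup F] {p : ℝ} (hp : 0 < p)
    (c : EuclideanSpace ℝ (Fin 4)) (N : ℝ) (f : EuclideanSpace ℝ (Fin 4) → F) :
    weightedNorm p c N f ^ p = wint p (bw c N) f := by
  rw [weightedNorm, ← ENNReal.rpow_mul, one_div, inv_mul_cancel₀ hp.ne', ENNReal.rpow_one]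
  rfl

lemma sum_capIndex (N : ℝ) (f : ℕ × ℕ → ℝ≥0∞) :
    ∑ i : CapIndex N, f ((i.1 : ℕ), (i.2 : ℕ)) = ∑ I ∈ grid (level N), f I := by
  rw [Fintype.sum_prod_type, grid, Finset.sum_product,
    ← Fin.sum_univ_eq_sum_range (fun x => ∑ y ∈ Finset.range (2 ^ level N), f (x, y))]
  refine Finset.sum_congr rfl fun i _ => ?_
  rw [← Fin.sum_univ_eq_sum_range (fun y => f ((i : ℕ), y))]

lemma sum_cap (A : Coeffs) (N : ℝ) {p : ℝ} (hp : 0 < p) (c : EuclideanSpace ℝ (Fin 4))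
    (g : ℝ × ℝ → ℂ) (R : Set (ℝ × ℝ)) :
    ∑ i : CapIndex N, weightedNorm p c N (extension A (cap N i ∩ R) g) ^ p =
      ∑ I ∈ grid (level N), wint p (bw c N) (extension A (dsq (level N) I ∩ R) g) := by
  rw [← sum_capIndex N fun I => wint p (bw c N) (extension A (dsq (level N) I ∩ R) g)]
  exact Finset.sum_congr rfl fun i _ => weightedNorm_rpow hp _ _ _

lemma rpow_one_div_le_iff {p : ℝ} (hp : 0 < p) {x D S : ℝ≥0∞} :
    x ^ (1 / p) ≤ D * S ^ (1 / p) ↔ x ≤ D ^ p * S := by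
  rw [one_div, ENNReal.rpow_inv_le_iff hp, ENNReal.mul_rpow_of_nonneg _ _ hp.le,
    ENNReal.rpow_inv_rpow hp.ne']

/-- For positive b one divides, which needs b finite. For b = 0 the infimum carries no information
and an actual member of S is needed. -/
lemma le_sInf_mul {S : Set ℝ≥0∞} (hS : S.Nonempty) {a b : ℝ≥0∞} (hb : b ≠ ⊤)
    (h : ∀ D ∈ S, a ≤ D * b) : a ≤ sInf S * b := by
  by_cases hb0 : b = 0
  · obtain ⟨D, hD⟩ := hS
    have := h D hD
    rw [hb0, mul_zero] at this ⊢
    exact this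
  · rw [← ENNReal.div_le_iff_le_mul (Or.inl hb0) (Or.inl hb)]
    refine le_sInf fun D hD => ?_
    rw [ENNReal.div_le_iff_le_mul (Or.inl hb0) (Or.inl hb)]
    exact h D hD

lemma linearConst_set_iff (A : Coeffs) (N : ℝ) {p : ℝ} (hp : 0 < p) (D : ℝ≥0∞) :
    (∀ (g : ℝ × ℝ → ℂ), IntegrableOn g unitSquare → ∀ c : EuclideanSpace ℝ (Fin 4),
      weightedNorm p c N (extension A unitSquare g) ≤
        D * (∑ i : CapIndex N, weightedNorm p c N (extension A (cap N i) g) ^ p) ^ (1 / p)) ↔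
    BallDecoupling A (level N) N p (D ^ p) := by
  refine forall_congr' fun g => forall_congr' fun _ => forall_congr' fun c => ?_
  have h := sum_cap A N hp c g univ
  simp only [inter_univ] at h
  rw [h]
  exact rpow_one_div_le_iff hp

lemma wint_bw_extension_ne_top (A : Coeffs) {N : ℝ} (hN : 1 ≤ N) {p : ℝ} (hp : 0 ≤ p)
    (c : EuclideanSpace ℝ (Fin 4)) (S : Set (ℝ × ℝ)) (g : ℝ × ℝ → ℂ) :
    wint p (bw c N) (extension A S g) ≠ ⊤ :=
  wint_ne_top (lintegral_bw_ne_top c hN) (norm_extension_le A S g) hp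

lemma linearConst_le {A : Coeffs} {N p : ℝ} (hp : 0 < p) {D : ℝ≥0∞}
    (h : BallDecoupling A (level N) N p (D ^ p)) : linearConst A N p ≤ D :=
  sInf_le ((linearConst_set_iff A N hp D).2 h)

lemma measurable_bw_self (c : EuclideanSpace ℝ (Fin 4)) (N : ℝ) : Measurable (bw c N) :=
  measurable_bw N measurable_const measurable_id

/-- The trivial decoupling inequality. -/
lemma ballDecoupling_trivial (A : Coeffs) (k : ℕ) (N : ℝ) {p : ℝ} (hp : 1 ≤ p) :
    BallDecoupling A k N p ((4 ^ k : ℝ≥0∞) ^ p) := by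
  intro g hg c
  have hgi : ∀ I ∈ grid k, IntegrableOn g (dsq k I) := fun I hI =>
    hg.mono_set (dsq_subset_unitSquare hI)
  calc wint p (bw c N) (extension A unitSquare g)
      ≤ ∫⁻ x, (4 ^ k : ℝ≥0∞) ^ p * ∑ I ∈ grid k, ‖extension A (dsq k I) g x‖ₑ ^ p * bw c N x := by
        refine lintegral_mono fun x => ?_
        dsimp only
        rw [extension_unitSquare_eq_sum A k hg, ← Finset.sum_mul, ← mul_assoc]
        refine mul_le_mul_left ?_ _
        have := enorm_rpow_sum_le (grid k) (fun I => extension A (dsq k I) g x) hp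
        rw [card_grid] at this
        simpa using this
    _ = _ := by
        rw [lintegral_const_mul' _ _ (ENNReal.rpow_ne_top_of_nonneg (by linarith)
          (ENNReal.pow_ne_top (by simp))), lintegral_finsetSum']
        · rfl
        · exact fun I hI => (((continuous_extension A (hgi I hI)).measurable.enorm.pow_const p).mul
            (measurable_bw_self c N)).aemeasurable

lemma pow_level_le {N : ℝ} (hN : 1 ≤ N) : (4 : ℝ) ^ level N ≤ N := by
  have h1 : ⌊N⌋₊ ≠ 0 := (Nat.floor_pos.2 hN).ne'
  have h2 : 4 ^ level N ≤ ⌊N⌋₊ := Nat.pow_log_le_self 4 h1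
  calc (4 : ℝ) ^ level N = ((4 ^ level N : ℕ) : ℝ) := by push_cast; rfl
    _ ≤ (⌊N⌋₊ : ℝ) := by exact_mod_cast h2
    _ ≤ N := Nat.floor_le (by linarith)

lemma lt_pow_level_succ (N : ℝ) : N < (4 : ℝ) ^ (level N + 1) := by
  have h2 : ⌊N⌋₊ < 4 ^ (level N + 1) := Nat.lt_pow_succ_log_self (by norm_num) _
  calc N < ⌊N⌋₊ + 1 := Nat.lt_floor_add_one N
    _ ≤ ((4 ^ (level N + 1) : ℕ) : ℝ) := by exact_mod_cast h2
    _ = _ := by push_cast; rfl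

/-- Division by 4^m shifts the base-4 logarithm by exactly m, so the caps at scale N are exactly the
subdivided caps of level m even when N is not a power of 4. -/
lemma level_eq_add {N : ℝ} {m : ℕ} (hN : 4 ^ m ≤ N) : level N = m + level (N / 4 ^ m) := by
  have h1 : (1 : ℝ) ≤ N / 4 ^ m := by rwa [one_le_div (by positivity)]
  have hN0 : 1 ≤ N := le_trans (one_le_pow₀ (by norm_num)) hN
  have h2 := pow_level_le h1
  have h3 := lt_pow_level_succ (N / 4 ^ m)
  rw [le_div_iff₀ (by positivity), ← pow_add] at h2
  rw [div_lt_iff₀ (by positivity), ← pow_add] at h3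
  have h4 := pow_level_le hN0
  have h5 := lt_pow_level_succ N
  have h6 : level (N / 4 ^ m) + m < level N + 1 :=
    (pow_lt_pow_iff_right₀ (by norm_num : (1 : ℝ) < 4)).1 (h2.trans_lt h5)
  have h7 : level N < level (N / 4 ^ m) + 1 + m :=
    (pow_lt_pow_iff_right₀ (by norm_num : (1 : ℝ) < 4)).1 (h4.trans_lt h3)
  omega

lemma linearConst_le_card (A : Coeffs) (N : ℝ) {p : ℝ} (hp : 1 ≤ p) :
    linearConst A N p ≤ 4 ^ level N :=
  linearConst_le (by linarith) (ballDecoupling_trivial A (level N) N hp)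

/-- The infimum that defines the linear decoupling constant is attained. -/
lemma ballDecoupling_linearConst (A : Coeffs) {N p : ℝ} (hN : 1 ≤ N) (hp : 1 ≤ p) :
    BallDecoupling A (level N) N p (linearConst A N p ^ p) := by
  have hp0 : 0 < p := by linarith
  rw [← linearConst_set_iff A N hp0]
  intro g hg c
  have hne : {D : ℝ≥0∞ | ∀ (g : ℝ × ℝ → ℂ), IntegrableOn g unitSquare →
    ∀ c : EuclideanSpace ℝ (Fin 4),
      weightedNorm p c N (extension A unitSquare g) ≤
        D * (∑ i : CapIndex N, weightedNorm p c N (extension A (cap N i) g) ^ p) ^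
          (1 / p)}.Nonempty :=
    ⟨4 ^ level N, (linearConst_set_iff A N hp0 _).2 (ballDecoupling_trivial A (level N) N hp)⟩
  refine le_sInf_mul hne ?_ fun D hD => hD g hg c
  refine ENNReal.rpow_ne_top_of_nonneg (by positivity) (ENNReal.sum_ne_top.2 fun i _ => ?_)
  rw [weightedNorm_rpow hp0]
  exact wint_bw_extension_ne_top A hN hp0.le c _ g

lemma enorm_rpow_half_rpow (z : ℂ) (p : ℝ) :
    ‖‖z‖ ^ (1 / 2 : ℝ)‖ₑ ^ p = ‖z‖ₑ ^ (p / 2) := by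
  rw [Real.enorm_of_nonneg (by positivity), ← ENNReal.ofReal_rpow_of_nonneg (norm_nonneg z)
    (by norm_num), ofReal_norm, ← ENNReal.rpow_mul]
  congr 1; ring

/-- The infimum that defines the bilinear decoupling constant is attained. -/
lemma wint_le_bilinearConst {A : Coeffs} {N p ν : ℝ} (hN : 1 ≤ N) (hp : 1 ≤ p)
    (hD : bilinearConst A N p ν ≠ ⊤) {R : Fin 2 → Set (ℝ × ℝ)} (hR : ∀ j, IsSubsquare (R j))
    (hT : Transverse A ν (R 0) (R 1)) {g : Fin 2 → ℝ × ℝ → ℂ} (hg : ∀ j, IntegrableOn (g j) (R j))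
    (c : EuclideanSpace ℝ (Fin 4)) :
    ∫⁻ x, (‖extension A (R 0) (g 0) x‖ₑ * ‖extension A (R 1) (g 1) x‖ₑ) ^ (p / 2) * bw c N x ≤
      bilinearConst A N p ν ^ p * (∏ j : Fin 2, ∑ I ∈ grid (level N),
        wint p (bw c N) (extension A (dsq (level N) I ∩ R j) (g j))) ^ (1 / 2 : ℝ) := by
  have hp0 : 0 < p := by linarith
  have hne : {D : ℝ≥0∞ | ∀ R : Fin 2 → Set (ℝ × ℝ), (∀ j, IsSubsquare (R j)) →
    Transverse A ν (R 0) (R 1) →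
    ∀ g : Fin 2 → ℝ × ℝ → ℂ, (∀ j, IntegrableOn (g j) (R j)) →
    ∀ c : EuclideanSpace ℝ (Fin 4),
      weightedNorm p c N
          (fun x => ‖extension A (R 0) (g 0) x * extension A (R 1) (g 1) x‖ ^ (1 / 2 : ℝ)) ≤
        D * (∏ j : Fin 2, ∑ i : CapIndex N,
          weightedNorm p c N (extension A (cap N i ∩ R j) (g j)) ^ p) ^ (1 / (2 * p))}.Nonempty := by
    by_contra h
    rw [not_nonempty_iff_eq_empty] at h
    rw [bilinearConst, h, sInf_empty] at hD
    exact hD rfl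
  have hfin : (∏ j : Fin 2, ∑ i : CapIndex N,
      weightedNorm p c N (extension A (cap N i ∩ R j) (g j)) ^ p) ^ (1 / (2 * p)) ≠ ⊤ := by
    refine ENNReal.rpow_ne_top_of_nonneg (by positivity) (ENNReal.prod_ne_top fun j _ =>
      ENNReal.sum_ne_top.2 fun i _ => ?_)
    rw [weightedNorm_rpow hp0]
    exact wint_bw_extension_ne_top A hN hp0.le c _ _
  have h1 := le_sInf_mul hne hfin fun D hD => hD R hR hT g hg c
  have h2 := ENNReal.rpow_le_rpow h1 hp0.le
  rw [weightedNorm_rpow hp0, ENNReal.mul_rpow_of_nonneg _ _ hp0.le, ← ENNReal.rpow_mul,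
    show 1 / (2 * p) * p = 1 / 2 by field_simp] at h2
  simp only [sum_cap A N hp0 c] at h2
  refine le_trans (le_of_eq ?_) h2
  refine lintegral_congr fun x => ?_
  rw [enorm_rpow_half_rpow, enorm_mul]

end SurfaceDecoupling
end

/-! ### One step of the recursion -/

noncomputable section

namespace SurfaceDecoupling

/-- For each of the two functionals a square has only three strip numbers within one of its own, so
it is counted at most six times. -/
lemma sum_stripFinset_le (m : ℕ) (H : ℝ) (l : Fin 2 → ℝ × ℝ) (𝒯 : Finset (Fin 2 × ℤ))
    (f : ℕ × ℕ → ℝ≥0∞) :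
    ∑ t ∈ 𝒯, ∑ I ∈ stripFinset m H (l t.1) t.2, f I ≤ 6 * ∑ I ∈ grid m, f I := by
  classical
  simp only [stripFinset, Finset.sum_filter]
  rw [Finset.sum_comm, Finset.mul_sum]
  refine Finset.sum_le_sum fun I _ => ?_
  rw [← Finset.sum_filter, Finset.sum_const, nsmul_eq_mul]
  refine mul_le_mul_left ?_ _
  have h1 : (𝒯.filter fun t => |strip H (l t.1) I - t.2| ≤ 1) ⊆
      ((Finset.univ : Finset (Fin 2)) ×ˢ ({-1, 0, 1} : Finset ℤ)).image
        fun r => (r.1, strip H (l r.1) I + r.2) := by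
    intro t ht
    rw [Finset.mem_filter, abs_le] at ht
    refine Finset.mem_image.2 ⟨(t.1, t.2 - strip H (l t.1) I), ?_, by simp⟩
    simp only [Finset.mem_product, Finset.mem_univ, Finset.mem_insert, Finset.mem_singleton,
      true_and]
    omega
  have h2 := (Finset.card_le_card h1).trans Finset.card_image_le
  have h3 : ((Finset.univ : Finset (Fin 2)) ×ˢ ({-1, 0, 1} : Finset ℤ)).card = 6 := by decide
  rw [h3] at h2
  exact_mod_cast h2

lemma sub_mem_grid {m k : ℕ} {J I : ℕ × ℕ} (hJ : J ∈ grid m) (hI : I ∈ grid k) :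
    sub k J I ∈ grid (m + k) := by
  rw [mem_grid] at *
  have key : ∀ {i j : ℕ}, j < 2 ^ m → i < 2 ^ k → j * 2 ^ k + i < 2 ^ (m + k) := by
    intro i j hj hi
    calc j * 2 ^ k + i < (j + 1) * 2 ^ k := by rw [add_mul]; omega
      _ ≤ 2 ^ m * 2 ^ k := by gcongr; omega
      _ = _ := (pow_add _ _ _).symm
  exact ⟨key hJ.1 hI.1, key hJ.2 hI.2⟩

lemma sum_sub_le (m k : ℕ) (f : ℕ × ℕ → ℝ≥0∞) :
    ∑ J ∈ grid m, ∑ I ∈ grid k, f (sub k J I) ≤ ∑ I ∈ grid (m + k), f I := by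
  classical
  rw [← Finset.sum_product' (f := fun J I => f (sub k J I)),
    ← Finset.sum_image (f := f) (g := fun r : (ℕ × ℕ) × (ℕ × ℕ) => sub k r.1 r.2)]
  · refine Finset.sum_le_sum_of_subset fun I hI => ?_
    obtain ⟨r, hr, rfl⟩ := Finset.mem_image.1 hI
    rw [Finset.mem_product] at hr
    exact sub_mem_grid hr.1 hr.2
  · have key : ∀ {a b i j : ℕ}, i < 2 ^ k → j < 2 ^ k → a * 2 ^ k + i = b * 2 ^ k + j → a = b := by
      intro a b i j hi hj h
      have h1 := congrArg (· / 2 ^ k) h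
      simpa [Nat.mul_add_div, mul_comm _ (2 ^ k), Nat.div_eq_of_lt hi, Nat.div_eq_of_lt hj]
        using h1
    rintro ⟨J, I⟩ hr ⟨J', I'⟩ hr' h
    simp only [Finset.coe_product, mem_prod, Finset.mem_coe, mem_grid] at hr hr'
    have hJ : J = J' := Prod.ext (key hr.2.1 hr'.2.1 (congrArg Prod.fst h))
      (key hr.2.2 hr'.2.2 (congrArg Prod.snd h))
    subst hJ
    exact congrArg (Prod.mk J) (sub_injective k J h)

lemma sub_div_mod (k : ℕ) (I : ℕ × ℕ) :
    sub k (I.1 / 2 ^ k, I.2 / 2 ^ k) (I.1 % 2 ^ k, I.2 % 2 ^ k) = I := by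
  simp [sub, Nat.div_add_mod']

/-- A fine dyadic square lies in the coarse one or meets it in a null set, so the intersection
changes the extension only by possibly deleting it. -/
lemma wint_inter_dsq_le (A : Coeffs) (p : ℝ) (hp : 0 < p) (W : EuclideanSpace ℝ (Fin 4) → ℝ≥0∞)
    (m k : ℕ) (g : ℝ × ℝ → ℂ) (J I : ℕ × ℕ) :
    wint p W (extension A (dsq (m + k) I ∩ dsq m J) g) ≤
      wint p W (extension A (dsq (m + k) I) g) := by
  have h1 : dsq (m + k) I ⊆ dsq m (I.1 / 2 ^ k, I.2 / 2 ^ k) := by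
    have h2 := dsq_sub_subset (m := m) (J := (I.1 / 2 ^ k, I.2 / 2 ^ k))
      (I := (I.1 % 2 ^ k, I.2 % 2 ^ k)) (mem_grid.2 ⟨Nat.mod_lt I.1 (by positivity : 0 < 2 ^ k),
        Nat.mod_lt I.2 (by positivity : 0 < 2 ^ k)⟩)
    rwa [sub_div_mod] at h2
  by_cases h : (I.1 / 2 ^ k, I.2 / 2 ^ k) = J
  · rw [h] at h1
    rw [inter_eq_left.2 h1]
  · have h2 : volume (dsq (m + k) I ∩ dsq m J) = 0 :=
      measure_mono_null (inter_subset_inter_left _ h1) (aedisjoint_dsq m h)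
    have h3 : extension A (dsq (m + k) I ∩ dsq m J) g = 0 := by
      funext x
      rw [extension_eq, Measure.restrict_eq_zero.2 h2, integral_zero_measure, Pi.zero_apply]
    rw [h3]
    simp [wint, ENNReal.zero_rpow_of_pos hp]

lemma isSubsquare_dsq {k : ℕ} {I : ℕ × ℕ} (hI : I ∈ grid k) : IsSubsquare (dsq k I) :=
  ⟨dsq_subset_unitSquare hI, _, _, by positivity, rfl⟩

/-- The weight of a ball of radius `N ≥ 1` varies slowly at scale `N`. -/
lemma exists_trSlow_bw : ∃ C : ℝ, 1 ≤ C ∧ ∀ (c : EuclideanSpace ℝ (Fin 4)) (N : ℝ), 1 ≤ N →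
    TrSlow C N 100 (bw c N) := by
  refine ⟨(2 * (4 + 16 * 1)) ^ 100, one_le_pow₀ (by norm_num), fun c N hN => ?_⟩
  -- The trivial rescaling, with zero coefficients, zero corner and K = 1, recovers the weight of
  -- the ball itself.
  have h := rescaledWeight_unscale (A := 0) (L := 1) one_pos (by simp) (a := 0) (by simp)
    (by simp) le_rfl hN c
  have e : ∀ y, unscale 0 0 1 y = y := fun y => by
    simp only [unscale, grad, Prod.fst_zero, Prod.snd_zero, mul_zero, add_zero, one_pow, one_smul]
    exact (congrArg (pt · _) (sub_zero _)).trans (pt_parts y)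
  simp only [e, one_pow, div_one] at h
  exact h.trSlow (pow_nonneg (by norm_num) _) (by linarith)

/-- One step of the broad-narrow recursion. -/
theorem exists_linearConst_le_add {L : ℝ} (hL : 0 < L) : ∃ C : ℝ≥0∞, C ≠ ⊤ ∧ 1 ≤ C ∧
    ∀ A ∈ admissible L, ∀ (m : ℕ) (ν N p : ℝ), ν ≤ 1 / 4 ^ m → 4 ^ m ≤ N → 2 ≤ p →
    linearConst A N p ≤ C * ((2 : ℝ≥0∞) ^ m) ^ (1 - 2 / p) * linearConst A (N / 4 ^ m) p +
      4 ^ (4 * m) * bilinearConst A N p ν := by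
  classical
  obtain ⟨Cw, hCw, hW⟩ := exists_trSlow_bw
  obtain ⟨C₁, hC₁, hC₁1, hres⟩ := exists_rescaled_decoupling hL
  obtain ⟨H, hH, hstrip⟩ := exists_transverse_or_strip hL
  obtain ⟨C₃, hC₃, hC₃1, hflat⟩ := exists_flat_decoupling Cw hCw
  obtain ⟨n₀, hn₀⟩ : ∃ n₀ : ℕ, n₀ = ⌊6 * H⌋₊ + 1 := ⟨_, rfl⟩
  have hn₀1 : (1 : ℝ≥0∞) ≤ n₀ := by rw [hn₀]; simp
  refine ⟨14 * C₁ * C₃ * n₀, by finiteness, ?_, ?_⟩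
  · refine one_le_mul (one_le_mul (one_le_mul (by norm_num) hC₁1) hC₃1) hn₀1
  intro A hA m ν N p hν hN hp
  by_cases hbt : bilinearConst A N p ν = ⊤
  · rw [hbt, ENNReal.mul_top (by positivity)]
    simp
  have hp0 : 0 < p := by linarith
  have hp1 : 1 ≤ p := by linarith
  obtain ⟨l, hl, hdich⟩ := hstrip A hA
  have hN1 : 1 ≤ N := le_trans (one_le_pow₀ (by norm_num)) hN
  have hN'1 : (1 : ℝ) ≤ N / 4 ^ m := by rwa [one_le_div (by positivity)]
  obtain ⟨k, hk⟩ : ∃ k, k = level (N / 4 ^ m) := ⟨_, rfl⟩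
  have hlev : level N = m + k := by rw [hk]; exact level_eq_add hN
  have h2k : (2 : ℝ) ^ k ≤ N / 4 ^ m := by
    rw [hk]
    exact (pow_le_pow_left₀ (by norm_num) (by norm_num) _).trans (pow_level_le hN'1)
  have h2m : (2 : ℝ) ^ m ≤ N := (pow_le_pow_left₀ (by norm_num) (by norm_num) _).trans hN
  have hBD : BallDecoupling A k (N / 4 ^ m) p (linearConst A (N / 4 ^ m) p ^ p) := by
    rw [hk]; exact ballDecoupling_linearConst A hN'1 hp1
  refine linearConst_le hp0 fun g hg c => ?_
  have hgi : ∀ n, ∀ I ∈ grid n, IntegrableOn g (dsq n I) := fun n I hI =>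
    hg.mono_set (dsq_subset_unitSquare hI)
  rw [hlev]
  obtain ⟨S, hS⟩ : ∃ S, S = ∑ I ∈ grid (m + k), wint p (bw c N) (extension A (dsq (m + k) I) g) :=
    ⟨_, rfl⟩
  obtain ⟨D, hD⟩ : ∃ D, D = linearConst A (N / 4 ^ m) p := ⟨_, rfl⟩
  obtain ⟨b, hb⟩ : ∃ b, b = bilinearConst A N p ν := ⟨_, rfl⟩
  rw [← hS, ← hD, ← hb]
  rw [← hD] at hBD
  rw [← hb] at hbt
  obtain ⟨K, hK⟩ : ∃ K : ℝ≥0∞, K = 2 ^ m := ⟨_, rfl⟩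
  have hK1 : 1 ≤ K := by rw [hK]; exact one_le_pow₀ (by norm_num)
  have hcoarse : ∑ J ∈ grid m, wint p (bw c N) (extension A (dsq m J) g) ≤ C₁ ^ p * D ^ p * S := by
    calc _ ≤ ∑ J ∈ grid m, C₁ ^ p * D ^ p *
          ∑ I ∈ grid k, wint p (bw c N) (extension A (dsq (m + k) (sub k J I)) g) :=
          Finset.sum_le_sum fun J hJ =>
            hres A hA.1 m k N p _ hN1 h2k hp hBD J hJ g (hgi m J hJ) c
      _ ≤ _ := by
          rw [← Finset.mul_sum, hS]
          exact mul_le_mul_right (sum_sub_le m k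
            fun I => wint p (bw c N) (extension A (dsq (m + k) I) g)) _
  obtain ⟨R, hR⟩ : ∃ R : Finset ((ℕ × ℕ) × (ℕ × ℕ)), R = (grid m ×ˢ grid m).filter
    fun r => Transverse A ν (dsq m r.1) (dsq m r.2) := ⟨_, rfl⟩
  -- Strips are indexed by the image, so each occurs once; the overlap bound needs this.
  obtain ⟨𝒯, h𝒯⟩ : ∃ 𝒯 : Finset (Fin 2 × ℤ), 𝒯 = ((Finset.univ : Finset (Fin 2)) ×ˢ grid m).image
    fun r => (r.1, strip H (l r.1) r.2) := ⟨_, rfl⟩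
  have hpt : ∀ x, ‖extension A unitSquare g x‖ₑ ^ p * bw c N x ≤
      2 ^ p * (∑ J ∈ grid m, ‖extension A (dsq m J) g x‖ₑ ^ p * bw c N x) +
      2 ^ p * (∑ t ∈ 𝒯, ‖∑ J ∈ stripFinset m H (l t.1) t.2, extension A (dsq m J) g x‖ₑ ^ p *
        bw c N x) +
      ((4 ^ m) ^ 2) ^ p * ∑ r ∈ R, (‖extension A (dsq m r.1) g x‖ₑ *
        ‖extension A (dsq m r.2) g x‖ₑ) ^ (p / 2) * bw c N x := by
    intro x
    have h := broad_narrow (grid m) (fun J => extension A (dsq m J) g x) R 𝒯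
      (fun t => stripFinset m H (l t.1) t.2) (fun t _ => Finset.filter_subset _ _) ?_ hp1
    · rw [← extension_unitSquare_eq_sum A m hg, card_grid] at h
      refine (mul_le_mul_left h _).trans (le_of_eq ?_)
      rw [add_mul, add_mul, mul_assoc, mul_assoc, mul_assoc, Finset.sum_mul, Finset.sum_mul,
        Finset.sum_mul]
      push_cast
      rfl
    · intro S' hS' hne
      rcases hdich m ν hν S' hS' hne with ⟨I, hI, J, hJ, hIJ⟩ | ⟨i, I, hI, hSI⟩
      · refine Or.inl ⟨I, hI, J, hJ, ?_⟩
        rw [hR]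
        exact Finset.mem_filter.2 ⟨Finset.mem_product.2 ⟨hS' hI, hS' hJ⟩, hIJ⟩
      · refine Or.inr ⟨(i, strip H (l i) I), ?_, hSI⟩
        rw [h𝒯]
        exact Finset.mem_image.2
          ⟨(i, I), Finset.mem_product.2 ⟨Finset.mem_univ _, hI⟩, rfl⟩
  have hmeas : ∀ J ∈ grid m, Measurable (extension A (dsq m J) g) := fun J hJ =>
    (continuous_extension A (hgi m J hJ)).measurable
  have hbwm := measurable_bw_self c N
  have hm1 : ∀ J ∈ grid m, Measurable fun x => ‖extension A (dsq m J) g x‖ₑ ^ p * bw c N x :=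
    fun J hJ => ((hmeas J hJ).enorm.pow_const p).mul hbwm
  have hm2 : ∀ t ∈ 𝒯, Measurable fun x =>
      ‖∑ J ∈ stripFinset m H (l t.1) t.2, extension A (dsq m J) g x‖ₑ ^ p * bw c N x :=
    fun t _ => ((Finset.measurable_fun_sum _ fun J hJ =>
      hmeas J (Finset.mem_filter.1 hJ).1).enorm.pow_const p).mul hbwm
  have hRm : ∀ r ∈ R, r.1 ∈ grid m ∧ r.2 ∈ grid m ∧ Transverse A ν (dsq m r.1) (dsq m r.2) := by
    intro r hr
    rw [hR, Finset.mem_filter, Finset.mem_product] at hr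
    exact ⟨hr.1.1, hr.1.2, hr.2⟩
  have hm3 : ∀ r ∈ R, Measurable fun x => (‖extension A (dsq m r.1) g x‖ₑ *
        ‖extension A (dsq m r.2) g x‖ₑ) ^ (p / 2) * bw c N x := fun r hr =>
    (((hmeas _ (hRm r hr).1).enorm.mul (hmeas _ (hRm r hr).2.1).enorm).pow_const _).mul hbwm
  have hstr : ∑ t ∈ 𝒯, wint p (bw c N)
      (fun x => ∑ J ∈ stripFinset m H (l t.1) t.2, extension A (dsq m J) g x) ≤
      C₃ ^ p * ((n₀ * K) ^ (p - 2) * (6 * (C₁ ^ p * D ^ p * S))) := by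
    calc _ ≤ ∑ t ∈ 𝒯, C₃ ^ p * ((n₀ * K) ^ (p - 2) *
          ∑ J ∈ stripFinset m H (l t.1) t.2, wint p (bw c N) (extension A (dsq m J) g)) := by
          refine Finset.sum_le_sum fun t _ => (hflat A m N p hp h2m _ g
            (fun J hJ => hgi m J (Finset.mem_filter.1 hJ).1) _ (hW c N hN1)).trans ?_
          refine mul_le_mul_right (mul_le_mul_left
            (ENNReal.rpow_le_rpow ?_ (by linarith)) _) _
          have := card_stripFinset_le hH t.2 (hl t.1) (m := m)
          rw [hn₀, hK]
          exact_mod_cast this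
      _ ≤ _ := by
          rw [← Finset.mul_sum, ← Finset.mul_sum]
          refine mul_le_mul_right (mul_le_mul_right ?_ _) _
          exact (sum_stripFinset_le m H l 𝒯 _).trans (mul_le_mul_right hcoarse _)
  have hbroad : ∀ r ∈ R, ∫⁻ x, (‖extension A (dsq m r.1) g x‖ₑ *
        ‖extension A (dsq m r.2) g x‖ₑ) ^ (p / 2) * bw c N x ≤ b ^ p * S := by
    intro r hr
    obtain ⟨h1, h2, h3⟩ := hRm r hr
    have h := wint_le_bilinearConst hN1 hp1 (hb ▸ hbt) (R := ![dsq m r.1, dsq m r.2])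
      (by intro j; fin_cases j; exacts [isSubsquare_dsq h1, isSubsquare_dsq h2]) h3
      (g := fun _ => g) (by intro j; fin_cases j; exacts [hgi m _ h1, hgi m _ h2]) c
    rw [hlev, ← hb, Fin.prod_univ_two] at h
    refine h.trans (mul_le_mul_right ?_ _)
    have h4 : ∀ J, ∑ I ∈ grid (m + k), wint p (bw c N)
        (extension A (dsq (m + k) I ∩ dsq m J) g) ≤ S := fun J => by
      rw [hS]
      exact Finset.sum_le_sum fun I _ => wint_inter_dsq_le A p hp0 _ m k g J I
    calc _ ≤ (S * S) ^ (1 / 2 : ℝ) :=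
          ENNReal.rpow_le_rpow (mul_le_mul' (h4 _) (h4 _)) (by norm_num)
      _ = S := by
          rw [ENNReal.mul_rpow_of_nonneg _ _ (by norm_num), ← ENNReal.rpow_add_of_nonneg _ _
            (by norm_num) (by norm_num)]
          norm_num
  -- The number of pairs is at most 4^(2m). With another 4^(2m) from the broad case it accounts for
  -- the factor 4^(4m).
  have hRcard : (R.card : ℝ≥0∞) ≤ ((4 ^ m) ^ 2) ^ p := by
    have h1 : R.card ≤ (4 ^ m) ^ 2 := by
      rw [hR]
      refine (Finset.card_filter_le _ _).trans ?_
      rw [Finset.card_product, card_grid, sq]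
    calc (R.card : ℝ≥0∞) ≤ ((4 ^ m) ^ 2 : ℝ≥0∞) := by exact_mod_cast h1
      _ = ((4 ^ m) ^ 2 : ℝ≥0∞) ^ (1 : ℝ) := (ENNReal.rpow_one _).symm
      _ ≤ _ := ENNReal.rpow_le_rpow_of_exponent_le
        (one_le_pow₀ (one_le_pow₀ (by norm_num))) hp1
  have hfin2 : ∀ a : ℝ≥0∞, a ≠ ⊤ → a ^ p ≠ ⊤ := fun a ha =>
    ENNReal.rpow_ne_top_of_nonneg hp0.le ha
  have hmain : wint p (bw c N) (extension A unitSquare g) ≤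
      2 ^ p * (C₁ ^ p * D ^ p * S) +
      2 ^ p * (C₃ ^ p * ((n₀ * K) ^ (p - 2) * (6 * (C₁ ^ p * D ^ p * S)))) +
      ((4 ^ m) ^ 2) ^ p * (((4 ^ m) ^ 2) ^ p * (b ^ p * S)) := by
    refine (lintegral_mono hpt).trans ?_
    rw [lintegral_add_right' _ ((Finset.measurable_fun_sum R hm3).const_mul _).aemeasurable,
      lintegral_add_right' _ ((Finset.measurable_fun_sum 𝒯 hm2).const_mul _).aemeasurable,
      lintegral_const_mul' _ _ (hfin2 2 (by simp)), lintegral_const_mul' _ _ (hfin2 2 (by simp)),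
      lintegral_const_mul' _ _ (hfin2 _ (by finiteness)),
      lintegral_finsetSum' _ fun J hJ => (hm1 J hJ).aemeasurable,
      lintegral_finsetSum' _ fun J hJ => (hm2 J hJ).aemeasurable,
      lintegral_finsetSum' _ fun J hJ => (hm3 J hJ).aemeasurable]
    refine add_le_add (add_le_add (mul_le_mul_right hcoarse _) (mul_le_mul_right hstr _))
      (mul_le_mul_right ?_ _)
    refine (Finset.sum_le_card_nsmul _ _ _ hbroad).trans ?_
    rw [nsmul_eq_mul]
    exact mul_le_mul_left hRcard _
  refine hmain.trans ?_
  rw [← hK]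
  -- Superadditivity of the p-th power allows p-th roots to be taken term by term. Every constant
  -- must therefore appear as a p-th power.
  have hsup : ∀ a b : ℝ≥0∞, a ^ p + b ^ p ≤ (a + b) ^ p := fun a b =>
    ENNReal.add_rpow_le_rpow_add a b hp1
  refine le_trans ?_ (mul_le_mul_left (hsup _ _) S)
  rw [add_mul]
  refine add_le_add ?_ (le_of_eq ?_)
  · have e1 : (K ^ (1 - 2 / p)) ^ p = K ^ (p - 2) := by
      rw [← ENNReal.rpow_mul]; congr 1; field_simp
    have e2 : (n₀ * K : ℝ≥0∞) ^ (p - 2) ≤ n₀ ^ p * K ^ (p - 2) := by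
      rw [ENNReal.mul_rpow_of_nonneg _ _ (by linarith)]
      exact mul_le_mul_left (ENNReal.rpow_le_rpow_of_exponent_le hn₀1 (by linarith)) _
    have e3 : ∀ a : ℝ≥0∞, 1 ≤ a → 1 ≤ a ^ p := fun a ha => ENNReal.one_le_rpow ha hp0
    have e4 : 1 ≤ K ^ (p - 2) := by
      simpa using ENNReal.rpow_le_rpow hK1 (by linarith : 0 ≤ p - 2)
    have e5 : (7 : ℝ≥0∞) ≤ 7 ^ p := by
      simpa using ENNReal.rpow_le_rpow_of_exponent_le (by norm_num : (1 : ℝ≥0∞) ≤ 7) hp1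
    obtain ⟨X, hX⟩ : ∃ X, X = C₁ ^ p * D ^ p * S := ⟨_, rfl⟩
    obtain ⟨Y, hY⟩ : ∃ Y : ℝ≥0∞, Y = C₃ ^ p * (n₀ ^ p * K ^ (p - 2)) := ⟨_, rfl⟩
    have hY1 : 1 ≤ Y := by
      rw [hY]; exact one_le_mul (e3 _ hC₃1) (one_le_mul (e3 _ hn₀1) e4)
    rw [← hX]
    -- The single-cap term counts once and the strips six times, hence the 7; raising it to the
    -- power p keeps the final constant independent of p.
    calc 2 ^ p * X + 2 ^ p * (C₃ ^ p * ((n₀ * K) ^ (p - 2) * (6 * X)))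
        ≤ 2 ^ p * (Y * X) + 2 ^ p * (C₃ ^ p * (n₀ ^ p * K ^ (p - 2) * (6 * X))) :=
          add_le_add (mul_le_mul_right (le_mul_of_one_le_left' hY1) _)
            (mul_le_mul_right (mul_le_mul_right (mul_le_mul_left e2 _) _) _)
      _ = 7 * (2 ^ p * (Y * X)) := by rw [hY]; ring
      _ ≤ 7 ^ p * (2 ^ p * (Y * X)) := mul_le_mul_left e5 _
      _ = _ := by
          rw [hY, hX, ENNReal.mul_rpow_of_nonneg _ _ hp0.le, ENNReal.mul_rpow_of_nonneg _ _ hp0.le,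
            ENNReal.mul_rpow_of_nonneg _ _ hp0.le, ENNReal.mul_rpow_of_nonneg _ _ hp0.le,
            ENNReal.mul_rpow_of_nonneg _ _ hp0.le, e1,
            show (14 : ℝ≥0∞) = 7 * 2 by norm_num, ENNReal.mul_rpow_of_nonneg _ _ hp0.le]
          ring
  · rw [ENNReal.mul_rpow_of_nonneg _ _ hp0.le, show (4 : ℝ≥0∞) ^ (4 * m) =
      (4 ^ m) ^ 2 * (4 ^ m) ^ 2 by rw [← pow_mul, ← pow_add]; congr 1; ring,
      ENNReal.mul_rpow_of_nonneg _ _ hp0.le]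
    ring

end SurfaceDecoupling
end

/-! ### Lower bound for the bilinear constant at scale one -/

noncomputable section

namespace SurfaceDecoupling

lemma inv_two_pow_le_bw {x : EuclideanSpace ℝ (Fin 4)} (hx : ‖x‖ ≤ 1) :
    ENNReal.ofReal (1 / 2 ^ 100) ≤ bw 0 1 x := by
  rw [bw, ballWeight, dist_zero_right, div_one]
  refine ENNReal.ofReal_le_ofReal (one_div_le_one_div_of_le (by positivity) ?_)
  exact pow_le_pow_left₀ (by positivity) (by linarith) _

/-- A small square around a point of a given square, on which the phases with frequencies in the
unit ball are nearly constant. -/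
lemma exists_subset_extension_ge (A : Coeffs) {R : Set (ℝ × ℝ)} (hR : IsSubsquare R) :
    ∃ S : Set (ℝ × ℝ), MeasurableSet S ∧ S ⊆ R ∧ 0 < volume.real S ∧ volume S ≠ ⊤ ∧
      ∀ x, ‖x‖ ≤ 1 → volume.real S / 2 ≤ ‖extension A S (fun _ => 1) x‖ := by
  obtain ⟨-, q, l, hl, rfl⟩ := hR
  have hc : ContinuousAt (surface A) q := (continuous_surface A).continuousAt
  -- A variation 1/16 of the surface changes the phase factor by at most 2π/16 < 1/2 for frequencies
  -- in the unit ball.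
  obtain ⟨δ, hδ, hq⟩ := Metric.continuousAt_iff.1 hc (1 / 16) (by norm_num)
  obtain ⟨d, hd⟩ : ∃ d, d = min l (δ / 2) := ⟨_, rfl⟩
  have hd0 : 0 < d := by rw [hd]; positivity
  have hdl : d ≤ l := hd ▸ min_le_left _ _
  have hdδ : d < δ := (hd ▸ min_le_right _ _ : d ≤ δ / 2).trans_lt (by linarith)
  have hvol : volume (square q d) = ENNReal.ofReal d * ENNReal.ofReal d := by
    rw [square, Measure.volume_eq_prod, Measure.prod_prod, Real.volume_Icc, Real.volume_Icc,
      add_sub_cancel_left, add_sub_cancel_left]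
  have hvt : volume (square q d) ≠ ⊤ := by rw [hvol]; finiteness
  have hvr : volume.real (square q d) = d * d := by
    rw [measureReal_def, hvol, ENNReal.toReal_mul, ENNReal.toReal_ofReal hd0.le]
  refine ⟨square q d, measurableSet_square q d, ?_, by rw [hvr]; positivity, hvt, fun x hx => ?_⟩
  · exact prod_mono (Icc_subset_Icc_right (by linarith)) (Icc_subset_Icc_right (by linarith))
  have hnear : ∀ q' ∈ square q d, ‖ee (inner ℝ x (surface A q')) -
      ee (inner ℝ x (surface A q))‖ ≤ 1 / 2 := by
    intro q' hq'
    have h1 : dist q' q < δ := by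
      refine lt_of_le_of_lt ?_ hdδ
      rw [square, mem_prod, mem_Icc, mem_Icc] at hq'
      rw [Prod.dist_eq, Real.dist_eq, Real.dist_eq]
      exact max_le (abs_le.2 ⟨by linarith [hq'.1.1], by linarith [hq'.1.2]⟩)
        (abs_le.2 ⟨by linarith [hq'.2.1], by linarith [hq'.2.2]⟩)
    have h2 := hq h1
    rw [dist_eq_norm] at h2
    have e : ee (inner ℝ x (surface A q')) - ee (inner ℝ x (surface A q)) =
        ee (inner ℝ x (surface A q)) * (ee (inner ℝ x (surface A q' - surface A q)) - 1) := by
      rw [mul_sub, mul_one, ← ee_add, inner_sub_right, add_sub_cancel]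
    rw [e, norm_mul, norm_ee, one_mul]
    have h3 : |inner ℝ x (surface A q' - surface A q)| ≤ 1 / 16 :=
      (abs_real_inner_le_norm _ _).trans
        ((mul_le_of_le_one_left (norm_nonneg _) hx).trans h2.le)
    refine (norm_ee_sub_one_le _).trans ?_
    nlinarith [Real.pi_lt_four, Real.pi_pos, abs_nonneg (inner ℝ x (surface A q' - surface A q))]
  have hi1 : IntegrableOn (fun q' => ee (inner ℝ x (surface A q'))) (square q d) := by
    refine Continuous.integrableOn_Icc (a := q) (b := (q.1 + d, q.2 + d)) ?_ |>.mono_set ?_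
    · exact continuous_phase_right A x
    · exact (Icc_prod_Icc q.1 (q.1 + d) q.2 (q.2 + d)).subset
  have hi2 : IntegrableOn (fun _ : ℝ × ℝ => ee (inner ℝ x (surface A q))) (square q d) :=
    integrableOn_const hvt
  have h4 : ‖extension A (square q d) (fun _ => 1) x -
      ∫ _ in square q d, ee (inner ℝ x (surface A q))‖ ≤ 1 / 2 * volume.real (square q d) := by
    rw [extension_eq]
    simp only [one_mul]
    rw [← integral_sub hi1 hi2]
    exact norm_setIntegral_le_of_norm_le_const hvt.lt_top hnear
  rw [setIntegral_const] at h4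
  have h5 : ‖volume.real (square q d) • ee (inner ℝ x (surface A q))‖ =
      volume.real (square q d) := by
    rw [norm_smul, norm_ee, mul_one, Real.norm_of_nonneg measureReal_nonneg]
  have h6 := norm_sub_norm_le (volume.real (square q d) • ee (inner ℝ x (surface A q)))
    (extension A (square q d) (fun _ => 1) x)
  rw [norm_sub_rev, h5] at h6
  linarith

/-- The bilinear constant at scale `1` is bounded below. -/
theorem exists_le_bilinearConst_one : ∃ θ : ℝ, 0 < θ ∧ θ ≤ 1 ∧ ∀ (A : Coeffs) (p ν : ℝ), 1 ≤ p →
    (∃ R₁ R₂, IsSubsquare R₁ ∧ IsSubsquare R₂ ∧ Transverse A ν R₁ R₂) →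
    ENNReal.ofReal θ ≤ bilinearConst A 1 p ν := by
  obtain ⟨κ, hκ⟩ : ∃ κ : ℝ≥0∞, κ = ENNReal.ofReal (1 / 2 ^ 100) := ⟨_, rfl⟩
  obtain ⟨B, hB⟩ : ∃ B : Set (EuclideanSpace ℝ (Fin 4)), B = Metric.ball 0 1 := ⟨_, rfl⟩
  have hBpos : 0 < volume B := hB ▸ Metric.measure_ball_pos _ _ one_pos
  have hκ0 : κ ≠ 0 := by
    rw [hκ]; exact (ENNReal.ofReal_pos.2 (by positivity)).ne'
  obtain ⟨W, hW⟩ : ∃ W, W = ∫⁻ x, bw 0 1 x := ⟨_, rfl⟩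
  have hWt : W ≠ ⊤ := hW ▸ lintegral_bw_ne_top 0 le_rfl
  -- A ratio of weight integrals that does not depend on A, p or ν. The cap at 1 gives t^p ≤ t, so
  -- one constant serves every p.
  obtain ⟨t, ht⟩ : ∃ t, t = min 1 (κ * volume B / W) := ⟨_, rfl⟩
  have ht1 : t ≤ 1 := ht ▸ min_le_left _ _
  have htt : t ≠ ⊤ := (ht1.trans_lt ENNReal.one_lt_top).ne
  have ht0 : t ≠ 0 := by
    rw [ht]
    refine (lt_min one_pos ?_).ne'
    exact ENNReal.div_pos (mul_ne_zero hκ0 hBpos.ne') hWt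
  have htp : 0 < t.toReal := ENNReal.toReal_pos ht0 htt
  refine ⟨t.toReal / 2, by positivity, ?_, fun A p ν hp hR => ?_⟩
  · have := ENNReal.toReal_mono ENNReal.one_ne_top ht1
    rw [ENNReal.toReal_one] at this
    linarith
  by_cases hbt : bilinearConst A 1 p ν = ⊤
  · rw [hbt]; exact le_top
  have hp0 : 0 < p := by linarith
  obtain ⟨R₁, R₂, h₁, h₂, hT⟩ := hR
  obtain ⟨S₁, hS₁, hSR₁, hv₁, hvt₁, hE₁⟩ := exists_subset_extension_ge A h₁
  obtain ⟨S₂, hS₂, hSR₂, hv₂, hvt₂, hE₂⟩ := exists_subset_extension_ge A h₂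
  have hext : ∀ {S R : Set (ℝ × ℝ)}, MeasurableSet S → S ⊆ R → ∀ x,
      extension A R (S.indicator fun _ => 1) x = extension A S (fun _ => 1) x := by
    intro S R hS hSR x
    have e : (fun q => S.indicator (fun _ => (1 : ℂ)) q * ee (inner ℝ x (surface A q))) =
        S.indicator fun q => 1 * ee (inner ℝ x (surface A q)) := by
      funext q
      by_cases hq : q ∈ S <;> simp [hq]
    rw [extension_eq, extension_eq, e, setIntegral_indicator hS, inter_eq_self_of_subset_right hSR]
  have hlow : ∀ {S : Set (ℝ × ℝ)}, volume S ≠ ⊤ →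
      (∀ x, ‖x‖ ≤ 1 → volume.real S / 2 ≤ ‖extension A S (fun _ => 1) x‖) →
      ∀ x, ‖x‖ ≤ 1 → volume S / 2 ≤ ‖extension A S (fun _ => 1) x‖ₑ := by
    intro S hS h x hx
    have := ENNReal.ofReal_le_ofReal (h x hx)
    rwa [ofReal_norm, ENNReal.ofReal_div_of_pos two_pos, measureReal_def,
      ENNReal.ofReal_toReal hS, ENNReal.ofReal_ofNat] at this
  have hup : ∀ {S R : Set (ℝ × ℝ)}, MeasurableSet S → S ⊆ R → volume S ≠ ⊤ → ∀ T,
      wint p (bw 0 1) (extension A (T ∩ R) (S.indicator fun _ => 1)) ≤ volume S ^ p * W := by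
    intro S R hS hSR hSt T
    rw [hW, ← lintegral_const_mul' _ _ (ENNReal.rpow_ne_top_of_nonneg hp0.le hSt)]
    refine lintegral_mono fun x => mul_le_mul_left (ENNReal.rpow_le_rpow ?_ hp0.le) _
    rw [extension_eq]
    refine (enorm_integral_le_lintegral_enorm _).trans ?_
    calc _ ≤ ∫⁻ q in T ∩ R, S.indicator (fun _ => 1) q := by
          refine lintegral_mono fun q => ?_
          by_cases hq : q ∈ S
          · simp [hq, ← ofReal_norm, norm_ee]
          · simp [hq]
      _ ≤ ∫⁻ q, S.indicator (fun _ => 1) q := setLIntegral_le_lintegral _ _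
      _ = volume S := lintegral_indicator_one hS
  have hmain := wint_le_bilinearConst le_rfl hp hbt (R := ![R₁, R₂])
    (by intro j; fin_cases j; exacts [h₁, h₂]) hT
    (g := ![S₁.indicator fun _ => 1, S₂.indicator fun _ => 1])
    (by
      intro j; fin_cases j
      exacts [((integrable_indicator_iff hS₁).2 (integrableOn_const hvt₁)).integrableOn,
        ((integrable_indicator_iff hS₂).2 (integrableOn_const hvt₂)).integrableOn]) 0
  have hlev : level 1 = 0 := by simp [level]
  have hgrid : grid 0 = {(0, 0)} := by decide
  rw [hlev, hgrid, Fin.prod_univ_two, Finset.sum_singleton, Finset.sum_singleton] at hmain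
  simp only [Matrix.cons_val_zero, Matrix.cons_val_one] at hmain
  -- Both sides scale with V^(p/2), which cancels. The bound is therefore independent of the size of
  -- the transverse squares.
  obtain ⟨V, hV⟩ : ∃ V, V = volume S₁ * volume S₂ := ⟨_, rfl⟩
  have hV0 : V ≠ 0 := by
    rw [hV]
    refine mul_ne_zero ?_ ?_
    · intro h; simp [measureReal_def, h] at hv₁
    · intro h; simp [measureReal_def, h] at hv₂
  have hVt : V ≠ ⊤ := hV ▸ ENNReal.mul_ne_top hvt₁ hvt₂
  have hVp0 : V ^ (p / 2) ≠ 0 := (ENNReal.rpow_pos (pos_iff_ne_zero.2 hV0) hVt).ne'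
  have hVpt : V ^ (p / 2) ≠ ⊤ := ENNReal.rpow_ne_top_of_nonneg (by linarith) hVt
  have hright : bilinearConst A 1 p ν ^ p * (wint p (bw 0 1)
      (extension A (dsq 0 (0, 0) ∩ R₁) (S₁.indicator fun _ => 1)) * wint p (bw 0 1)
      (extension A (dsq 0 (0, 0) ∩ R₂) (S₂.indicator fun _ => 1))) ^ (1 / 2 : ℝ) ≤
      V ^ (p / 2) * (bilinearConst A 1 p ν ^ p * W) := by
    rw [mul_left_comm]
    refine mul_le_mul_right ((ENNReal.rpow_le_rpow (mul_le_mul' (hup hS₁ hSR₁ hvt₁ _)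
      (hup hS₂ hSR₂ hvt₂ _)) (by norm_num)).trans (le_of_eq ?_)) _
    rw [mul_mul_mul_comm, ← ENNReal.mul_rpow_of_nonneg _ _ hp0.le, ← hV,
      ENNReal.mul_rpow_of_nonneg _ _ (by norm_num), ← ENNReal.rpow_mul,
      ENNReal.mul_rpow_of_nonneg W W (by norm_num), ← ENNReal.rpow_add_of_nonneg _ _
        (by norm_num) (by norm_num)]
    rw [show p * (1 / 2) = p / 2 by ring, show (1 / 2 + 1 / 2 : ℝ) = 1 by norm_num,
      ENNReal.rpow_one]
  have hleft : V ^ (p / 2) * ((1 / 2) ^ p * (κ * volume B)) ≤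
      ∫⁻ x, (‖extension A R₁ (S₁.indicator fun _ => 1) x‖ₑ *
        ‖extension A R₂ (S₂.indicator fun _ => 1) x‖ₑ) ^ (p / 2) * bw 0 1 x := by
    calc _ = ∫⁻ _ in B, V ^ (p / 2) * ((1 / 2) ^ p * κ) := by
          rw [setLIntegral_const]; ring
      _ ≤ ∫⁻ x in B, (‖extension A R₁ (S₁.indicator fun _ => 1) x‖ₑ *
        ‖extension A R₂ (S₂.indicator fun _ => 1) x‖ₑ) ^ (p / 2) * bw 0 1 x := by
          refine setLIntegral_mono' (hB ▸ measurableSet_ball) fun x hx => ?_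
          have hx1 : ‖x‖ ≤ 1 := by
            rw [hB, mem_ball_zero_iff] at hx; exact hx.le
          rw [← mul_assoc]
          refine mul_le_mul' ?_ (hκ ▸ inv_two_pow_le_bw hx1)
          have e : V ^ (p / 2) * (1 / 2) ^ p = (volume S₁ / 2 * (volume S₂ / 2)) ^ (p / 2) := by
            rw [show (1 / 2 : ℝ≥0∞) ^ p = ((1 / 2) ^ (2 : ℝ)) ^ (p / 2) by
              rw [← ENNReal.rpow_mul]; congr 1; ring,
              ← ENNReal.mul_rpow_of_nonneg _ _ (by linarith), hV]
            congr 1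
            rw [ENNReal.rpow_two, div_eq_mul_inv, div_eq_mul_inv, div_eq_mul_inv]
            ring
          rw [e, hext hS₁ hSR₁, hext hS₂ hSR₂]
          exact ENNReal.rpow_le_rpow (mul_le_mul' (hlow hvt₁ hE₁ x hx1) (hlow hvt₂ hE₂ x hx1))
            (by linarith)
      _ ≤ _ := setLIntegral_le_lintegral _ _
  have h1 := (hleft.trans hmain).trans hright
  rw [ENNReal.mul_le_mul_iff_right hVp0 hVpt] at h1
  have h2 : (1 / 2) ^ p * (κ * volume B / W) ≤ bilinearConst A 1 p ν ^ p := by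
    rw [← mul_div_assoc]
    exact ENNReal.div_le_of_le_mul h1
  have h3 : t ^ p ≤ κ * volume B / W := by
    calc t ^ p ≤ t ^ (1 : ℝ) := ENNReal.rpow_le_rpow_of_exponent_ge ht1 hp
      _ = t := ENNReal.rpow_one t
      _ ≤ _ := ht ▸ min_le_right _ _
  rw [← ENNReal.rpow_le_rpow_iff hp0]
  refine le_trans (le_of_eq ?_) ((mul_le_mul_right h3 _).trans h2)
  rw [ENNReal.ofReal_div_of_pos two_pos, ENNReal.ofReal_toReal htt, ENNReal.ofReal_ofNat,
    ← ENNReal.mul_rpow_of_nonneg _ _ hp0.le, one_div, mul_comm, div_eq_mul_inv]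

end SurfaceDecoupling
end

/-! ### Iteration over scales -/

noncomputable section

namespace SurfaceDecoupling

/-- The supremum of rescaled bilinear decoupling constants over all scales up to `N`. -/
def bilinearSup (A : Coeffs) (ν N p : ℝ) : ℝ≥0∞ :=
  ⨆ M ∈ Icc (1 : ℝ) N, ENNReal.ofReal ((M / N) ^ (1 / p - 1 / 2)) * bilinearConst A M p ν

lemma bilinearConst_le_bilinearSup (A : Coeffs) {N : ℝ} (hN : 1 ≤ N) (p ν : ℝ) :
    bilinearConst A N p ν ≤ bilinearSup A ν N p := by
  refine le_trans (le_of_eq ?_) (le_iSup₂ (f := fun M (_ : M ∈ Icc (1 : ℝ) N) =>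
    ENNReal.ofReal ((M / N) ^ (1 / p - 1 / 2)) * bilinearConst A M p ν) N ⟨hN, le_rfl⟩)
  rw [div_self (by linarith), Real.one_rpow, ENNReal.ofReal_one, one_mul]

/-- The term M = 1 carries the weight N^(1/2 - 1/p), which is at least 1 because p ≥ 2. -/
lemma bilinearConst_one_le_bilinearSup (A : Coeffs) {N p : ℝ} (hN : 1 ≤ N) (hp : 2 ≤ p) (ν : ℝ) :
    bilinearConst A 1 p ν ≤ bilinearSup A ν N p := by
  refine le_trans ?_ (le_iSup₂ (f := fun M (_ : M ∈ Icc (1 : ℝ) N) =>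
    ENNReal.ofReal ((M / N) ^ (1 / p - 1 / 2)) * bilinearConst A M p ν) 1 ⟨le_rfl, hN⟩)
  refine le_mul_of_one_le_left' (ENNReal.one_le_ofReal.2 ?_)
  refine Real.one_le_rpow_of_pos_of_le_one_of_nonpos (by positivity)
    ((div_le_one (by linarith)).2 hN) ?_
  have := one_div_le_one_div_of_le two_pos hp
  linarith

/-- Replacing N/4^m by N multiplies the weight of each M by 4^(m(1/2 - 1/p)) = (2^m)^(1 - 2/p), so
the loss of one recursion step is absorbed exactly. -/
lemma rpow_mul_bilinearSup_le (A : Coeffs) {N p : ℝ} (m : ℕ) (hN : 0 < N) (ν : ℝ) :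
    ((2 : ℝ≥0∞) ^ m) ^ (1 - 2 / p) * bilinearSup A ν (N / 4 ^ m) p ≤ bilinearSup A ν N p := by
  have h4 : (1 : ℝ) ≤ 4 ^ m := one_le_pow₀ (by norm_num)
  simp only [bilinearSup, ENNReal.mul_iSup]
  refine iSup₂_le fun M hM => ?_
  have hM0 : 0 < M := by linarith [hM.1]
  refine le_trans (le_of_eq ?_) (le_iSup₂ (f := fun M (_ : M ∈ Icc (1 : ℝ) N) =>
    ENNReal.ofReal ((M / N) ^ (1 / p - 1 / 2)) * bilinearConst A M p ν) M
    ⟨hM.1, hM.2.trans (div_le_self hN.le h4)⟩)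
  rw [← mul_assoc]
  congr 1
  have e1 : ((2 : ℝ≥0∞) ^ m) ^ (1 - 2 / p) = ENNReal.ofReal ((2 ^ m : ℝ) ^ (1 - 2 / p)) := by
    rw [← ENNReal.ofReal_rpow_of_pos (by positivity), ENNReal.ofReal_pow two_pos.le,
      ENNReal.ofReal_ofNat]
  have e2 : (4 ^ m : ℝ) = (2 ^ m) ^ (2 : ℝ) := by
    rw [Real.rpow_two, ← pow_mul, mul_comm, pow_mul]; norm_num
  rw [e1, ← ENNReal.ofReal_mul (by positivity)]
  congr 1
  rw [div_div_eq_mul_div, mul_div_right_comm, Real.mul_rpow (by positivity) (by positivity),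
    mul_left_comm]
  conv_rhs => rw [← mul_one ((M / N) ^ (1 / p - 1 / 2))]
  congr 1
  rw [e2, ← Real.rpow_mul (by positivity), ← Real.rpow_add (by positivity),
    show 1 - 2 / p + 2 * (1 / p - 1 / 2) = 0 by ring, Real.rpow_zero]

/-- Iteration of the broad-narrow step. -/
lemma linearConst_le_of_step {A : Coeffs} {m : ℕ} {ν p : ℝ} {C B : ℝ≥0∞} (hp : 2 ≤ p)
    (hstep : ∀ N, 4 ^ m ≤ N → linearConst A N p ≤
      C * ((2 : ℝ≥0∞) ^ m) ^ (1 - 2 / p) * linearConst A (N / 4 ^ m) p +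
        B * bilinearConst A N p ν)
    (hbase : ∀ N, 1 ≤ N → N < 4 ^ m → linearConst A N p ≤ B * bilinearConst A 1 p ν) (j : ℕ) :
    ∀ N, 1 ≤ N → N < (4 ^ m) ^ (j + 1) →
      linearConst A N p ≤ B * (C + 1) ^ j * bilinearSup A ν N p := by
  induction j with
  | zero =>
    intro N hN hNm
    rw [zero_add, pow_one] at hNm
    rw [pow_zero, mul_one]
    exact (hbase N hN hNm).trans
      (mul_le_mul_right (bilinearConst_one_le_bilinearSup A hN hp ν) _)
  | succ j ih =>
    intro N hN hNm
    have hC1 : (1 : ℝ≥0∞) ≤ (C + 1) ^ j := one_le_pow₀ le_add_self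
    rcases lt_or_ge N (4 ^ m) with h | h
    · refine (hbase N hN h).trans (mul_le_mul' (le_mul_of_one_le_right' ?_)
        (bilinearConst_one_le_bilinearSup A hN hp ν))
      exact one_le_pow₀ le_add_self
    have h4 : (0 : ℝ) < 4 ^ m := by positivity
    have h1 := ih (N / 4 ^ m) ((one_le_div h4).2 h)
      ((div_lt_iff₀ h4).2 (by rwa [← pow_succ]))
    -- With the absorbed step the coefficients satisfy C(C+1)^j + 1 ≤ (C+1)^(j+1), which is why C +
    -- 1 is iterated instead of C.
    calc linearConst A N p
        ≤ C * ((2 : ℝ≥0∞) ^ m) ^ (1 - 2 / p) *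
            (B * (C + 1) ^ j * bilinearSup A ν (N / 4 ^ m) p) + B * bilinearSup A ν N p :=
          (hstep N h).trans (add_le_add (mul_le_mul_right h1 _)
            (mul_le_mul_right (bilinearConst_le_bilinearSup A hN p ν) _))
      _ = C * (B * (C + 1) ^ j) *
            (((2 : ℝ≥0∞) ^ m) ^ (1 - 2 / p) * bilinearSup A ν (N / 4 ^ m) p) +
            B * bilinearSup A ν N p := by ring
      _ ≤ C * (B * (C + 1) ^ j) * bilinearSup A ν N p +
            B * (C + 1) ^ j * bilinearSup A ν N p :=
          add_le_add (mul_le_mul_right (rpow_mul_bilinearSup_le A m (by linarith) ν) _)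
            (mul_le_mul_left (le_mul_of_one_le_right' hC1) _)
      _ = _ := by ring

lemma tendsto_level_one_div : Tendsto (fun ν : ℝ => level (1 / ν)) (𝓝[>] 0) atTop := by
  have h1 : Tendsto (Nat.log 4) atTop atTop :=
    tendsto_atTop_atTop_of_monotone Nat.log_monotone
      fun b => ⟨4 ^ b, (Nat.log_pow (by norm_num) b).ge⟩
  simp only [one_div]
  exact h1.comp (tendsto_nat_floor_atTop.comp tendsto_inv_nhdsGT_zero)

/-- A power of the number of steps is a small power of the scale. -/
lemma pow_le_rpow_of_pow_le {a b N : ℝ} {j : ℕ} (ha : 1 ≤ a) (hb : 1 < b) (h : b ^ j ≤ N) :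
    a ^ j ≤ N ^ (Real.log a / Real.log b) := by
  have hb0 : 0 < b := by linarith
  have e : b ^ (Real.log a / Real.log b) = a := by
    rw [Real.rpow_def_of_pos hb0, mul_div_cancel₀ _ (Real.log_pos hb).ne', Real.exp_log (by linarith)]
  calc a ^ j = (b ^ (Real.log a / Real.log b)) ^ j := by rw [e]
    _ = (b ^ j) ^ (Real.log a / Real.log b) := by
        rw [← Real.rpow_natCast, ← Real.rpow_natCast, ← Real.rpow_mul hb0.le,
          ← Real.rpow_mul hb0.le, mul_comm]
    _ ≤ _ := Real.rpow_le_rpow (by positivity) h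
        (div_nonneg (Real.log_nonneg ha) (Real.log_pos hb).le)

end SurfaceDecoupling
end

/-! ### Choice of the scale m and conclusion -/

theorem theorem5p2 (L : ℝ) (hL : 0 < L) :
    ∃ (C : ℝ → ℝ) (ε : ℝ → ℝ → ℝ),
      (∀ ν, 0 < C ν) ∧
      (∀ p, 2 ≤ p → Tendsto (fun ν => ε ν p) (𝓝[>] 0) (𝓝 0)) ∧
      ∀ ν p : ℝ, 0 < ν → ν ≤ 1 / 10 → 2 ≤ p →
        ∀ A ∈ admissible L,
          (∃ R₁ R₂, IsSubsquare R₁ ∧ IsSubsquare R₂ ∧ Transverse A ν R₁ R₂) →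
          ∀ N : ℝ, 1 ≤ N →
            linearConst A N p ≤
              ENNReal.ofReal (C ν * N ^ ε ν p) *
                ⨆ M ∈ Icc (1 : ℝ) N,
                  ENNReal.ofReal ((M / N) ^ (1 / p - 1 / 2)) * bilinearConst A M p ν := by
  obtain ⟨C₀, hC₀, hC₀1, hstep⟩ := exists_linearConst_le_add hL
  obtain ⟨θ, hθ, hθ1, hone⟩ := exists_le_bilinearConst_one
  obtain ⟨a, ha⟩ : ∃ a : ℝ, a = C₀.toReal + 1 := ⟨_, rfl⟩
  have ha1 : 1 ≤ a := by rw [ha]; linarith [ENNReal.toReal_nonneg (a := C₀)]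
  have haC : ENNReal.ofReal a = C₀ + 1 := by
    rw [ha, ENNReal.ofReal_add ENNReal.toReal_nonneg zero_le_one, ENNReal.ofReal_toReal hC₀,
      ENNReal.ofReal_one]
  -- Here `level (1 / ν)` is the m of the recursion. Division by θ lets the same constant cover the
  -- scales below 4^m through the lower bound on the bilinear constant at scale 1. The exponent does
  -- not depend on p.
  refine ⟨fun ν => 4 ^ (4 * level (1 / ν)) / θ,
    fun ν _ => Real.log a / Real.log (4 ^ level (1 / ν)), fun ν => by positivity, fun p _ => ?_, ?_⟩
  · simp only [Real.log_pow]
    exact (((tendsto_natCast_atTop_atTop (R := ℝ)).comp tendsto_level_one_div).atTop_mul_const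
      (Real.log_pos (by norm_num))).const_div_atTop _
  intro ν p hν hν1 hp A hA hR N hN
  obtain ⟨m, hm⟩ : ∃ m, m = level (1 / ν) := ⟨_, rfl⟩
  have hν10 : 10 ≤ 1 / ν := by rw [le_div_iff₀ hν]; linarith
  have hmν : ν ≤ 1 / 4 ^ m := by
    have h := pow_level_le (by linarith : 1 ≤ 1 / ν)
    rw [← hm, le_div_iff₀ hν] at h
    rw [le_div_iff₀ (by positivity)]
    linarith
  -- The bound ν ≤ 1/10 keeps m positive, so that 4^m exceeds 1 and the scales really decrease.
  have hm0 : m ≠ 0 := by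
    rintro rfl
    have h := lt_pow_level_succ (1 / ν)
    rw [← hm] at h
    norm_num at h hν10
    linarith
  have h4m : (1 : ℝ) < 4 ^ m := one_lt_pow₀ (by norm_num) hm0
  obtain ⟨j, hj1, hj2⟩ := exists_nat_pow_near hN h4m
  obtain ⟨B, hB⟩ : ∃ B : ℝ≥0∞, B = ENNReal.ofReal (4 ^ (4 * m) / θ) := ⟨_, rfl⟩
  have h4 : ∀ n : ℕ, ENNReal.ofReal (4 ^ n) = 4 ^ n := fun n => by
    rw [ENNReal.ofReal_pow (by norm_num), ENNReal.ofReal_ofNat]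
  have hB1 : 4 ^ (4 * m) ≤ B := by
    rw [hB, ← h4]
    exact ENNReal.ofReal_le_ofReal (le_div_self (by positivity) hθ hθ1)
  have hBθ : B * ENNReal.ofReal θ = 4 ^ (4 * m) := by
    rw [hB, ← ENNReal.ofReal_mul (by positivity), div_mul_cancel₀ _ hθ.ne', h4]
  have hmain := linearConst_le_of_step (A := A) (m := m) (ν := ν) (C := C₀) (B := B) hp
    (fun N hN => (hstep A hA m ν N p hmν hN hp).trans
      (add_le_add_right (mul_le_mul_left hB1 _) _)) ?_ j N hN hj2
  · dsimp only
    rw [← hm]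
    refine hmain.trans (mul_le_mul_left ?_ _)
    rw [ENNReal.ofReal_mul (by positivity), ← hB, ← haC, ← ENNReal.ofReal_pow (by linarith)]
    exact mul_le_mul_right (ENNReal.ofReal_le_ofReal (pow_le_rpow_of_pow_le ha1 h4m hj1)) _
  -- Below 4^m the trivial bound by the number of caps suffices.
  · intro N hN hNm
    have hlt : level N < m :=
      (pow_lt_pow_iff_right₀ (by norm_num : (1 : ℝ) < 4)).1 ((pow_level_le hN).trans_lt hNm)
    calc linearConst A N p ≤ 4 ^ level N := linearConst_le_card A N (by linarith)
      _ ≤ 4 ^ (4 * m) := pow_le_pow_right₀ (by norm_num) (by omega)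
      _ = B * ENNReal.ofReal θ := hBθ.symm
      _ ≤ _ := mul_le_mul_right (hone A p ν (by linarith) hR) _
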